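/- Let $d\ge 2$, let $\mathbb S^d$ be the unit sphere of $\mathbb R^{d+1}$, let $e\in\mathbb S^d$, and let $\mathbb S_e^+=\{u\in\mathbb S^d:\langle u,e\rangle\ge 0\}$ be the closed halfsphere with centre $e$. For $n\ge d+1$ let $X_1,\dots,X_n$ be stochastically independent random points, each uniformly distributed in $\mathbb S_e^+$ (with respect to spherical Lebesgue measure), and let $$P_n=\mathbb S^d\cap\operatorname{pos}\{X_1,\dots,X_n\}$$ be their spherical convex hull, where $\operatorname{pos}$ denotes the positive hull in $\mathbb R^{d+1}$. The surface area $S(P)$ of a spherical polytope $P\subset\mathbb S^d$ is the sum, over the facets ($(d-1)$-dimensional faces) $F$ of $P$, of the $(d-1)$-dimensional spherical Lebesgue measure of $F$ in the great subsphere spanned by $F$. Put $\omega_d=2\pi^{d/2}/\Gamma(d/2)$. Then for every $n\ge d+1$ $$\mathbb E\,S(P_n)=\frac{d\,\omega_d}{\pi^d}\binom nd\int_0^\pi\Bigl(1-\frac x\pi\Bigr)^{n-d}\sin^{d-1}x\,\mathrm dx .$$ Further, as $n\to\infty$, $$\mathbb E\,S(P_n)=\omega_d\left(1-\binom{d+1}{3}\pi^2\,n^{-2}+O(n^{-3})\right),$$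 where the implied constant depends only on $d$. -/

import Mathlib

open MeasureTheory ProbabilityTheory

open scoped ENNReal

namespace RandomSphericalPolytope

/-- The ambient Euclidean space `ℝ^{d+1}` of the sphere `S^d`. -/
abbrev Ambient (d : ℕ) : Type := EuclideanSpace ℝ (Fin (d + 1))

/-- The unit sphere `S^d` of `ℝ^{d+1}`. -/
abbrev Sph (d : ℕ) : Set (Ambient d) := Metric.sphere (0 : Ambient d) 1

/-- `ω_k = 2 π^{k/2} / Γ(k/2)`, the total measure of the unit sphere of `ℝ^k`. -/
noncomputable def omega (k : ℕ) : ℝ :=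
  2 * Real.pi ^ ((k : ℝ) / 2) / Real.Gamma ((k : ℝ) / 2)

/-- Spherical Lebesgue measure `σ` on `S^d`. -/
noncomputable def sigma (d : ℕ) : Measure (Sph d) :=
  (volume : Measure (Ambient d)).toSphere

/-- The closed halfsphere `{u ∈ S^d : ⟨u, e⟩ ≥ 0}`. -/
def halfsphere {d : ℕ} (e : Sph d) : Set (Sph d) :=
  {u | 0 ≤ inner ℝ (u : Ambient d) (e : Ambient d)}

/-- The uniform probability measure on the closed halfsphere: `σ` restricted to the halfsphere,
divided by the total mass of the halfsphere. -/
noncomputable def uniformHalfsphere {d : ℕ} (e : Sph d) : Measure (Sph d) :=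
  (sigma d)[|halfsphere e]

/-- The spherical convex hull `conv_s A = S^d ∩ pos A`, where `pos A` is the positive hull
(the set of all finite linear combinations of points of `A` with nonnegative coefficients). -/
def sphericalHull {d : ℕ} (A : Set (Ambient d)) : Set (Ambient d) :=
  Sph d ∩ (PointedCone.hull ℝ A : Set (Ambient d))

/-- `F` is a facet (a `(d-1)`-dimensional face) of the spherical polytope `P ⊆ S^d`: it is the
intersection of `P` with a hyperplane through `0` that has `P` on one side, and its linear hull
has dimension `d`. -/
def IsFacet {d : ℕ} (P F : Set (Ambient d)) : Prop :=
  (∃ v : Ambient d, (∀ x ∈ P, inner ℝ v x ≤ 0) ∧ F = {x ∈ P | inner ℝ v x = 0}) ∧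
    Module.finrank ℝ (Submodule.span ℝ F) = d

/-- Spherical Lebesgue measure on the great subsphere `L ∩ S^d`, for a linear subspace `L`, as a
measure on `ℝ^{d+1}`. It is induced by Lebesgue measure of the Euclidean space `L`. -/
noncomputable def greatSubsphereMeasure {d : ℕ} (L : Submodule ℝ (Ambient d)) :
    Measure (Ambient d) :=
  ((volume : Measure L).toSphere).map
    (fun x : Metric.sphere (0 : L) 1 => ((x : L) : Ambient d))

/-- The surface area of a spherical polytope `P`: the sum over its facets `F` of the
`(d-1)`-dimensional spherical Lebesgue measure of `F` in the great subsphere spanned by `F`. -/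
noncomputable def surfaceArea {d : ℕ} (P : Set (Ambient d)) : ℝ≥0∞ :=
  ∑' F : {F : Set (Ambient d) // IsFacet P F},
    greatSubsphereMeasure (Submodule.span ℝ F.1) F.1

/-- The spherical polytope spanned by `n` points of `S^d`. -/
def polytope {d n : ℕ} (x : Fin n → Sph d) : Set (Ambient d) :=
  sphericalHull (Set.range fun i => (x i : Ambient d))

end RandomSphericalPolytope

namespace RandomSphericalPolytope

/-! The uniform law on the halfsphere is replaced by a Gaussian one. If (h, z) in ℝ × ℝ^d has the
standard Gaussian density conditioned on h ≥ 0, its direction is uniform in the halfsphere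
(`map_direction_halfGaussian`), and positive rescaling of the points does not change their spherical
hull. Almost surely the points are in general position (`ae_generic`). Then the facets correspond to
the d-element index sets I whose hyperplane leaves all other points strictly on one side
(`GeneralPosition.surfaceArea_eq`, `supports_iff_oneSided`), and the content of such a facet is, up
to a radial constant, the Gaussian integral over the cone spanned by the points of I
(`greatSubsphereMeasure_hull_vec`). The expected area is therefore C(n, d) times the mean
contribution of one I (`lintegral_facetTerm`).

The points of I span a hyperplane h = ⟨a, z⟩. For fixed horizontal parts Z the heights are Z a, with
Jacobian |det Z|; the cone integral brings a second factor |det Z|. Integrating Z out leaves a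
constant times (1 + |a|²)^(-(d+1)/2), the density of the slope of a uniformly distributed hyperplane
(`lintegral_halfGaussian_coneGaussian`). A further point lies below the hyperplane with probability
x/π and above it with probability 1 - x/π, where x = arctan |a| (`halfGaussian_below`,
`halfGaussian_above`). Polar coordinates and |a| = tan x turn the density of slopes into sin^(d-1) x
dx on (0, π/2), and the reflection x ↦ π - x merges the two sides into one integral over (0, π)
(`lintegral_slope_density`, `integral_slope_sum`).

The constant is the delicate point, because all points and also the coefficients c of the cone are
restricted to half-spaces or orthants. Whitening the form |z|² + ⟨a, z⟩² and transposing the matrix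
of points leaves one row restricted to the orthant, while all rows become Gaussian with precision 1
+ c cᵀ (`lintegral_simplex_of_slope`). The free rows contribute the second moment of a determinant.
The remaining integral over two orthants is evaluated by an auxiliary radial variable and the
Cauchy–Schlömilch substitution, after which it factors into planar integrals equal to 1
(`setLIntegral_orthants_kernel`). Legendre duplication simplifies the result (`facetConst_eq`).

For the asymptotics, sin^m x = x^m - (m/6) x^(m+2) + O(x^(m+3)) is integrated against (1 - x/π)^N by
exact Beta integrals (`exists_abs_integral_sub_le`). -/

@[fun_prop]
theorem measurable_dotProduct {α : Type*} [MeasurableSpace α] {n : ℕ} {f g : α → Fin n → ℝ}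
    (hf : Measurable f) (hg : Measurable g) : Measurable fun x => f x ⬝ᵥ g x := by
  simp only [dotProduct]
  fun_prop

theorem dotProduct_self_nonneg_real {n : ℕ} (c : Fin n → ℝ) : 0 ≤ c ⬝ᵥ c :=
  Finset.sum_nonneg fun _ _ => mul_self_nonneg _

/-! ### Linear changes of variables and Tonelli for powers of a measure -/

section LinearChange

variable {E : Type*} [NormedAddCommGroup E] [NormedSpace ℝ E] [MeasurableSpace E] [BorelSpace E]
  [FiniteDimensional ℝ E]

/-- Linear change of variables for the lower Lebesgue integral. -/
theorem lintegral_comp_linearMap (μ : Measure E) [μ.IsAddHaarMeasure] (f : E →ₗ[ℝ] E)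
    (hf : LinearMap.det f ≠ 0) {F : E → ℝ≥0∞} (hF : Measurable F) :
    ∫⁻ x, F x ∂μ = ENNReal.ofReal |LinearMap.det f| * ∫⁻ x, F (f x) ∂μ := by
  have hc : Measurable f := f.continuous_of_finiteDimensional.measurable
  rw [← lintegral_map hF hc, Measure.map_linearMap_addHaar_eq_smul_addHaar μ hf,
    lintegral_smul_measure, smul_eq_mul, ← mul_assoc, ← ENNReal.ofReal_mul (abs_nonneg _),
    ← abs_mul, mul_inv_cancel₀ hf]
  simp

end LinearChange

/-- Change of variables by an invertible matrix. -/
theorem lintegral_comp_mulVec {d : ℕ} (M : Matrix (Fin d) (Fin d) ℝ) (hM : M.det ≠ 0)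
    {F : (Fin d → ℝ) → ℝ≥0∞} (hF : Measurable F) :
    ∫⁻ x, F x = ENNReal.ofReal |M.det| * ∫⁻ x, F (M.mulVec x) := by
  have h := lintegral_comp_linearMap volume (Matrix.toLin' M) (by simpa using hM) hF
  simpa using h

/-- Change of variables by an invertible matrix acting on each vector of a finite family. -/
theorem lintegral_comp_mulVec_pi {k d : ℕ} (M : Matrix (Fin d) (Fin d) ℝ) (hM : M.det ≠ 0)
    {F : (Fin k → Fin d → ℝ) → ℝ≥0∞} (hF : Measurable F) :
    ∫⁻ Z, F Z = ENNReal.ofReal |M.det| ^ k *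
      ∫⁻ Z : Fin k → Fin d → ℝ, F (fun i => M.mulVec (Z i)) := by
  have hdet : LinearMap.det (LinearMap.pi fun i : Fin k =>
      (Matrix.toLin' M) ∘ₗ (LinearMap.proj i : (Fin k → Fin d → ℝ) →ₗ[ℝ] (Fin d → ℝ))) =
      M.det ^ k := by
    rw [LinearMap.det_pi]; simp
  have h := lintegral_comp_linearMap volume _ (by rw [hdet]; exact pow_ne_zero _ hM) hF
  rw [hdet, abs_pow, ENNReal.ofReal_pow (abs_nonneg _)] at h
  exact h

/-- Lebesgue measure on square matrices is invariant under transposition. -/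
theorem lintegral_comp_transpose {d : ℕ} {F : (Fin d → Fin d → ℝ) → ℝ≥0∞} (hF : Measurable F) :
    ∫⁻ Z, F Z = ∫⁻ Z : Fin d → Fin d → ℝ, F (fun i j => Z j i) := by
  let f : (Fin d → Fin d → ℝ) →ₗ[ℝ] (Fin d → Fin d → ℝ) :=
    { toFun := fun Z i j => Z j i, map_add' := fun _ _ => rfl, map_smul' := fun _ _ => rfl }
  -- Transposition is an involution, so its determinant is ±1 and no permutation sign has to be
  -- computed.
  have hff : LinearMap.det f * LinearMap.det f = 1 := by
    rw [← LinearMap.det_comp]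
    exact LinearMap.det_id
  have h1 : |LinearMap.det f| = 1 := by
    rcases mul_self_eq_one_iff.1 hff with h | h <;> simp [h]
  have h := lintegral_comp_linearMap volume f (fun h0 => by simp [h0] at h1) hF
  rw [h1] at h
  simpa [f] using h

/-- Tonelli for the first coordinate of a finite power. -/
theorem lintegral_pi_cons {k : ℕ} {α : Type*} [MeasurableSpace α] (μ : Measure α) [SigmaFinite μ]
    {F : (Fin (k + 1) → α) → ℝ≥0∞} (hF : Measurable F) :
    ∫⁻ x, F x ∂(Measure.pi fun _ => μ) =
      ∫⁻ r, ∫⁻ S : Fin k → α, F (Fin.cons r S) ∂(Measure.pi fun _ => μ) ∂μ := by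
  have hmp := (measurePreserving_piFinSuccAbove (fun _ : Fin (k + 1) => μ) 0).symm
  have h := lintegral_prod (μ := μ) (ν := Measure.pi fun _ : Fin k => μ) _
    (hF.comp hmp.measurable).aemeasurable
  rw [← hmp.lintegral_comp hF]
  refine h.trans ?_
  simp [MeasurableEquiv.piFinSuccAbove_symm_apply, Fin.insertNthEquiv]

/-- Tonelli for finite products of functions of one coordinate each. -/
theorem lintegral_pi_prod {k : ℕ} {α : Type*} [MeasurableSpace α] (μ : Measure α) [SigmaFinite μ]
    {f : Fin k → α → ℝ≥0∞} (hf : ∀ i, Measurable (f i)) :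
    ∫⁻ x : Fin k → α, ∏ i, f i (x i) ∂(Measure.pi fun _ => μ) = ∏ i, ∫⁻ x, f i x ∂μ := by
  induction k with
  | zero => simp
  | succ k ih =>
    have hm : ∀ n : ℕ, ∀ g : Fin n → α → ℝ≥0∞, (∀ i, Measurable (g i)) →
        Measurable fun y : Fin n → α => ∏ i, g i (y i) := fun n g hg =>
      Finset.measurable_prod _ fun i _ => (hg i).comp (measurable_pi_apply i)
    rw [lintegral_pi_cons μ (hm _ f hf), Fin.prod_univ_succ, ← ih fun i => hf i.succ,
      ← lintegral_mul_const _ (hf 0)]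
    refine lintegral_congr fun r => ?_
    simp only [Fin.prod_univ_succ, Fin.cons_zero, Fin.cons_succ]
    exact lintegral_const_mul _ (hm _ _ fun i => hf i.succ)

/-- A finite power of a measure with density is the power measure with product density. -/
theorem pi_withDensity {k : ℕ} {α : Type*} [MeasurableSpace α] (μ : Measure α) [SigmaFinite μ]
    {f : α → ℝ≥0∞} (hf : Measurable f) [SigmaFinite (μ.withDensity f)] :
    Measure.pi (fun _ : Fin k => μ.withDensity f) =
      (Measure.pi fun _ : Fin k => μ).withDensity fun x => ∏ i, f (x i) := by
  refine Measure.pi_eq fun s hs => ?_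
  rw [withDensity_apply _ (MeasurableSet.univ_pi hs), ← lintegral_indicator
    (MeasurableSet.univ_pi hs)]
  have : ∀ x : Fin k → α, (Set.univ.pi s).indicator (fun x => ∏ i, f (x i)) x =
      ∏ i, (s i).indicator f (x i) := by
    intro x
    by_cases hx : x ∈ Set.univ.pi s
    · rw [Set.indicator_of_mem hx]
      exact Finset.prod_congr rfl fun i _ => (Set.indicator_of_mem (hx i trivial) _).symm
    · rw [Set.indicator_of_notMem hx]
      simp only [Set.mem_pi, Set.mem_univ, forall_const, not_forall] at hx
      obtain ⟨i, hi⟩ := hx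
      exact (Finset.prod_eq_zero (Finset.mem_univ i) (Set.indicator_of_notMem hi _)).symm
  simp_rw [this]
  rw [lintegral_pi_prod μ fun i => hf.indicator (hs i)]
  refine Finset.prod_congr rfl fun i _ => ?_
  rw [lintegral_indicator (hs i), withDensity_apply _ (hs i)]

/-! ### Rotations and whitening -/

/-- A unit vector is the first vector of an orthonormal basis. -/
theorem exists_orthonormalBasis_zero_eq {m : ℕ} (e : EuclideanSpace ℝ (Fin (m + 1)))
    (he : ‖e‖ = 1) :
    ∃ b : OrthonormalBasis (Fin (m + 1)) ℝ (EuclideanSpace ℝ (Fin (m + 1))), b 0 = e := by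
  have h : Orthonormal ℝ (({0} : Set (Fin (m + 1))).domRestrict fun _ => e) := by
    constructor
    · intro i; exact he
    · intro i j hij
      exact absurd (Subsingleton.elim i j) hij
  obtain ⟨b, hb⟩ := h.exists_orthonormalBasis_extension_of_card_eq (by simp)
  exact ⟨b, hb 0 (by simp)⟩

/-- A rotation that maps a given vector to a nonnegative multiple of the first coordinate vector. -/
theorem exists_rotation {m : ℕ} (a : Fin (m + 1) → ℝ) :
    ∃ R : Matrix (Fin (m + 1)) (Fin (m + 1)) ℝ,
      (∀ i j, R i ⬝ᵥ R j = if i = j then 1 else 0) ∧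
      (∀ i, a ⬝ᵥ R i = if i = 0 then √(a ⬝ᵥ a) else 0) := by
  obtain ⟨e, he, hae⟩ : ∃ e : EuclideanSpace ℝ (Fin (m + 1)), ‖e‖ = 1 ∧
      WithLp.toLp 2 a = ‖WithLp.toLp 2 a‖ • e := by
    by_cases h : WithLp.toLp 2 a = 0
    · exact ⟨EuclideanSpace.single 0 1, by simp, by simp [h]⟩
    · refine ⟨‖WithLp.toLp 2 a‖⁻¹ • WithLp.toLp 2 a, ?_, ?_⟩
      · simp [norm_smul, h]
      · rw [smul_smul, mul_inv_cancel₀ (norm_ne_zero_iff.2 h), one_smul]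
  obtain ⟨b, hb⟩ := exists_orthonormalBasis_zero_eq e he
  have hinner : ∀ x y : EuclideanSpace ℝ (Fin (m + 1)), inner ℝ x y = x.ofLp ⬝ᵥ y.ofLp := by
    intro x y
    simp [PiLp.inner_apply, dotProduct, mul_comm]
  have hn : ‖WithLp.toLp 2 a‖ = √(a ⬝ᵥ a) := by
    rw [← Real.sqrt_sq (norm_nonneg _), ← real_inner_self_eq_norm_sq, hinner]
  refine ⟨fun i => (b i).ofLp, fun i j => ?_, fun i => ?_⟩
  · rw [← hinner]
    exact orthonormal_iff_ite.1 b.orthonormal i j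
  · have h1 : a ⬝ᵥ (b i).ofLp = inner ℝ (WithLp.toLp 2 a) (b i) := by rw [hinner]
    rw [h1, hae, inner_smul_left, ← hb, orthonormal_iff_ite.1 b.orthonormal]
    by_cases h : i = 0
    · subst h; simp [hn]
    · simp [h, Ne.symm h]

/-- Consequences of `exists_rotation` for the change of variables `w ↦ Rᵀ w`. -/
theorem rotation_transpose {m : ℕ} {a : Fin (m + 1) → ℝ} {R : Matrix (Fin (m + 1)) (Fin (m + 1)) ℝ}
    (hR : ∀ i j, R i ⬝ᵥ R j = if i = j then 1 else 0)
    (hRa : ∀ i, a ⬝ᵥ R i = if i = 0 then √(a ⬝ᵥ a) else 0) :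
    |R.transpose.det| = 1 ∧ (∀ w, R.transpose.mulVec w ⬝ᵥ R.transpose.mulVec w = w ⬝ᵥ w) ∧
      ∀ w, a ⬝ᵥ R.transpose.mulVec w = √(a ⬝ᵥ a) * w 0 := by
  have hmat : R * R.transpose = 1 := by
    ext i j
    rw [Matrix.one_apply, ← hR i j]
    rfl
  refine ⟨?_, fun w => ?_, fun w => ?_⟩
  · have h := congrArg Matrix.det hmat
    rw [Matrix.det_mul, Matrix.det_transpose, Matrix.det_one] at h
    rw [Matrix.det_transpose]
    rcases mul_self_eq_one_iff.1 h with h | h <;> simp [h]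
  · rw [Matrix.dotProduct_mulVec, Matrix.vecMul_transpose, Matrix.mulVec_mulVec, hmat,
      Matrix.one_mulVec]
  · have h : R.mulVec a = Pi.single 0 √(a ⬝ᵥ a) := by
      funext i
      change R i ⬝ᵥ a = _
      rw [dotProduct_comm, hRa]
      by_cases hi : i = 0
      · subst hi; simp
      · simp [hi]
    rw [Matrix.dotProduct_mulVec, Matrix.vecMul_transpose, h, single_dotProduct]

/-- Whitening: a matrix `M` with `M (1 + a aᵀ) Mᵀ = 1` that maps `a` to a nonnegative multiple of
the first coordinate vector. -/
theorem exists_whitening {m : ℕ} (a : Fin (m + 1) → ℝ) :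
    ∃ (M : Matrix (Fin (m + 1)) (Fin (m + 1)) ℝ) (l : ℝ), 0 ≤ l ∧ (a ≠ 0 → 0 < l) ∧
      M.mulVec a = Pi.single 0 l ∧
      M.det ^ 2 * (1 + a ⬝ᵥ a) = 1 ∧
      (∀ i j, M i ⬝ᵥ M j + (a ⬝ᵥ M i) * (a ⬝ᵥ M j) = if i = j then 1 else 0) ∧
      (∀ x y : Fin (m + 1) → ℝ, (M.transpose.mulVec x) ⬝ᵥ (M.transpose.mulVec y) +
        (a ⬝ᵥ M.transpose.mulVec x) * (a ⬝ᵥ M.transpose.mulVec y) = x ⬝ᵥ y) := by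
  obtain ⟨b, hbb, hab⟩ := exists_rotation a
  set n : ℝ := √(a ⬝ᵥ a) with hn
  have hn0 : 0 ≤ n := Real.sqrt_nonneg _
  set s : ℝ := (√(1 + n ^ 2))⁻¹ with hs
  have hpos : 0 < 1 + n ^ 2 := by positivity
  have hs0 : 0 < s := by positivity
  have hs2 : s ^ 2 * (1 + n ^ 2) = 1 := by
    rw [hs, inv_pow, Real.sq_sqrt hpos.le, inv_mul_cancel₀ hpos.ne']
  have haa : a ⬝ᵥ a = n ^ 2 := (Real.sq_sqrt (dotProduct_self_nonneg_real a)).symm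
  -- The form 1 + a aᵀ has eigenvalue 1 + |a|² along a and 1 on its complement, so only the axis
  -- along a has to be shrunk, by the factor s = (1 + |a|²)^(-1/2).
  let t : Fin (m + 1) → ℝ := fun i => if i = 0 then s else 1
  let M : Matrix (Fin (m + 1)) (Fin (m + 1)) ℝ := fun i => t i • b i
  have hMM : ∀ i j, M i ⬝ᵥ M j + (a ⬝ᵥ M i) * (a ⬝ᵥ M j) = if i = j then 1 else 0 := by
    intro i j
    simp only [M, dotProduct_smul, smul_dotProduct, hbb, hab, smul_eq_mul, t]
    by_cases hi : i = 0
    · by_cases hj : j = 0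
      · subst hi hj; simp only [if_true]; linear_combination hs2
      · have : i ≠ j := fun h => hj (h ▸ hi)
        simp [hi, hj, Ne.symm hj]
    · by_cases hij : i = j
      · subst hij; simp [hi]
      · simp [hi, hij]
  have hMa : M.mulVec a = Pi.single 0 (s * n) := by
    funext i
    change M i ⬝ᵥ a = _
    rw [dotProduct_comm]
    simp only [M, dotProduct_smul, hab, smul_eq_mul, t]
    by_cases hi : i = 0
    · subst hi; simp
    · simp [hi]
  have hmat : M * M.transpose + Matrix.vecMulVec (M.mulVec a) (M.mulVec a) = 1 := by
    ext i j
    rw [Matrix.one_apply, ← hMM i j, dotProduct_comm a, dotProduct_comm a]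
    rfl
  -- In this form the matrix determinant lemma det(1 + a aᵀ) = 1 + |a|² applies and gives the value
  -- of (det M)².
  have hmat2 : M * (1 + Matrix.replicateCol Unit a * Matrix.replicateRow Unit a) * M.transpose
      = 1 := by
    rw [mul_add, add_mul, mul_one, ← hmat]
    congr 1
    rw [← Matrix.vecMulVec_eq, Matrix.mul_vecMulVec, Matrix.vecMulVec_mul, Matrix.vecMul_transpose]
  refine ⟨M, s * n, by positivity, fun ha => ?_, hMa, ?_, hMM, ?_⟩
  · have : n ≠ 0 := by
      intro h0
      rw [h0, sq, mul_zero] at haa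
      exact ha (dotProduct_self_eq_zero.1 haa)
    positivity
  · have h := congrArg Matrix.det hmat2
    rw [Matrix.det_mul, Matrix.det_mul, Matrix.det_one_add_replicateCol_mul_replicateRow,
      Matrix.det_transpose, Matrix.det_one] at h
    linear_combination h
  · intro x y
    have h1 : M.transpose.mulVec x ⬝ᵥ M.transpose.mulVec y = x ⬝ᵥ (M * M.transpose).mulVec y := by
      rw [← Matrix.mulVec_mulVec, Matrix.dotProduct_mulVec x, ← Matrix.mulVec_transpose]
    have h2 : ∀ x, a ⬝ᵥ M.transpose.mulVec x = M.mulVec a ⬝ᵥ x := by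
      intro x
      rw [Matrix.dotProduct_mulVec, Matrix.vecMul_transpose]
    have h3 := congrArg (fun N => x ⬝ᵥ N.mulVec y) hmat
    simp only [Matrix.add_mulVec, Matrix.one_mulVec, dotProduct_add, Matrix.vecMulVec_mulVec] at h3
    rw [h1, h2, h2, ← h3]
    simp [dotProduct_comm x, mul_comm]

/-! ### Gaussian moments and the second moment of a determinant -/

theorem integrable_pow_mul_gaussian (k : ℕ) :
    Integrable fun x : ℝ => x ^ k * Real.exp (-(x * x) / 2) := by
  have h := integrable_rpow_mul_exp_neg_mul_sq (b := 1 / 2) (by norm_num) (s := k)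
    (by have := Nat.cast_nonneg (α := ℝ) k; linarith)
  refine h.congr (Filter.Eventually.of_forall fun x => ?_)
  simp only [Real.rpow_natCast]
  congr 2; ring

theorem integral_gaussian_weight : ∫ x : ℝ, Real.exp (-(x * x) / 2) = √(2 * Real.pi) := by
  have h := integral_gaussian (1 / 2)
  rw [show Real.pi / (1 / 2) = 2 * Real.pi by ring] at h
  rw [← h]
  congr 1; funext x; congr 1; ring

theorem integral_id_mul_gaussian : ∫ x : ℝ, x * Real.exp (-(x * x) / 2) = 0 := by
  have h := integral_neg_eq_self (fun x : ℝ => x * Real.exp (-(x * x) / 2)) volume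
  simp only [neg_mul_neg, neg_mul _ (Real.exp _), integral_neg] at h
  linarith

theorem integral_sq_mul_gaussian :
    ∫ x : ℝ, x * x * Real.exp (-(x * x) / 2) = √(2 * Real.pi) := by
  have h := variance_id_gaussianReal (μ := 0) (v := 1)
  simp only [variance_eq_integral aemeasurable_id, id, integral_id_gaussianReal] at h
  rw [
    integral_gaussianReal_eq_integral_smul one_ne_zero] at h
  simp only [gaussianPDFReal, NNReal.coe_one, mul_one, sub_zero, smul_eq_mul] at h
  have h2 : ∀ x : ℝ, (√(2 * Real.pi))⁻¹ * Real.exp (-x ^ 2 / 2) * x ^ 2 =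
      (√(2 * Real.pi))⁻¹ * (x * x * Real.exp (-(x * x) / 2)) := by
    intro x; rw [show -x ^ 2 / 2 = -(x * x) / 2 by ring]; ring
  simp_rw [h2] at h
  rw [integral_const_mul] at h
  have : √(2 * Real.pi) ≠ 0 := by positivity
  field_simp at h
  simpa [← sq, neg_div] using h

/-- The integrand is a product over coordinates. For i ≠ j it has an odd factor with integral zero;
for i = j every factor integrates to √(2π). -/
theorem gaussian_moment_two {n : ℕ} (i j : Fin n) :
    Integrable (fun x : Fin n → ℝ => x i * x j * Real.exp (-(x ⬝ᵥ x) / 2)) ∧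
    ∫ x : Fin n → ℝ, x i * x j * Real.exp (-(x ⬝ᵥ x) / 2) =
      if i = j then √(2 * Real.pi) ^ n else 0 := by
  let f : Fin n → ℝ → ℝ := fun l t => (if i = l then t else 1) * (if j = l then t else 1) *
    Real.exp (-(t * t) / 2)
  have hfac : (fun x : Fin n → ℝ => x i * x j * Real.exp (-(x ⬝ᵥ x) / 2)) = fun x =>
      ∏ l, f l (x l) := by
    funext x
    simp only [f, Finset.prod_mul_distrib, Finset.prod_ite_eq, Finset.mem_univ, if_true]
    rw [← Real.exp_sum, ← Finset.sum_div, Finset.sum_neg_distrib]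
    rfl
  rw [hfac]
  have h0 := integrable_pow_mul_gaussian 0
  have h1 := integrable_pow_mul_gaussian 1
  have h2 := integrable_pow_mul_gaussian 2
  simp only [pow_zero, one_mul, pow_one, sq] at h0 h1 h2
  constructor
  · refine Integrable.fintype_prod_dep (f := f) fun l => ?_
    by_cases hi : i = l <;> by_cases hj : j = l <;> simpa [f, hi, hj]
  · rw [integral_fintype_prod_volume_eq_prod (f := f)]
    by_cases hij : i = j
    · subst hij
      rw [if_pos rfl]
      rw [Finset.prod_congr rfl (g := fun _ => √(2 * Real.pi))]
      · simp
      · intro l _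
        by_cases hi : i = l
        · simpa [f, hi] using integral_sq_mul_gaussian
        · simpa [f, hi] using integral_gaussian_weight
    · rw [if_neg hij]
      refine Finset.prod_eq_zero (Finset.mem_univ i) ?_
      simpa [f, Ne.symm hij] using integral_id_mul_gaussian

/-- A permutation is determined by its value at 0 and a permutation of m letters, so every value at
0 occurs m! times. -/
theorem sum_perm_apply_zero {m : ℕ} (f : Fin (m + 1) → ℝ) :
    ∑ σ : Equiv.Perm (Fin (m + 1)), f (σ 0) = m.factorial * ∑ j, f j := by
  rw [← Equiv.sum_comp Equiv.Perm.decomposeFin.symm, Fintype.sum_prod_type, Finset.mul_sum]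
  simp [Fintype.card_perm]

/-- Second moment of a determinant whose first row is fixed and whose other rows are Gaussian. -/
theorem lintegral_det_sq_gaussian {m : ℕ} (r : Fin (m + 1) → ℝ) :
    ∫⁻ S : Fin m → Fin (m + 1) → ℝ, ENNReal.ofReal
      ((Matrix.of (Fin.cons r S)).det ^ 2 *
        Real.exp (-(∑ k, S k ⬝ᵥ S k) / 2)) =
      ENNReal.ofReal (m.factorial * (r ⬝ᵥ r) * √(2 * Real.pi) ^ (m * (m + 1))) := by
  -- The squared Leibniz expansion is a double sum over permutations whose terms are products over
  -- the rows, so each is integrated row by row.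
  have hexp : (fun S : Fin m → Fin (m + 1) → ℝ =>
      (Matrix.of (Fin.cons r S)).det ^ 2 *
        Real.exp (-(∑ k, S k ⬝ᵥ S k) / 2)) = fun S =>
      ∑ σ : Equiv.Perm (Fin (m + 1)), ∑ τ : Equiv.Perm (Fin (m + 1)),
        ((Equiv.Perm.sign σ : ℤ) : ℝ) * ((Equiv.Perm.sign τ : ℤ) : ℝ) * (r (σ 0) * r (τ 0)) *
        ∏ k, (S k (σ k.succ) * S k (τ k.succ) * Real.exp (-(S k ⬝ᵥ S k) / 2)) := by
    funext S
    have hdet : (Matrix.of (Fin.cons r S)).det =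
        ∑ σ : Equiv.Perm (Fin (m + 1)), ((Equiv.Perm.sign σ : ℤ) : ℝ) *
          (r (σ 0) * ∏ k, S k (σ k.succ)) := by
      rw [← Matrix.det_transpose, Matrix.det_apply']
      simp only [Matrix.transpose_apply, Matrix.of_apply, Fin.prod_univ_succ, Fin.cons_zero,
        Fin.cons_succ]
    rw [hdet, sq, Finset.sum_mul_sum, Finset.sum_mul]
    refine Finset.sum_congr rfl fun σ _ => ?_
    rw [Finset.sum_mul]
    refine Finset.sum_congr rfl fun τ _ => ?_
    rw [Finset.prod_mul_distrib, Finset.prod_mul_distrib, ← Real.exp_sum, ← Finset.sum_div,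
      ← Finset.sum_neg_distrib]
    ring
  have hint : ∀ σ τ : Equiv.Perm (Fin (m + 1)), Integrable fun S : Fin m → Fin (m + 1) → ℝ =>
      ((Equiv.Perm.sign σ : ℤ) : ℝ) * ((Equiv.Perm.sign τ : ℤ) : ℝ) * (r (σ 0) * r (τ 0)) *
        ∏ k, (S k (σ k.succ) * S k (τ k.succ) * Real.exp (-(S k ⬝ᵥ S k) / 2)) := by
    intro σ τ
    refine Integrable.const_mul ?_ _
    exact Integrable.fintype_prod_dep (f := fun k (x : Fin (m + 1) → ℝ) =>
      x (σ (Fin.succ k)) * x (τ (Fin.succ k)) * Real.exp (-(x ⬝ᵥ x) / 2))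
      fun k => (gaussian_moment_two _ _).1
  rw [← ofReal_integral_eq_lintegral_ofReal]
  · congr 1
    rw [hexp, integral_finsetSum _ fun σ _ => integrable_finsetSum _ fun τ _ => hint σ τ]
    have hterm : ∀ σ : Equiv.Perm (Fin (m + 1)), ∫ S : Fin m → Fin (m + 1) → ℝ,
        ∑ τ : Equiv.Perm (Fin (m + 1)),
        ((Equiv.Perm.sign σ : ℤ) : ℝ) * ((Equiv.Perm.sign τ : ℤ) : ℝ) * (r (σ 0) * r (τ 0)) *
        ∏ k, (S k (σ k.succ) * S k (τ k.succ) * Real.exp (-(S k ⬝ᵥ S k) / 2)) =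
        r (σ 0) * r (σ 0) * √(2 * Real.pi) ^ (m * (m + 1)) := by
      intro σ
      rw [integral_finsetSum _ fun τ _ => hint σ τ, Finset.sum_eq_single σ]
      · rw [integral_const_mul, integral_fintype_prod_volume_eq_prod
          (f := fun k (x : Fin (m + 1) → ℝ) =>
            x (σ (Fin.succ k)) * x (σ (Fin.succ k)) * Real.exp (-(x ⬝ᵥ x) / 2))]
        simp only [(gaussian_moment_two _ _).2, if_true, Finset.prod_const, Finset.card_univ,
          Fintype.card_fin]
        rw [← pow_mul, mul_comm (m + 1) m]
        have : ((Equiv.Perm.sign σ : ℤ) : ℝ) * ((Equiv.Perm.sign σ : ℤ) : ℝ) = 1 := by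
          rw [← Int.cast_mul, Int.units_coe_mul_self, Int.cast_one]
        rw [this, one_mul]
      · intro τ _ hτ
        rw [integral_const_mul, integral_fintype_prod_volume_eq_prod
          (f := fun k (x : Fin (m + 1) → ℝ) =>
            x (σ (Fin.succ k)) * x (τ (Fin.succ k)) * Real.exp (-(x ⬝ᵥ x) / 2))]
        -- Permutations that agree off 0 agree at 0 too. Distinct ones thus differ in a Gaussian
        -- row, whose mixed moment vanishes; only the diagonal terms survive.
        obtain ⟨k, hk⟩ : ∃ k : Fin m, σ k.succ ≠ τ k.succ := by
          by_contra! hcon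
          refine hτ (Equiv.ext fun i => ?_)
          by_contra hi
          have hne : i = 0 := by
            rcases Fin.eq_zero_or_eq_succ i with h | ⟨k, rfl⟩
            · exact h
            · exact absurd (hcon k).symm hi
          subst hne
          obtain ⟨l, hl⟩ := σ.surjective (τ 0)
          rcases Fin.eq_zero_or_eq_succ l with h | ⟨k, rfl⟩
          · subst h; exact hi hl.symm
          · rw [hcon k] at hl
            exact Fin.succ_ne_zero k (τ.injective hl)
        rw [Finset.prod_eq_zero (Finset.mem_univ k), mul_zero]
        rw [(gaussian_moment_two _ _).2, if_neg hk]
      · simp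
    simp_rw [hterm]
    rw [← Finset.sum_mul, sum_perm_apply_zero (fun j => r j * r j)]
    rfl
  · rw [hexp]
    exact integrable_finsetSum _ fun σ _ => integrable_finsetSum _ fun τ _ => hint σ τ
  · exact Filter.Eventually.of_forall fun S => by positivity

/-! ### Gaussian integrals over orthants -/

/-- Fundamental theorem of calculus on a half-line, for nonnegative derivatives. -/
theorem lintegral_Ioi_of_hasDerivAt {g g' : ℝ → ℝ} {a l : ℝ}
    (hd : ∀ x ∈ Set.Ici a, HasDerivAt g (g' x) x) (hg : ∀ x ∈ Set.Ioi a, 0 ≤ g' x)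
    (hl : Filter.Tendsto g Filter.atTop (nhds l)) :
    ∫⁻ x in Set.Ioi a, ENNReal.ofReal (g' x) = ENNReal.ofReal (l - g a) := by
  rw [← integral_Ioi_of_hasDerivAt_of_nonneg' hd hg hl, ofReal_integral_eq_lintegral_ofReal
    (integrableOn_Ioi_deriv_of_nonneg' hd hg hl)]
  exact (ae_restrict_iff' measurableSet_Ioi).2 (Filter.Eventually.of_forall hg)

theorem lintegral_pow_mul_exp_neg_mul_sq (k : ℕ) {b : ℝ} (hb : 0 < b) :
    ∫⁻ s in Set.Ioi (0 : ℝ), ENNReal.ofReal (s ^ k * Real.exp (-b * s ^ 2)) =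
      ENNReal.ofReal (b ^ (-((k : ℝ) + 1) / 2) * (1 / 2) * Real.Gamma (((k : ℝ) + 1) / 2)) := by
  have hk : (-1 : ℝ) < k := by have := Nat.cast_nonneg (α := ℝ) k; linarith
  have h := integral_rpow_mul_exp_neg_mul_rpow (p := 2) (q := k) (by norm_num) hk hb
  rw [← h]
  have hi := integrableOn_rpow_mul_exp_neg_mul_sq hb (s := k) hk
  have hcongr : ∀ s : ℝ, s ^ (k : ℝ) * Real.exp (-b * s ^ (2 : ℝ)) =
      s ^ k * Real.exp (-b * s ^ 2) := by
    intro s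
    rw [Real.rpow_natCast]; norm_num
  simp_rw [hcongr]
  simp_rw [Real.rpow_natCast] at hi
  rw [ofReal_integral_eq_lintegral_ofReal hi]
  refine (ae_restrict_iff' measurableSet_Ioi).2 (Filter.Eventually.of_forall fun s hs => ?_)
  have : (0 : ℝ) < s := hs
  positivity

/-- Scaling of a lower Lebesgue integral over the positive orthant. -/
theorem setLIntegral_Ici_comp_smul {n : ℕ} {s : ℝ} (hs : 0 < s) {F : (Fin n → ℝ) → ℝ≥0∞}
    (hF : Measurable F) :
    ∫⁻ x in Set.Ici 0, F x = ENNReal.ofReal (s ^ n) * ∫⁻ x in Set.Ici 0, F (s • x) := by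
  have hd : LinearMap.det (s • (LinearMap.id : (Fin n → ℝ) →ₗ[ℝ] _)) = s ^ n := by
    rw [LinearMap.det_smul]; simp
  rw [← lintegral_indicator measurableSet_Ici, ← lintegral_indicator measurableSet_Ici,
    lintegral_comp_linearMap volume (s • LinearMap.id) (by rw [hd]; positivity)
    (hF.indicator measurableSet_Ici), hd, abs_of_pos (by positivity)]
  congr 1
  refine lintegral_congr fun x => ?_
  have : s • x ∈ Set.Ici (0 : Fin n → ℝ) ↔ x ∈ Set.Ici (0 : Fin n → ℝ) := by
    simp only [Set.mem_Ici, Pi.le_def, Pi.zero_apply, Pi.smul_apply, smul_eq_mul]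
    exact forall_congr' fun i => mul_nonneg_iff_of_pos_left hs
  simp only [Set.indicator, LinearMap.smul_apply, LinearMap.id_apply]
  by_cases hx : x ∈ Set.Ici 0
  · rw [if_pos hx, if_pos (this.2 hx)]
  · rw [if_neg hx, if_neg fun h => hx (this.1 h)]

/-- Integration of a quadratic form against its Gaussian over the positive orthant. -/
theorem setLIntegral_quadratic_mul_exp {n : ℕ} (hn : 0 < n) {q : (Fin n → ℝ) → ℝ}
    (hq : Measurable q) (hpos : ∀ x ≠ 0, 0 < q x) (hhom : ∀ (s : ℝ) x, q (s • x) = s ^ 2 * q x) :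
    ∫⁻ x in Set.Ici 0, ENNReal.ofReal (q x * Real.exp (-q x / 2)) =
      n * ∫⁻ x in Set.Ici 0, ENNReal.ofReal (Real.exp (-q x / 2)) := by
  have hn' : (n : ℝ) ≠ 0 := by positivity
  set Q := ∫⁻ x in Set.Ici 0, ENNReal.ofReal (q x * Real.exp (-q x / 2)) with hQ
  have hae : ∀ᵐ x : Fin n → ℝ ∂volume.restrict (Set.Ici 0), x ≠ 0 := by
    have : Nonempty (Fin n) := ⟨⟨0, hn⟩⟩
    exact ae_restrict_of_ae (Measure.ae_ne volume 0)
  -- Integrating the derivative of u ↦ -exp(-u² q/2) from 1 to ∞ writes the Gaussian as a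
  -- superposition of dilates of q exp(-q/2). The dilate at u contributes u^(-n-1) Q, and these
  -- weights integrate to 1/n.
  have h1 : ∫⁻ x in Set.Ici (0 : Fin n → ℝ), ENNReal.ofReal (Real.exp (-q x / 2)) =
      ∫⁻ x in Set.Ici (0 : Fin n → ℝ), ∫⁻ u in Set.Ioi (1 : ℝ),
        ENNReal.ofReal (u * q x * Real.exp (-(u ^ 2 * q x) / 2)) := by
    refine lintegral_congr_ae (hae.mono fun x hx => ?_)
    have hqx := hpos x hx
    have hlim : Filter.Tendsto (fun u : ℝ => -Real.exp (-(u ^ 2 * q x) / 2)) Filter.atTop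
        (nhds (-0)) := by
      refine (Real.tendsto_exp_atBot.comp ?_).neg
      have : Filter.Tendsto (fun u : ℝ => u ^ 2 * (q x / 2)) Filter.atTop Filter.atTop :=
        (Filter.tendsto_pow_atTop two_ne_zero).atTop_mul_const (by positivity)
      refine (Filter.tendsto_neg_atTop_atBot.comp this).congr fun u => ?_
      simp only [Function.comp]; ring
    have hder : ∀ u ∈ Set.Ici (1 : ℝ), HasDerivAt (fun u : ℝ => -Real.exp (-(u ^ 2 * q x) / 2))
        (u * q x * Real.exp (-(u ^ 2 * q x) / 2)) u := by
      intro u _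
      have h := (((((hasDerivAt_id u).pow 2).mul_const (q x)).neg.div_const 2).exp).neg
      refine h.congr_deriv ?_
      simp; ring
    have h := lintegral_Ioi_of_hasDerivAt hder (fun u hu => by
      have : (1 : ℝ) < u := hu
      positivity) hlim
    simp only
    rw [h]
    simp
  have h2 : ∀ u ∈ Set.Ioi (1 : ℝ), ∫⁻ x in Set.Ici (0 : Fin n → ℝ),
      ENNReal.ofReal (u * q x * Real.exp (-(u ^ 2 * q x) / 2)) =
      ENNReal.ofReal (u ^ (-(n : ℝ) - 1)) * Q := by
    intro u hu
    have hu0 : 0 < u := zero_lt_one.trans hu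
    rw [setLIntegral_Ici_comp_smul (inv_pos.2 hu0) (by fun_prop), hQ]
    have : ∀ x, ENNReal.ofReal (u * q (u⁻¹ • x) * Real.exp (-(u ^ 2 * q (u⁻¹ • x)) / 2)) =
        ENNReal.ofReal u⁻¹ * ENNReal.ofReal (q x * Real.exp (-q x / 2)) := by
      intro x
      rw [← ENNReal.ofReal_mul (by positivity), hhom]
      congr 1
      field_simp
    simp_rw [this]
    rw [lintegral_const_mul _ (by fun_prop), ← mul_assoc, ← ENNReal.ofReal_mul (by positivity)]
    congr 2
    rw [Real.rpow_sub hu0, Real.rpow_neg hu0.le, Real.rpow_natCast, Real.rpow_one, inv_pow,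
      div_eq_mul_inv]
  have h3 : ∫⁻ u in Set.Ioi (1 : ℝ), ENNReal.ofReal (u ^ (-(n : ℝ) - 1)) =
      ENNReal.ofReal (n : ℝ)⁻¹ := by
    have hlt : -(n : ℝ) - 1 < -1 := by
      have : (0 : ℝ) < n := by positivity
      linarith
    rw [← ofReal_integral_eq_lintegral_ofReal (integrableOn_Ioi_rpow_of_lt hlt zero_lt_one),
      integral_Ioi_rpow_of_lt hlt zero_lt_one]
    · congr 1; simp
    · refine (ae_restrict_iff' measurableSet_Ioi).2 (Filter.Eventually.of_forall fun u hu => ?_)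
      have : (1 : ℝ) < u := hu
      positivity
  rw [h1, lintegral_lintegral_swap (by fun_prop), setLIntegral_congr_fun measurableSet_Ioi h2,
    lintegral_mul_const _ (by fun_prop), h3, ← mul_assoc, ← ENNReal.ofReal_natCast,
    ← ENNReal.ofReal_mul (by positivity), mul_inv_cancel₀ hn']
  simp

/-- The Cauchy–Schlömilch substitution for the Gaussian. -/
theorem lintegral_exp_neg_sq_add_inv_sq {m : ℝ} (hm : 0 ≤ m) :
    ∫⁻ s in Set.Ioi (0 : ℝ), ENNReal.ofReal (Real.exp (-(s ^ 2 + m ^ 2 / s ^ 2) / 2)) =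
      ENNReal.ofReal (√(Real.pi / 2) * Real.exp (-m)) := by
  -- For m = 0 the inversion s ↦ m/s degenerates, and the integral is a plain half Gaussian.
  rcases hm.eq_or_lt with rfl | hm
  · have h := lintegral_pow_mul_exp_neg_mul_sq 0 (b := 1 / 2) (by norm_num)
    convert h using 2 with s
    · simp only [pow_zero, one_mul, ne_eq, OfNat.ofNat_ne_zero, not_false_eq_true, zero_pow,
        zero_div, add_zero]
      ring_nf
    · rw [Nat.cast_zero, zero_add, Real.Gamma_one_half_eq, neg_zero, Real.exp_zero, mul_one,
        neg_div, Real.rpow_neg (by norm_num), ← Real.sqrt_eq_rpow, Real.sqrt_div' _ (by norm_num),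
        Real.sqrt_div' _ (by norm_num)]
      have := Real.mul_self_sqrt (show (0 : ℝ) ≤ 2 by norm_num)
      field_simp
      rw [Real.sqrt_one]
      linear_combination -this
  -- Completing the square, s² + m²/s² = (s - m/s)² + 2m. The inversion s ↦ m/s preserves f with
  -- Jacobian m/s²; adding both versions produces the derivative 1 + m/s² of s - m/s, which maps the
  -- half-line bijectively onto ℝ.
  · set f : ℝ → ℝ≥0∞ := fun s => ENNReal.ofReal (Real.exp (-(s - m / s) ^ 2 / 2)) with hf
    have hfm : Measurable f := by fun_prop
    have h0 : ∀ s ∈ Set.Ioi (0 : ℝ), ENNReal.ofReal (Real.exp (-(s ^ 2 + m ^ 2 / s ^ 2) / 2)) =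
        ENNReal.ofReal (Real.exp (-m)) * f s := by
      intro s hs
      have hs' : s ≠ 0 := ne_of_gt hs
      rw [hf, ← ENNReal.ofReal_mul (by positivity), ← Real.exp_add]
      congr 2
      field_simp
      ring
    have h1 : ∫⁻ s in Set.Ioi (0 : ℝ), f s =
        ∫⁻ s in Set.Ioi (0 : ℝ), ENNReal.ofReal (m / s ^ 2) * f s := by
      have himg : (fun s : ℝ => m / s) '' Set.Ioi 0 = Set.Ioi 0 := by
        ext y
        constructor
        · rintro ⟨s, hs, rfl⟩
          have : (0 : ℝ) < s := hs
          exact div_pos hm hs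
        · intro hy
          have : (0 : ℝ) < y := hy
          exact ⟨m / y, div_pos hm hy, by field_simp⟩
      have h := lintegral_image_eq_lintegral_abs_deriv_mul (f := fun s : ℝ => m / s)
        (f' := fun s => -(m / s ^ 2)) (measurableSet_Ioi (a := (0 : ℝ))) (fun s hs => ?_) ?_ f
      · rw [himg] at h
        rw [h]
        refine setLIntegral_congr_fun measurableSet_Ioi fun s hs => ?_
        have hs' : (0 : ℝ) < s := hs
        simp only [abs_neg, hf]
        rw [abs_of_pos (by positivity)]
        congr 4
        field_simp
        ring
      · have hs' : s ≠ 0 := ne_of_gt hs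
        have h1 : HasDerivAt (fun s : ℝ => m / s) (m * -(s ^ 2)⁻¹) s := by
          simpa only [div_eq_mul_inv] using (hasDerivAt_inv hs').const_mul m
        exact (h1.congr_deriv (by ring)).hasDerivWithinAt
      · intro x hx y hy hxy
        have hx' : (0 : ℝ) < x := hx
        have hy' : (0 : ℝ) < y := hy
        simp only at hxy
        field_simp at hxy
        exact hxy.symm
    have h2 : ∫⁻ s in Set.Ioi (0 : ℝ), ENNReal.ofReal (1 + m / s ^ 2) * f s =
        ENNReal.ofReal √(2 * Real.pi) := by
      have himg : (fun s : ℝ => s - m / s) '' Set.Ioi 0 = Set.univ := by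
        refine Set.eq_univ_of_forall fun y => ?_
        have hlt : |y| < √(y ^ 2 + 4 * m) := by
          rw [← Real.sqrt_sq_eq_abs]
          exact Real.sqrt_lt_sqrt (sq_nonneg _) (by linarith)
        have hy := neg_abs_le y
        have hs : 0 < (y + √(y ^ 2 + 4 * m)) / 2 := by linarith
        -- The positive root of s² - y s - m = 0.
        refine ⟨(y + √(y ^ 2 + 4 * m)) / 2, hs, ?_⟩
        have hsq := Real.sq_sqrt (show 0 ≤ y ^ 2 + 4 * m by positivity)
        have hD : y + √(y ^ 2 + 4 * m) ≠ 0 := by linarith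
        simp only
        field_simp
        linear_combination hsq
      have h := lintegral_image_eq_lintegral_abs_deriv_mul (f := fun s : ℝ => s - m / s)
        (f' := fun s => 1 + m / s ^ 2) (measurableSet_Ioi (a := (0 : ℝ))) (fun s hs => ?_) ?_
        (fun u => ENNReal.ofReal (Real.exp (-(u * u) / 2)))
      · rw [himg, Measure.restrict_univ] at h
        have h0 := integrable_pow_mul_gaussian 0
        simp only [pow_zero, one_mul] at h0
        rw [← integral_gaussian_weight, ofReal_integral_eq_lintegral_ofReal h0
          (Filter.Eventually.of_forall fun _ => by positivity), h]
        refine setLIntegral_congr_fun measurableSet_Ioi fun s hs => ?_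
        have hs' : (0 : ℝ) < s := hs
        simp only [hf, sq (s - m / s)]
        rw [abs_of_pos (by positivity)]
      · have hs' : s ≠ 0 := ne_of_gt hs
        have h1 : HasDerivAt (fun s : ℝ => m / s) (m * -(s ^ 2)⁻¹) s := by
          simpa only [div_eq_mul_inv] using (hasDerivAt_inv hs').const_mul m
        exact (((hasDerivAt_id s).sub h1).congr_deriv (by ring)).hasDerivWithinAt
      · intro x hx y hy hxy
        have hx' : (0 : ℝ) < x := hx
        have hy' : (0 : ℝ) < y := hy
        simp only at hxy
        have : (x - y) * (1 + m / (x * y)) = 0 := by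
          field_simp at hxy ⊢
          linear_combination hxy
        rcases mul_eq_zero.1 this with h | h
        · linarith
        · have : 0 < 1 + m / (x * y) := by positivity
          linarith
    have h3 : 2 * ∫⁻ s in Set.Ioi (0 : ℝ), f s = ENNReal.ofReal √(2 * Real.pi) := by
      rw [← h2, two_mul]
      -- Only the second of the two copies of the integral is to be transformed by the inversion.
      conv_lhs => rw [h1]; arg 1; rw [← h1]
      rw [← lintegral_add_left hfm]
      refine setLIntegral_congr_fun measurableSet_Ioi fun s hs => ?_
      have hs' : (0 : ℝ) < s := hs
      rw [ENNReal.ofReal_add zero_le_one (by positivity), ENNReal.ofReal_one, add_mul, one_mul]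
    have h4 : ∫⁻ s in Set.Ioi (0 : ℝ), f s = ENNReal.ofReal √(Real.pi / 2) := by
      have h5 : ENNReal.ofReal √(2 * Real.pi) = 2 * ENNReal.ofReal √(Real.pi / 2) := by
        rw [← ENNReal.ofReal_ofNat, ← ENNReal.ofReal_mul (by positivity)]
        congr 1
        rw [Real.sqrt_eq_iff_mul_self_eq (by positivity) (by positivity)]
        have := Real.mul_self_sqrt (show 0 ≤ Real.pi / 2 by positivity)
        linear_combination (-4) * this
      rw [h5] at h3
      exact (ENNReal.mul_right_inj (by simp) (by simp)).1 h3
    rw [setLIntegral_congr_fun measurableSet_Ioi h0, lintegral_const_mul _ hfm, h4, mul_comm,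
      ← ENNReal.ofReal_mul (by positivity)]

/-- For a given sum u = x + y the first coordinate runs through [0, u], so the integral reduces to
that of u exp(-u²/2) over the half-line. -/
theorem setLIntegral_exp_neg_add_sq :
    ∫⁻ p in (Set.Ici (0 : ℝ)) ×ˢ (Set.Ici (0 : ℝ)),
      ENNReal.ofReal (Real.exp (-(p.1 + p.2) ^ 2 / 2)) = 1 := by
  set f : ℝ → ℝ≥0∞ := fun u => ENNReal.ofReal (Real.exp (-u ^ 2 / 2)) with hf
  have hfm : Measurable f := by fun_prop
  rw [Measure.volume_eq_prod, setLIntegral_prod _ (by fun_prop)]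
  have h1 : ∀ x : ℝ, ∫⁻ y in Set.Ici (0 : ℝ), ENNReal.ofReal (Real.exp (-(x + y) ^ 2 / 2)) =
      ∫⁻ u, (Set.Ici x).indicator f u := by
    intro x
    rw [← lintegral_indicator measurableSet_Ici,
      ← lintegral_add_left_eq_self ((Set.Ici x).indicator f) x]
    refine lintegral_congr fun y => ?_
    simp [Set.indicator, hf]
  simp only [h1]
  rw [← lintegral_indicator measurableSet_Ici]
  have h2 : ∀ x : ℝ, (Set.Ici (0 : ℝ)).indicator (fun x => ∫⁻ u, (Set.Ici x).indicator f u) x =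
      ∫⁻ u, (Set.Icc 0 u).indicator (fun _ => f u) x := by
    intro x
    by_cases hx : x ∈ Set.Ici (0 : ℝ)
    · rw [Set.indicator_of_mem hx]
      refine lintegral_congr fun u => ?_
      have hx0 : 0 ≤ x := hx
      simp [Set.indicator, hx0]
    · rw [Set.indicator_of_notMem hx]
      have hx0 : ¬ 0 ≤ x := hx
      simp [Set.indicator, hx0]
  simp_rw [h2]
  rw [lintegral_lintegral_swap]
  · have h3 : ∀ u : ℝ, ∫⁻ x, (Set.Icc 0 u).indicator (fun _ => f u) x =
        (Set.Ioi (0 : ℝ)).indicator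
          (fun u => ENNReal.ofReal (u ^ 1 * Real.exp (-(1 / 2) * u ^ 2))) u := by
      intro u
      rw [lintegral_indicator measurableSet_Icc, setLIntegral_const, Real.volume_Icc]
      by_cases hu : u ∈ Set.Ioi (0 : ℝ)
      · have hu0 : 0 < u := hu
        rw [Set.indicator_of_mem hu, hf, ← ENNReal.ofReal_mul (by positivity)]
        congr 1
        rw [show -u ^ 2 / 2 = -(1 / 2) * u ^ 2 by ring]
        ring
      · rw [Set.indicator_of_notMem hu, ENNReal.ofReal_of_nonpos, mul_zero]
        simpa using hu
    simp_rw [h3]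
    rw [lintegral_indicator measurableSet_Ioi, lintegral_pow_mul_exp_neg_mul_sq 1 (by norm_num)]
    norm_num [Real.rpow_neg_one]
  · have : Measurable
        (Function.uncurry fun x u : ℝ => (Set.Icc 0 u).indicator (fun _ => f u) x) := by
      have hs : MeasurableSet {p : ℝ × ℝ | 0 ≤ p.1 ∧ p.1 ≤ p.2} :=
        (measurableSet_le measurable_const measurable_fst).inter
          (measurableSet_le measurable_fst measurable_snd)
      exact (hfm.comp measurable_snd).indicator hs
    exact this.aemeasurable

/-- The exponent is -∑ (b_i + r_i)²/2, so the integral is a product of n quadrant integrals, each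
equal to 1. -/
theorem setLIntegral_orthants_exp (n : ℕ) :
    ∫⁻ b in Set.Ici (0 : Fin n → ℝ), ∫⁻ r in Set.Ici (0 : Fin n → ℝ),
      ENNReal.ofReal (Real.exp (-(r ⬝ᵥ r + b ⬝ᵥ b) / 2 - b ⬝ᵥ r)) = 1 := by
  have hprod : ∀ p : (Fin n → ℝ) × (Fin n → ℝ),
      ((Set.Ici (0 : Fin n → ℝ)) ×ˢ (Set.Ici (0 : Fin n → ℝ))).indicator (fun p =>
        ENNReal.ofReal (Real.exp (-(p.2 ⬝ᵥ p.2 + p.1 ⬝ᵥ p.1) / 2 - p.1 ⬝ᵥ p.2))) p =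
      ∏ i, ((Set.Ici (0 : ℝ)) ×ˢ (Set.Ici (0 : ℝ))).indicator (fun p : ℝ × ℝ =>
        ENNReal.ofReal (Real.exp (-(p.1 + p.2) ^ 2 / 2))) (p.1 i, p.2 i) := by
    intro p
    by_cases hp : p ∈ (Set.Ici (0 : Fin n → ℝ)) ×ˢ (Set.Ici (0 : Fin n → ℝ))
    · rw [Set.indicator_of_mem hp]
      obtain ⟨h1, h2⟩ := hp
      have hmem : ∀ i, (p.1 i, p.2 i) ∈ (Set.Ici (0 : ℝ)) ×ˢ (Set.Ici (0 : ℝ)) :=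
        fun i => Set.mk_mem_prod (h1 i) (h2 i)
      rw [Finset.prod_congr rfl fun i _ => Set.indicator_of_mem (hmem i) _,
        ← ENNReal.ofReal_prod_of_nonneg fun i _ => Real.exp_nonneg _, ← Real.exp_sum]
      congr 2
      simp only [dotProduct, ← Finset.sum_add_distrib, ← Finset.sum_neg_distrib, Finset.sum_div,
        ← Finset.sum_sub_distrib]
      refine Finset.sum_congr rfl fun i _ => ?_
      ring
    · rw [Set.indicator_of_notMem hp]
      have : ∃ i, (p.1 i, p.2 i) ∉ (Set.Ici (0 : ℝ)) ×ˢ (Set.Ici (0 : ℝ)) := by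
        by_contra! hcon
        exact hp ⟨fun i => (hcon i).1, fun i => (hcon i).2⟩
      obtain ⟨i, hi⟩ := this
      exact (Finset.prod_eq_zero (Finset.mem_univ i) (Set.indicator_of_notMem hi _)).symm
  rw [← setLIntegral_prod (fun p : (Fin n → ℝ) × (Fin n → ℝ) =>
    ENNReal.ofReal (Real.exp (-(p.2 ⬝ᵥ p.2 + p.1 ⬝ᵥ p.1) / 2 - p.1 ⬝ᵥ p.2))) (by
      simp only [dotProduct]; fun_prop),
    ← lintegral_indicator (measurableSet_Ici.prod measurableSet_Ici)]
  simp_rw [hprod]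
  have hmp := volume_measurePreserving_arrowProdEquivProdArrow ℝ ℝ (Fin n)
  rw [← Measure.volume_eq_prod, ← hmp.lintegral_comp_emb (MeasurableEquiv.measurableEmbedding _)]
  have h := lintegral_pi_prod (k := n) (volume : Measure (ℝ × ℝ)) (f := fun _ =>
    ((Set.Ici (0 : ℝ)) ×ˢ (Set.Ici (0 : ℝ))).indicator (fun p : ℝ × ℝ =>
        ENNReal.ofReal (Real.exp (-(p.1 + p.2) ^ 2 / 2))))
    (fun _ => Measurable.indicator (by fun_prop) (measurableSet_Ici.prod measurableSet_Ici))
  rw [lintegral_indicator (measurableSet_Ici.prod measurableSet_Ici),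
    setLIntegral_exp_neg_add_sq, Finset.prod_const_one] at h
  exact h

/-- The constant `∫_{c ≥ 0} ∫_{r ≥ 0} (1 + |c|²)^{-(d+1)/2} exp (-(|r|² + ⟨c, r⟩²) / 2)`. -/
theorem setLIntegral_orthants_kernel (n : ℕ) :
    ∫⁻ c in Set.Ici (0 : Fin n → ℝ), ∫⁻ r in Set.Ici (0 : Fin n → ℝ),
      ENNReal.ofReal ((√(1 + c ⬝ᵥ c))⁻¹ ^ (n + 1) * Real.exp (-(r ⬝ᵥ r + (c ⬝ᵥ r) ^ 2) / 2)) =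
      ENNReal.ofReal (√(Real.pi / 2) /
        ((1 / 2 : ℝ) ^ (-((n : ℝ) + 1) / 2) * (1 / 2) * Real.Gamma (((n : ℝ) + 1) / 2))) := by
  set κ : ℝ := (1 / 2 : ℝ) ^ (-((n : ℝ) + 1) / 2) * (1 / 2) * Real.Gamma (((n : ℝ) + 1) / 2) with hκ
  have hκ0 : 0 < κ := by
    have : 0 < Real.Gamma (((n : ℝ) + 1) / 2) := Real.Gamma_pos_of_pos (by positivity)
    positivity
  -- The power of 1 + |c|² is opened up as a radial Gaussian integral in an auxiliary variable s, at
  -- the price of the constant κ.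
  have hradial : ∀ c : Fin n → ℝ, ∫⁻ s in Set.Ioi (0 : ℝ),
      ENNReal.ofReal (s ^ n * Real.exp (-((1 + c ⬝ᵥ c) / 2) * s ^ 2)) =
      ENNReal.ofReal κ * ENNReal.ofReal ((√(1 + c ⬝ᵥ c))⁻¹ ^ (n + 1)) := by
    intro c
    have h1 : 0 < 1 + c ⬝ᵥ c := by have := dotProduct_self_nonneg_real c; linarith
    rw [lintegral_pow_mul_exp_neg_mul_sq n (by positivity), ← ENNReal.ofReal_mul hκ0.le]
    congr 1
    rw [hκ, div_eq_mul_one_div (1 + c ⬝ᵥ c), Real.mul_rpow h1.le (by norm_num)]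
    have : (√(1 + c ⬝ᵥ c))⁻¹ ^ (n + 1) = (1 + c ⬝ᵥ c) ^ (-((n : ℝ) + 1) / 2) := by
      rw [Real.sqrt_eq_rpow, ← Real.rpow_neg h1.le, ← Real.rpow_natCast, ← Real.rpow_mul h1.le]
      congr 1; push_cast; ring
    rw [this]; ring
  have key : ENNReal.ofReal κ * ∫⁻ c in Set.Ici (0 : Fin n → ℝ), ∫⁻ r in Set.Ici (0 : Fin n → ℝ),
      ENNReal.ofReal ((√(1 + c ⬝ᵥ c))⁻¹ ^ (n + 1) * Real.exp (-(r ⬝ᵥ r + (c ⬝ᵥ r) ^ 2) / 2)) =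
      ENNReal.ofReal √(Real.pi / 2) := by
    let F : (Fin n → ℝ) → (Fin n → ℝ) → ℝ → ℝ≥0∞ := fun c r s =>
      ENNReal.ofReal (s ^ n * Real.exp (-((1 + c ⬝ᵥ c) / 2) * s ^ 2)) *
        ENNReal.ofReal (Real.exp (-(r ⬝ᵥ r + (c ⬝ᵥ r) ^ 2) / 2))
    have hF : Measurable fun p : ((Fin n → ℝ) × ℝ) × (Fin n → ℝ) => F p.1.1 p.2 p.1.2 := by
      fun_prop
    let G : (Fin n → ℝ) → (Fin n → ℝ) → ℝ → ℝ≥0∞ := fun b r s =>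
      ENNReal.ofReal (Real.exp (-(r ⬝ᵥ r + b ⬝ᵥ b) / 2)) *
        ENNReal.ofReal (Real.exp (-(s ^ 2 + (b ⬝ᵥ r) ^ 2 / s ^ 2) / 2))
    have hG : Measurable fun p : ((Fin n → ℝ) × ℝ) × (Fin n → ℝ) => G p.1.1 p.2 p.1.2 := by
      fun_prop
    have h1 : ∀ c : Fin n → ℝ, ENNReal.ofReal κ * ∫⁻ r in Set.Ici (0 : Fin n → ℝ), ENNReal.ofReal
        ((√(1 + c ⬝ᵥ c))⁻¹ ^ (n + 1) * Real.exp (-(r ⬝ᵥ r + (c ⬝ᵥ r) ^ 2) / 2)) =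
        ∫⁻ s in Set.Ioi (0 : ℝ), ∫⁻ r in Set.Ici (0 : Fin n → ℝ), F c r s := by
      intro c
      have hFc : Measurable (Function.uncurry fun s r => F c r s) :=
        hF.comp (f := fun p : ℝ × (Fin n → ℝ) => ((c, p.1), p.2)) (by fun_prop)
      rw [lintegral_lintegral_swap hFc.aemeasurable, ← lintegral_const_mul _ (by fun_prop)]
      refine lintegral_congr fun r => ?_
      rw [lintegral_mul_const _ (by fun_prop), hradial, mul_assoc, ← ENNReal.ofReal_mul
        (by positivity : 0 ≤ (√(1 + c ⬝ᵥ c))⁻¹ ^ (n + 1))]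
    -- With c = b/s the Jacobian s^(-n) cancels the weight s^n, and ⟨c, r⟩² becomes ⟨b, r⟩²/s².
    have h2 : ∀ s ∈ Set.Ioi (0 : ℝ), ∫⁻ c in Set.Ici (0 : Fin n → ℝ),
        ∫⁻ r in Set.Ici (0 : Fin n → ℝ), F c r s = ∫⁻ b in Set.Ici (0 : Fin n → ℝ),
        ∫⁻ r in Set.Ici (0 : Fin n → ℝ), G b r s := by
      intro s hs
      have hs0 : 0 < s := hs
      have hFs : Measurable (fun p : (Fin n → ℝ) × (Fin n → ℝ) => F p.1 p.2 s) :=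
        hF.comp (f := fun p : (Fin n → ℝ) × (Fin n → ℝ) => ((p.1, s), p.2)) (by fun_prop)
      rw [setLIntegral_Ici_comp_smul (inv_pos.2 hs0) hFs.lintegral_prod_right',
        ← lintegral_const_mul _ (by
          exact hFs.lintegral_prod_right'.comp
            (g := fun c => ∫⁻ r in Set.Ici (0 : Fin n → ℝ), F c r s)
            (measurable_const_smul s⁻¹))]
      refine lintegral_congr fun b => ?_
      rw [← lintegral_const_mul' _ _ ENNReal.ofReal_ne_top]
      refine lintegral_congr fun r => ?_
      simp only [F, G]
      rw [← ENNReal.ofReal_mul (by positivity), ← ENNReal.ofReal_mul (by positivity),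
        ← ENNReal.ofReal_mul (by positivity), mul_assoc, ← mul_assoc, ← mul_pow,
        inv_mul_cancel₀ hs0.ne', one_pow, one_mul, ← Real.exp_add, ← Real.exp_add]
      congr 2
      simp only [smul_dotProduct, dotProduct_smul, smul_eq_mul]
      field_simp
      ring
    -- On the orthants ⟨b, r⟩ ≥ 0, so Cauchy–Schlömilch with parameter ⟨b, r⟩ integrates s out and
    -- leaves exp(-⟨b, r⟩), without an absolute value.
    have h3 : ∀ b ∈ Set.Ici (0 : Fin n → ℝ), ∫⁻ s in Set.Ioi (0 : ℝ),
        ∫⁻ r in Set.Ici (0 : Fin n → ℝ), G b r s = ENNReal.ofReal √(Real.pi / 2) *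
        ∫⁻ r in Set.Ici (0 : Fin n → ℝ),
          ENNReal.ofReal (Real.exp (-(r ⬝ᵥ r + b ⬝ᵥ b) / 2 - b ⬝ᵥ r)) := by
      intro b hb
      have hGb : Measurable (Function.uncurry fun s r => G b r s) :=
        hG.comp (f := fun p : ℝ × (Fin n → ℝ) => ((b, p.1), p.2)) (by fun_prop)
      rw [lintegral_lintegral_swap hGb.aemeasurable, ← lintegral_const_mul _ (by fun_prop)]
      refine setLIntegral_congr_fun measurableSet_Ici fun r hr => ?_
      have hbr : 0 ≤ b ⬝ᵥ r := Finset.sum_nonneg fun i _ => mul_nonneg (hb i) (hr i)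
      simp only [G]
      rw [lintegral_const_mul _ (by fun_prop), lintegral_exp_neg_sq_add_inv_sq hbr,
        ← ENNReal.ofReal_mul (by positivity), ← ENNReal.ofReal_mul (by positivity), sub_eq_add_neg,
        Real.exp_add]
      congr 1
      ring
    have hFcs : Measurable (Function.uncurry fun (c : Fin n → ℝ) (s : ℝ) =>
        ∫⁻ r in Set.Ici (0 : Fin n → ℝ), F c r s) := hF.lintegral_prod_right'
    have hGcs : Measurable (Function.uncurry fun (c : Fin n → ℝ) (s : ℝ) =>
        ∫⁻ r in Set.Ici (0 : Fin n → ℝ), G c r s) := hG.lintegral_prod_right'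
    have hmeas : Measurable fun b : Fin n → ℝ => ∫⁻ r in Set.Ici (0 : Fin n → ℝ),
        ENNReal.ofReal (Real.exp (-(r ⬝ᵥ r + b ⬝ᵥ b) / 2 - b ⬝ᵥ r)) := by
      have : Measurable fun p : (Fin n → ℝ) × (Fin n → ℝ) =>
        ENNReal.ofReal (Real.exp (-(p.2 ⬝ᵥ p.2 + p.1 ⬝ᵥ p.1) / 2 - p.1 ⬝ᵥ p.2)) := by fun_prop
      exact this.lintegral_prod_right'
    rw [← lintegral_const_mul' _ _ ENNReal.ofReal_ne_top, lintegral_congr h1,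
      lintegral_lintegral_swap hFcs.aemeasurable, setLIntegral_congr_fun measurableSet_Ioi h2,
      ← lintegral_lintegral_swap hGcs.aemeasurable, setLIntegral_congr_fun measurableSet_Ici h3,
      lintegral_const_mul _ hmeas, setLIntegral_orthants_exp, mul_one]
  have hne : ENNReal.ofReal κ ≠ 0 := by simpa using hκ0
  rw [ENNReal.ofReal_div_of_pos hκ0, ← key, mul_comm, ENNReal.mul_div_cancel_right hne
    ENNReal.ofReal_ne_top]

/-! ### Determinants with correlated Gaussian rows -/

theorem measurable_det {m : ℕ} : Measurable fun U : Fin m → Fin m → ℝ => (Matrix.of U).det :=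
  Continuous.measurable (Continuous.matrix_det (by fun_prop : Continuous fun U => Matrix.of U))

theorem abs_det_eq_inv_sqrt {m : ℕ} {M : Matrix (Fin m) (Fin m) ℝ} {a : Fin m → ℝ}
    (h : M.det ^ 2 * (1 + a ⬝ᵥ a) = 1) : |M.det| = (√(1 + a ⬝ᵥ a))⁻¹ := by
  have h0 : 0 ≤ 1 + a ⬝ᵥ a := by have := dotProduct_self_nonneg_real a; linarith
  have h1 : |M.det| * √(1 + a ⬝ᵥ a) = 1 := by
    rw [← Real.sqrt_sq_eq_abs, ← Real.sqrt_mul (sq_nonneg _), h, Real.sqrt_one]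
  exact eq_inv_of_mul_eq_one_left h1

/-- Gaussian second moment of the determinant, for rows whose precision matrix is `1 + c cᵀ`, the
first row being fixed. -/
theorem lintegral_det_sq_correlated {m : ℕ} (c r : Fin (m + 1) → ℝ) :
    ∫⁻ S : Fin m → Fin (m + 1) → ℝ, ENNReal.ofReal ((Matrix.of (Fin.cons r S)).det ^ 2 *
        Real.exp (-(∑ k, (S k ⬝ᵥ S k + (c ⬝ᵥ S k) ^ 2)) / 2)) =
      ENNReal.ofReal (m.factorial * √(2 * Real.pi) ^ (m * (m + 1)) *
        (√(1 + c ⬝ᵥ c))⁻¹ ^ (m + 2) * (r ⬝ᵥ r + (c ⬝ᵥ r) ^ 2)) := by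
  obtain ⟨M, -, -, -, -, hdet, -, hM⟩ := exists_whitening c
  have hw := abs_det_eq_inv_sqrt hdet
  have hne : M.transpose.det ≠ 0 := by
    rw [Matrix.det_transpose]
    intro h
    rw [h] at hdet
    simp at hdet
  -- The fixed row is whitened along with the others, so that the determinant factors as det(r', S)
  -- · det M. With the Jacobian |det M|^m this gives |det M|^(m+2).
  obtain ⟨r', rfl⟩ : ∃ r', M.transpose.mulVec r' = r :=
    ⟨M.transpose⁻¹.mulVec r, by
      rw [Matrix.mulVec_mulVec, Matrix.mul_nonsing_inv _ (Ne.isUnit hne), Matrix.one_mulVec]⟩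
  have hmeas : Measurable fun S : Fin m → Fin (m + 1) → ℝ => ENNReal.ofReal
      ((Matrix.of (Fin.cons (M.transpose.mulVec r') S)).det ^ 2 *
        Real.exp (-(∑ k, (S k ⬝ᵥ S k + (c ⬝ᵥ S k) ^ 2)) / 2)) := by
    have h1 : Measurable fun S : Fin m → Fin (m + 1) → ℝ =>
        (Matrix.of (Fin.cons (M.transpose.mulVec r') S)).det := by
      refine measurable_det.comp (f := fun S : Fin m → Fin (m + 1) → ℝ =>
        (Fin.cons (M.transpose.mulVec r') S : Fin (m + 1) → Fin (m + 1) → ℝ)) ?_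
      refine measurable_pi_iff.2 fun i => ?_
      refine Fin.cases ?_ (fun k => ?_) i
      · exact measurable_const
      · exact measurable_pi_apply k
    fun_prop
  rw [lintegral_comp_mulVec_pi _ hne hmeas]
  have h2 : ∀ S : Fin m → Fin (m + 1) → ℝ,
      (Matrix.of (Fin.cons (M.transpose.mulVec r') fun i => M.transpose.mulVec (S i))).det =
      (Matrix.of (Fin.cons r' S)).det * M.det := by
    intro S
    rw [← Matrix.det_mul]
    congr 1
    ext i j
    refine Fin.cases ?_ (fun k => ?_) i
    · simp [Matrix.mulVec, Matrix.mul_apply, dotProduct, mul_comm]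
    · simp [Matrix.mulVec, Matrix.mul_apply, dotProduct, mul_comm]
  have h3 : ∀ s : Fin (m + 1) → ℝ, M.transpose.mulVec s ⬝ᵥ M.transpose.mulVec s +
      (c ⬝ᵥ M.transpose.mulVec s) ^ 2 = s ⬝ᵥ s := fun s => by rw [sq]; exact hM s s
  simp only [h2, h3, mul_pow, Matrix.det_transpose, mul_right_comm _ (M.det ^ 2)]
  have h4 : ∀ S : Fin m → Fin (m + 1) → ℝ, ENNReal.ofReal ((Matrix.of (Fin.cons r' S)).det ^ 2 *
      Real.exp (-(∑ k, S k ⬝ᵥ S k) / 2) * M.det ^ 2) = ENNReal.ofReal (M.det ^ 2) *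
      ENNReal.ofReal ((Matrix.of (Fin.cons r' S)).det ^ 2 *
      Real.exp (-(∑ k, S k ⬝ᵥ S k) / 2)) := by
    intro S
    rw [← ENNReal.ofReal_mul (sq_nonneg _), mul_comm]
  simp_rw [h4]
  rw [lintegral_const_mul' _ _ ENNReal.ofReal_ne_top, lintegral_det_sq_gaussian,
    ← ENNReal.ofReal_pow (abs_nonneg _), ← ENNReal.ofReal_mul (sq_nonneg _),
    ← ENNReal.ofReal_mul (by positivity), ← sq_abs M.det, hw]
  congr 1
  ring

/-- The constant of the random-simplex integral in dimension `m + 1`. -/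
noncomputable def simplexConst (m : ℕ) : ℝ :=
  m.factorial * √(2 * Real.pi) ^ (m * (m + 1)) * ((m + 1) * (√(Real.pi / 2) /
    ((1 / 2 : ℝ) ^ (-((m + 1 : ℕ) + 1 : ℝ) / 2) * (1 / 2) *
      Real.Gamma (((m + 1 : ℕ) + 1 : ℝ) / 2))))

/-- Only the row U 0 is restricted. Integrating the other rows leaves the quadratic form of U 0 as a
factor; homogeneity trades that factor for m + 1, and the two-orthant kernel remains. -/
theorem lintegral_det_sq_halfspace (m : ℕ) :
    ∫⁻ c in Set.Ici (0 : Fin (m + 1) → ℝ),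
      ∫⁻ U in {U : Fin (m + 1) → Fin (m + 1) → ℝ | U 0 ∈ Set.Ici 0},
        ENNReal.ofReal ((Matrix.of U).det ^ 2 *
          Real.exp (-(∑ k, (U k ⬝ᵥ U k + (c ⬝ᵥ U k) ^ 2)) / 2)) =
      ENNReal.ofReal (simplexConst m) := by
  have hinner : ∀ c : Fin (m + 1) → ℝ,
      ∫⁻ U in {U : Fin (m + 1) → Fin (m + 1) → ℝ | U 0 ∈ Set.Ici 0},
        ENNReal.ofReal ((Matrix.of U).det ^ 2 *
          Real.exp (-(∑ k, (U k ⬝ᵥ U k + (c ⬝ᵥ U k) ^ 2)) / 2)) =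
      ENNReal.ofReal (m.factorial * √(2 * Real.pi) ^ (m * (m + 1)) * (m + 1)) *
        ∫⁻ r in Set.Ici (0 : Fin (m + 1) → ℝ), ENNReal.ofReal ((√(1 + c ⬝ᵥ c))⁻¹ ^ (m + 1 + 1) *
          Real.exp (-(r ⬝ᵥ r + (c ⬝ᵥ r) ^ 2) / 2)) := by
    intro c
    have hms : MeasurableSet {U : Fin (m + 1) → Fin (m + 1) → ℝ | U 0 ∈ Set.Ici 0} :=
      measurableSet_Ici.preimage (measurable_pi_apply 0)
    have hmeas : Measurable fun U : Fin (m + 1) → Fin (m + 1) → ℝ =>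
        {U : Fin (m + 1) → Fin (m + 1) → ℝ | U 0 ∈ Set.Ici 0}.indicator (fun U =>
        ENNReal.ofReal ((Matrix.of U).det ^ 2 *
          Real.exp (-(∑ k, (U k ⬝ᵥ U k + (c ⬝ᵥ U k) ^ 2)) / 2))) U := by
      refine Measurable.indicator ?_ hms
      have := measurable_det (m := m + 1)
      fun_prop
    rw [← lintegral_indicator hms, volume_pi, lintegral_pi_cons volume hmeas]
    have h1 : ∀ r : Fin (m + 1) → ℝ, ∫⁻ S : Fin m → Fin (m + 1) → ℝ,
        {U : Fin (m + 1) → Fin (m + 1) → ℝ | U 0 ∈ Set.Ici 0}.indicator (fun U =>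
        ENNReal.ofReal ((Matrix.of U).det ^ 2 *
          Real.exp (-(∑ k, (U k ⬝ᵥ U k + (c ⬝ᵥ U k) ^ 2)) / 2)))
          (Fin.cons r S) =
        (Set.Ici (0 : Fin (m + 1) → ℝ)).indicator (fun r =>
          ENNReal.ofReal (m.factorial * √(2 * Real.pi) ^ (m * (m + 1)) *
            (√(1 + c ⬝ᵥ c))⁻¹ ^ (m + 2)) * ENNReal.ofReal ((r ⬝ᵥ r + (c ⬝ᵥ r) ^ 2) *
              Real.exp (-(r ⬝ᵥ r + (c ⬝ᵥ r) ^ 2) / 2))) r := by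
      intro r
      by_cases hr : r ∈ Set.Ici (0 : Fin (m + 1) → ℝ)
      · rw [Set.indicator_of_mem hr]
        have : ∀ S : Fin m → Fin (m + 1) → ℝ,
            {U : Fin (m + 1) → Fin (m + 1) → ℝ | U 0 ∈ Set.Ici 0}.indicator (fun U =>
            ENNReal.ofReal ((Matrix.of U).det ^ 2 *
              Real.exp (-(∑ k, (U k ⬝ᵥ U k + (c ⬝ᵥ U k) ^ 2)) / 2))) (Fin.cons r S) =
            ENNReal.ofReal (Real.exp (-(r ⬝ᵥ r + (c ⬝ᵥ r) ^ 2) / 2)) *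
            ENNReal.ofReal ((Matrix.of (Fin.cons r S)).det ^ 2 *
              Real.exp (-(∑ k, (S k ⬝ᵥ S k + (c ⬝ᵥ S k) ^ 2)) / 2)) := by
          intro S
          rw [Set.indicator_of_mem (by simpa using hr), ← ENNReal.ofReal_mul (by positivity)]
          congr 1
          rw [Fin.sum_univ_succ, mul_left_comm, ← Real.exp_add]
          simp only [Fin.cons_zero, Fin.cons_succ]
          congr 2
          ring
        simp_rw [this]
        rw [lintegral_const_mul' _ _ ENNReal.ofReal_ne_top, lintegral_det_sq_correlated,
          ← ENNReal.ofReal_mul (by positivity), ← ENNReal.ofReal_mul (by positivity)]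
        congr 1
        ring
      · rw [Set.indicator_of_notMem hr]
        exact (lintegral_congr fun S => Set.indicator_of_notMem
          (s := {U : Fin (m + 1) → Fin (m + 1) → ℝ | U 0 ∈ Set.Ici 0}) hr _).trans lintegral_zero
    rw [← volume_pi, lintegral_congr h1]
    rw [lintegral_indicator measurableSet_Ici, lintegral_const_mul' _ _ ENNReal.ofReal_ne_top]
    have hq := setLIntegral_quadratic_mul_exp (n := m + 1) m.succ_pos
      (q := fun r => r ⬝ᵥ r + (c ⬝ᵥ r) ^ 2) (by fun_prop) (fun x hx => by
        have : 0 < x ⬝ᵥ x := lt_of_le_of_ne (dotProduct_self_nonneg_real x)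
          (fun h => hx (dotProduct_self_eq_zero.1 h.symm))
        positivity) (fun s x => by
        simp only [smul_dotProduct, dotProduct_smul, smul_eq_mul]; ring)
    rw [hq]
    simp_rw [ENNReal.ofReal_mul (show 0 ≤ (√(1 + c ⬝ᵥ c))⁻¹ ^ (m + 1 + 1) by positivity)]
    rw [lintegral_const_mul' _ _ ENNReal.ofReal_ne_top, ← mul_assoc, ← mul_assoc,
      ← ENNReal.ofReal_natCast, ← ENNReal.ofReal_mul (by positivity),
      ← ENNReal.ofReal_mul (by positivity)]
    congr 2
    push_cast
    ring
  simp_rw [hinner]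
  rw [lintegral_const_mul' _ _ ENNReal.ofReal_ne_top, setLIntegral_orthants_kernel,
    ← ENNReal.ofReal_mul (by positivity), simplexConst]
  congr 1
  push_cast
  ring

/-! ### The half-Gaussian model and the Blaschke–Petkantschin formula -/

/-- The normalised half-Gaussian density on `ℝ × ℝ^d`, supported by the closed half-space of points
with nonnegative first coordinate. -/
noncomputable def halfGaussianDensity (d : ℕ) (p : ℝ × (Fin d → ℝ)) : ℝ≥0∞ :=
  (Set.Ici (0 : ℝ) ×ˢ Set.univ).indicator (fun p => ENNReal.ofReal
    (2 * (√(2 * Real.pi))⁻¹ ^ (d + 1) * Real.exp (-(p.1 ^ 2 + p.2 ⬝ᵥ p.2) / 2))) p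

theorem measurable_halfGaussianDensity (d : ℕ) : Measurable (halfGaussianDensity d) :=
  Measurable.indicator (by fun_prop) (measurableSet_Ici.prod MeasurableSet.univ)

/-- The slope `a` of the hyperplane `{(h, z) | h = ⟨a, z⟩}` through the origin and `d` points. -/
noncomputable def slope {d : ℕ} (p : Fin d → ℝ × (Fin d → ℝ)) : Fin d → ℝ :=
  (Matrix.of fun i => (p i).2)⁻¹.mulVec fun i => (p i).1

/-- The Gaussian integral over the cone spanned by `d` points, with respect to Lebesgue measure of
the hyperplane spanned by them. -/
noncomputable def coneGaussian {d : ℕ} (p : Fin d → ℝ × (Fin d → ℝ)) : ℝ≥0∞ :=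
  ENNReal.ofReal (√(1 + slope p ⬝ᵥ slope p) * |(Matrix.of fun i => (p i).2).det|) *
    ∫⁻ c in Set.Ici (0 : Fin d → ℝ), ENNReal.ofReal (Real.exp
      (-((∑ i, c i • (p i).2) ⬝ᵥ (∑ i, c i • (p i).2) + (∑ i, c i * (p i).1) ^ 2) / 2))

/-- By Cramer's rule the slope is a polynomial map divided by a determinant. The identity also
covers singular matrices, where the inverse is zero by convention. -/
theorem measurable_slope {d : ℕ} : Measurable (slope (d := d)) := by
  have h : slope (d := d) = fun p => ((Matrix.of fun i => (p i).2).det)⁻¹ •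
      (Matrix.of fun i => (p i).2).adjugate.mulVec fun i => (p i).1 := by
    funext p
    rw [slope, Matrix.inv_def, Ring.inverse_eq_inv', Matrix.smul_mulVec]
  rw [h]
  have hd : Measurable fun p : Fin d → ℝ × (Fin d → ℝ) => (Matrix.of fun i => (p i).2).det :=
    (Continuous.matrix_det (by fun_prop)).measurable
  have ha : Measurable fun p : Fin d → ℝ × (Fin d → ℝ) =>
      (Matrix.of fun i => (p i).2).adjugate.mulVec fun i => (p i).1 :=
    ((Continuous.matrix_adjugate (by fun_prop : Continuous fun p : Fin d → ℝ × (Fin d → ℝ) =>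
      Matrix.of fun i => (p i).2)).matrix_mulVec (by fun_prop)).measurable
  exact hd.inv.smul ha

theorem measurable_coneGaussian {d : ℕ} : Measurable (coneGaussian (d := d)) := by
  have h1 := measurable_slope (d := d)
  have h2 : Measurable fun p : Fin d → ℝ × (Fin d → ℝ) => (Matrix.of fun i => (p i).2).det :=
    (Continuous.matrix_det (by fun_prop)).measurable
  refine Measurable.mul (by fun_prop) ?_
  have h3 : Measurable fun q : (Fin d → ℝ × (Fin d → ℝ)) × (Fin d → ℝ) =>
      ENNReal.ofReal (Real.exp (-((∑ i, q.2 i • (q.1 i).2) ⬝ᵥ (∑ i, q.2 i • (q.1 i).2) +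
        (∑ i, q.2 i * (q.1 i).1) ^ 2) / 2)) := by fun_prop
  exact h3.lintegral_prod_right'

/-- The Gaussian simplex integral over a half-space with inner normal `a`, for the quadratic form
of the hyperplane of slope `a`. -/
theorem lintegral_simplex_of_slope {m : ℕ} {a : Fin (m + 1) → ℝ} (ha : a ≠ 0) :
    ∫⁻ Z in {Z : Fin (m + 1) → Fin (m + 1) → ℝ | ∀ i, 0 ≤ a ⬝ᵥ Z i},
      ∫⁻ c in Set.Ici (0 : Fin (m + 1) → ℝ), ENNReal.ofReal ((Matrix.of Z).det ^ 2 * Real.exp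
        (-(∑ i, (Z i ⬝ᵥ Z i + (a ⬝ᵥ Z i) ^ 2) + ((∑ i, c i • Z i) ⬝ᵥ (∑ i, c i • Z i) +
          (a ⬝ᵥ ∑ i, c i • Z i) ^ 2)) / 2)) =
      ENNReal.ofReal ((√(1 + a ⬝ᵥ a))⁻¹ ^ (m + 3) * simplexConst m) := by
  obtain ⟨M, l, -, hl, hMa, hdet, -, hM⟩ := exists_whitening a
  have hl := hl ha
  have hw := abs_det_eq_inv_sqrt hdet
  have hne : M.transpose.det ≠ 0 := by
    rw [Matrix.det_transpose]
    intro h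
    rw [h] at hdet
    simp at hdet
  have haM : ∀ w : Fin (m + 1) → ℝ, a ⬝ᵥ M.transpose.mulVec w = l * w 0 := by
    intro w
    rw [Matrix.dotProduct_mulVec, Matrix.vecMul_transpose, hMa, single_dotProduct]
  have hquad : ∀ s : Fin (m + 1) → ℝ, M.transpose.mulVec s ⬝ᵥ M.transpose.mulVec s +
      (a ⬝ᵥ M.transpose.mulVec s) ^ 2 = s ⬝ᵥ s := fun s => by rw [sq]; exact hM s s
  have hset : MeasurableSet {Z : Fin (m + 1) → Fin (m + 1) → ℝ | ∀ i, 0 ≤ a ⬝ᵥ Z i} := by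
    have : {Z : Fin (m + 1) → Fin (m + 1) → ℝ | ∀ i, 0 ≤ a ⬝ᵥ Z i} =
      ⋂ i, {Z | 0 ≤ a ⬝ᵥ Z i} := by ext; simp
    rw [this]
    exact MeasurableSet.iInter fun i => measurableSet_le measurable_const (by fun_prop)
  have hset0 : MeasurableSet {U : Fin (m + 1) → Fin (m + 1) → ℝ | U 0 ∈ Set.Ici 0} :=
    measurableSet_Ici.preimage (measurable_pi_apply 0)
  have hdm := measurable_det (m := m + 1)
  have hmeas : Measurable fun q : (Fin (m + 1) → Fin (m + 1) → ℝ) × (Fin (m + 1) → ℝ) =>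
      ENNReal.ofReal ((Matrix.of q.1).det ^ 2 * Real.exp
        (-(∑ i, (q.1 i ⬝ᵥ q.1 i + (a ⬝ᵥ q.1 i) ^ 2) +
          ((∑ i, q.2 i • q.1 i) ⬝ᵥ (∑ i, q.2 i • q.1 i) +
          (a ⬝ᵥ ∑ i, q.2 i • q.1 i) ^ 2)) / 2)) := by fun_prop
  have hmeas2 : Measurable fun q : (Fin (m + 1) → Fin (m + 1) → ℝ) × (Fin (m + 1) → ℝ) =>
      ENNReal.ofReal ((Matrix.of q.1).det ^ 2 * Real.exp
        (-(∑ k, (q.1 k ⬝ᵥ q.1 k + (q.2 ⬝ᵥ q.1 k) ^ 2)) / 2)) := by fun_prop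
  -- Transposition gathers the conditions on all points into one condition on the first row U 0. It
  -- also turns |∑ c_i w_i|² into ∑_k ⟨c, U_k⟩², so that the rows become independent for fixed c.
  rw [← lintegral_indicator hset,
    lintegral_comp_mulVec_pi _ hne (hmeas.lintegral_prod_right'.indicator hset),
    lintegral_comp_transpose (by
      refine (hmeas.lintegral_prod_right'.indicator hset).comp (?_ : Measurable
        fun W : Fin (m + 1) → Fin (m + 1) → ℝ => fun i => M.transpose.mulVec (W i))
      exact Continuous.measurable (by fun_prop))]
  have hpt : ∀ U : Fin (m + 1) → Fin (m + 1) → ℝ,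
      {Z : Fin (m + 1) → Fin (m + 1) → ℝ | ∀ i, 0 ≤ a ⬝ᵥ Z i}.indicator (fun Z =>
        ∫⁻ c in Set.Ici (0 : Fin (m + 1) → ℝ), ENNReal.ofReal ((Matrix.of Z).det ^ 2 * Real.exp
        (-(∑ i, (Z i ⬝ᵥ Z i + (a ⬝ᵥ Z i) ^ 2) + ((∑ i, c i • Z i) ⬝ᵥ (∑ i, c i • Z i) +
          (a ⬝ᵥ ∑ i, c i • Z i) ^ 2)) / 2))) (fun i => M.transpose.mulVec fun j => U j i) =
      ENNReal.ofReal (M.det ^ 2) *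
      {U : Fin (m + 1) → Fin (m + 1) → ℝ | U 0 ∈ Set.Ici 0}.indicator (fun U =>
        ∫⁻ c in Set.Ici (0 : Fin (m + 1) → ℝ), ENNReal.ofReal ((Matrix.of U).det ^ 2 * Real.exp
          (-(∑ k, (U k ⬝ᵥ U k + (c ⬝ᵥ U k) ^ 2)) / 2))) U := by
    intro U
    by_cases hU : U 0 ∈ Set.Ici (0 : Fin (m + 1) → ℝ)
    · rw [Set.indicator_of_mem (s := {U : Fin (m + 1) → Fin (m + 1) → ℝ | U 0 ∈ Set.Ici 0}) hU,
        Set.indicator_of_mem, ← lintegral_const_mul' _ _ ENNReal.ofReal_ne_top]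
      · refine lintegral_congr fun c => ?_
        rw [← ENNReal.ofReal_mul (sq_nonneg _), ← mul_assoc]
        have h1 : (Matrix.of fun i => M.transpose.mulVec fun j => U j i).det =
            M.det * (Matrix.of U).det := by
          rw [← Matrix.det_transpose (Matrix.of U), mul_comm, ← Matrix.det_mul]
          congr 1
          ext i j
          simp [Matrix.mulVec, Matrix.mul_apply, dotProduct, mul_comm]
        have h2 : ∑ i, c i • M.transpose.mulVec (fun j => U j i) =
            M.transpose.mulVec fun j => c ⬝ᵥ U j := by
          have : (fun j => c ⬝ᵥ U j) = ∑ i, c i • fun j => U j i := by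
            funext j
            simp [dotProduct]
          rw [this, Matrix.mulVec_sum]
          simp_rw [Matrix.mulVec_smul]
        rw [h1, h2, mul_pow]
        simp_rw [hquad]
        congr 4
        simp only [dotProduct, Finset.sum_add_distrib]
        rw [Finset.sum_comm]
        simp only [sq]
      · intro i
        rw [haM]
        exact mul_nonneg hl.le (hU i)
    · rw [Set.indicator_of_notMem (s := {U : Fin (m + 1) → Fin (m + 1) → ℝ | U 0 ∈ Set.Ici 0}) hU,
        Set.indicator_of_notMem, mul_zero]
      intro h
      refine hU fun i => ?_
      have := h i
      change 0 ≤ _ at this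
      rw [haM] at this
      exact nonneg_of_mul_nonneg_right this hl
  rw [lintegral_congr hpt, lintegral_const_mul' _ _ ENNReal.ofReal_ne_top,
    lintegral_indicator hset0, lintegral_lintegral_swap hmeas2.aemeasurable,
    lintegral_det_sq_halfspace, ← ENNReal.ofReal_pow (abs_nonneg _),
    ← ENNReal.ofReal_mul (sq_nonneg _), ← ENNReal.ofReal_mul (by positivity),
    Matrix.det_transpose, ← sq_abs M.det, hw]
  congr 1
  ring

/-- The normalising constant of the half-Gaussian simplex integral. -/
noncomputable def facetConst (m : ℕ) : ℝ :=
  (2 * (√(2 * Real.pi))⁻¹ ^ (m + 2)) ^ (m + 1) * simplexConst m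

theorem prod_halfGaussianDensity {d : ℕ} (h : Fin d → ℝ) (Z : Fin d → Fin d → ℝ) :
    ∏ i, halfGaussianDensity d (h i, Z i) =
      {h : Fin d → ℝ | ∀ i, 0 ≤ h i}.indicator (fun h => ENNReal.ofReal
        ((2 * (√(2 * Real.pi))⁻¹ ^ (d + 1)) ^ d *
          Real.exp (-(∑ i, (Z i ⬝ᵥ Z i + h i ^ 2)) / 2))) h := by
  by_cases hh : h ∈ {h : Fin d → ℝ | ∀ i, 0 ≤ h i}
  · rw [Set.indicator_of_mem hh]
    have : ∀ i, halfGaussianDensity d (h i, Z i) = ENNReal.ofReal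
        (2 * (√(2 * Real.pi))⁻¹ ^ (d + 1) * Real.exp (-(h i ^ 2 + Z i ⬝ᵥ Z i) / 2)) := fun i =>
      Set.indicator_of_mem (s := Set.Ici (0 : ℝ) ×ˢ Set.univ) (a := (h i, Z i)) ⟨hh i, trivial⟩ _
    simp_rw [this]
    rw [← ENNReal.ofReal_prod_of_nonneg fun i _ => by positivity, Finset.prod_mul_distrib,
      ← Real.exp_sum, ← Finset.sum_div, Finset.sum_neg_distrib]
    simp [add_comm]
  · rw [Set.indicator_of_notMem hh]
    have : ∃ i, ¬ 0 ≤ h i := not_forall.1 hh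
    obtain ⟨i, hi⟩ := this
    refine Finset.prod_eq_zero (Finset.mem_univ i) ?_
    exact Set.indicator_of_notMem (s := Set.Ici (0 : ℝ) ×ˢ Set.univ) (a := (h i, Z i))
      (fun hm => hi hm.1) _

theorem slope_mulVec {d : ℕ} {Z : Fin d → Fin d → ℝ} (hZ : (Matrix.of Z).det ≠ 0)
    (a : Fin d → ℝ) : slope (fun i => ((Matrix.of Z).mulVec a i, Z i)) = a := by
  change (Matrix.of Z)⁻¹.mulVec ((Matrix.of Z).mulVec a) = a
  rw [Matrix.mulVec_mulVec, Matrix.nonsing_inv_mul _ (Ne.isUnit hZ), Matrix.one_mulVec]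

/-- Linear Blaschke–Petkantschin formula for `d` half-Gaussian points: integration over the points
is replaced by integration over the slope of the hyperplane spanned by them. -/
theorem lintegral_halfGaussian_coneGaussian {m : ℕ} {Φ : (Fin (m + 1) → ℝ) → ℝ≥0∞}
    (hΦ : Measurable Φ) :
    ∫⁻ p : Fin (m + 1) → ℝ × (Fin (m + 1) → ℝ), (∏ i, halfGaussianDensity (m + 1) (p i)) *
      (coneGaussian p * Φ (slope p)) =
    ∫⁻ a, ENNReal.ofReal (facetConst m * (√(1 + a ⬝ᵥ a))⁻¹ ^ (m + 2)) * Φ a := by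
  set k : ℝ := (2 * (√(2 * Real.pi))⁻¹ ^ (m + 1 + 1)) ^ (m + 1) with hk
  have hk0 : 0 ≤ k := by positivity
  have hdens := measurable_halfGaussianDensity (m + 1)
  have hslope := measurable_slope (d := m + 1)
  have hcone := measurable_coneGaussian (d := m + 1)
  have hdm := measurable_det (m := m + 1)
  let F : (Fin (m + 1) → ℝ × (Fin (m + 1) → ℝ)) → ℝ≥0∞ := fun p =>
    (∏ i, halfGaussianDensity (m + 1) (p i)) * (coneGaussian p * Φ (slope p))
  have hF : Measurable F := by fun_prop
  let G : (Fin (m + 1) → ℝ) × (Fin (m + 1) → Fin (m + 1) → ℝ) → ℝ≥0∞ := fun q =>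
    F fun i => (q.1 i, q.2 i)
  have hG : Measurable G := hF.comp (by fun_prop)
  let H : (Fin (m + 1) → ℝ) → (Fin (m + 1) → Fin (m + 1) → ℝ) → ℝ≥0∞ := fun a Z =>
    {Z : Fin (m + 1) → Fin (m + 1) → ℝ | ∀ i, 0 ≤ a ⬝ᵥ Z i}.indicator (fun Z =>
      ∫⁻ c in Set.Ici (0 : Fin (m + 1) → ℝ), ENNReal.ofReal ((Matrix.of Z).det ^ 2 * Real.exp
        (-(∑ i, (Z i ⬝ᵥ Z i + (a ⬝ᵥ Z i) ^ 2) + ((∑ i, c i • Z i) ⬝ᵥ (∑ i, c i • Z i) +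
          (a ⬝ᵥ ∑ i, c i • Z i) ^ 2)) / 2))) Z
  have hHm : Measurable (Function.uncurry H) := by
    have h1 : Measurable fun q : ((Fin (m + 1) → ℝ) × (Fin (m + 1) → Fin (m + 1) → ℝ)) ×
        (Fin (m + 1) → ℝ) => ENNReal.ofReal ((Matrix.of q.1.2).det ^ 2 * Real.exp
        (-(∑ i, (q.1.2 i ⬝ᵥ q.1.2 i + (q.1.1 ⬝ᵥ q.1.2 i) ^ 2) +
          ((∑ i, q.2 i • q.1.2 i) ⬝ᵥ (∑ i, q.2 i • q.1.2 i) +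
          (q.1.1 ⬝ᵥ ∑ i, q.2 i • q.1.2 i) ^ 2)) / 2)) := by fun_prop
    have hs : MeasurableSet {q : (Fin (m + 1) → ℝ) × (Fin (m + 1) → Fin (m + 1) → ℝ) |
        ∀ i, 0 ≤ q.1 ⬝ᵥ q.2 i} := by
      have : {q : (Fin (m + 1) → ℝ) × (Fin (m + 1) → Fin (m + 1) → ℝ) |
          ∀ i, 0 ≤ q.1 ⬝ᵥ q.2 i} = ⋂ i, {q | 0 ≤ q.1 ⬝ᵥ q.2 i} := by ext; simp
      rw [this]
      exact MeasurableSet.iInter fun i => measurableSet_le measurable_const (by fun_prop)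
    exact h1.lintegral_prod_right'.indicator hs
  -- For regular Z the heights are substituted by Z a, after which a is the slope. The Jacobian and
  -- the cone integral supply one factor |det Z| each; for singular Z both sides vanish.
  have hinner : ∀ Z : Fin (m + 1) → Fin (m + 1) → ℝ, ∫⁻ h, G (h, Z) =
      ∫⁻ a, ENNReal.ofReal (k * √(1 + a ⬝ᵥ a)) * Φ a * H a Z := by
    intro Z
    by_cases hZ : (Matrix.of Z).det = 0
    · have h1 : ∀ h, G (h, Z) = 0 := by
        intro h
        simp only [G, F, coneGaussian]
        rw [show (Matrix.of fun i => Z i).det = 0 from hZ]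
        simp
      have h2 : ∀ a, H a Z = 0 := by
        intro a
        simp only [H]
        refine Set.indicator_apply_eq_zero.2 fun _ => ?_
        simp [hZ]
      simp [h1, h2]
    · rw [lintegral_comp_mulVec (Matrix.of Z) hZ (F := fun h => G (h, Z)) (hG.comp (by fun_prop)),
        ← lintegral_const_mul' _ _ ENNReal.ofReal_ne_top]
      refine lintegral_congr fun a => ?_
      simp only [G, F, slope_mulVec hZ, H, prod_halfGaussianDensity]
      have hza : ∀ i, (Matrix.of Z).mulVec a i = a ⬝ᵥ Z i := fun i => dotProduct_comm _ _
      by_cases ha : ∀ i, 0 ≤ a ⬝ᵥ Z i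
      · have hmem : Z ∈ {Z : Fin (m + 1) → Fin (m + 1) → ℝ | ∀ i, 0 ≤ a ⬝ᵥ Z i} := ha
        have hmem' : (Matrix.of Z).mulVec a ∈ {h : Fin (m + 1) → ℝ | ∀ i, 0 ≤ h i} :=
          fun i => (ha i).trans_eq (hza i).symm
        rw [Set.indicator_of_mem hmem', Set.indicator_of_mem hmem]
        have hsl : slope (fun i => (a ⬝ᵥ Z i, Z i)) = a := by
          have h := slope_mulVec hZ a
          simp only [hza] at h
          exact h
        simp only [coneGaussian, hza, hsl, ← hk]
        have hsum : ∀ c : Fin (m + 1) → ℝ, ∑ i, c i * a ⬝ᵥ Z i = a ⬝ᵥ ∑ i, c i • Z i := by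
          intro c
          rw [dotProduct_sum]
          simp [dotProduct_smul]
        simp only [hsum]
        have hsplit : ∀ c : Fin (m + 1) → ℝ, ENNReal.ofReal ((Matrix.of Z).det ^ 2 * Real.exp
            (-(∑ i, (Z i ⬝ᵥ Z i + (a ⬝ᵥ Z i) ^ 2) + ((∑ i, c i • Z i) ⬝ᵥ (∑ i, c i • Z i) +
            (a ⬝ᵥ ∑ i, c i • Z i) ^ 2)) / 2)) = ENNReal.ofReal (|(Matrix.of Z).det| ^ 2 *
            Real.exp (-(∑ i, (Z i ⬝ᵥ Z i + (a ⬝ᵥ Z i) ^ 2)) / 2)) * ENNReal.ofReal (Real.exp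
            (-((∑ i, c i • Z i) ⬝ᵥ (∑ i, c i • Z i) + (a ⬝ᵥ ∑ i, c i • Z i) ^ 2) / 2)) := by
          intro c
          rw [← ENNReal.ofReal_mul (by positivity), mul_assoc, ← Real.exp_add, sq_abs]
          congr 3
          ring
        simp_rw [hsplit]
        rw [lintegral_const_mul' _ _ ENNReal.ofReal_ne_top]
        set I := ∫⁻ c in Set.Ici (0 : Fin (m + 1) → ℝ), ENNReal.ofReal (Real.exp
            (-((∑ i, c i • Z i) ⬝ᵥ (∑ i, c i • Z i) + (a ⬝ᵥ ∑ i, c i • Z i) ^ 2) / 2))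
        have hcomb : ENNReal.ofReal |(Matrix.of Z).det| * (ENNReal.ofReal (k *
            Real.exp (-(∑ i, (Z i ⬝ᵥ Z i + (a ⬝ᵥ Z i) ^ 2)) / 2)) *
            ENNReal.ofReal (√(1 + a ⬝ᵥ a) * |(Matrix.of Z).det|)) =
            ENNReal.ofReal (k * √(1 + a ⬝ᵥ a)) * ENNReal.ofReal (|(Matrix.of Z).det| ^ 2 *
            Real.exp (-(∑ i, (Z i ⬝ᵥ Z i + (a ⬝ᵥ Z i) ^ 2)) / 2)) := by
          rw [← ENNReal.ofReal_mul (by positivity), ← ENNReal.ofReal_mul (by positivity),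
            ← ENNReal.ofReal_mul (by positivity)]
          congr 1
          ring
        calc _ = ENNReal.ofReal |(Matrix.of Z).det| * (ENNReal.ofReal (k *
            Real.exp (-(∑ i, (Z i ⬝ᵥ Z i + (a ⬝ᵥ Z i) ^ 2)) / 2)) *
            ENNReal.ofReal (√(1 + a ⬝ᵥ a) * |(Matrix.of Z).det|)) * (I * Φ a) := by ring
          _ = _ := by rw [hcomb]; ring
      · have hmem : Z ∉ {Z : Fin (m + 1) → Fin (m + 1) → ℝ | ∀ i, 0 ≤ a ⬝ᵥ Z i} := ha
        have hmem' : (Matrix.of Z).mulVec a ∉ {h : Fin (m + 1) → ℝ | ∀ i, 0 ≤ h i} :=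
          fun hm => ha fun i => (hm i).trans_eq (hza i)
        rw [Set.indicator_of_notMem hmem', Set.indicator_of_notMem hmem]
        simp
  have hmp := volume_measurePreserving_arrowProdEquivProdArrow ℝ (Fin (m + 1) → ℝ) (Fin (m + 1))
  have h1 : ∫⁻ p, F p = ∫⁻ q, G q := by
    rw [← hmp.lintegral_comp hG]
    rfl
  change ∫⁻ p, F p = _
  have hwm : Measurable fun a : Fin (m + 1) → ℝ => ENNReal.ofReal (k * √(1 + a ⬝ᵥ a)) * Φ a := by
    fun_prop
  have hHswap : Measurable (Function.uncurry fun (a : Fin (m + 1) → ℝ) Z =>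
      ENNReal.ofReal (k * √(1 + a ⬝ᵥ a)) * Φ a * H a Z) :=
    (hwm.comp measurable_fst).mul hHm
  rw [h1, Measure.volume_eq_prod, lintegral_prod_symm _ hG.aemeasurable, lintegral_congr hinner,
    ← lintegral_lintegral_swap hHswap.aemeasurable]
  -- At slope zero the half-space condition is void and the simplex integral has another value, but
  -- this is a single point.
  refine lintegral_congr_ae ((Measure.ae_ne volume (0 : Fin (m + 1) → ℝ)).mono fun a ha => ?_)
  have hs : MeasurableSet {Z : Fin (m + 1) → Fin (m + 1) → ℝ | ∀ i, 0 ≤ a ⬝ᵥ Z i} := by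
    have : {Z : Fin (m + 1) → Fin (m + 1) → ℝ | ∀ i, 0 ≤ a ⬝ᵥ Z i} =
      ⋂ i, {Z | 0 ≤ a ⬝ᵥ Z i} := by ext; simp
    rw [this]
    exact MeasurableSet.iInter fun i => measurableSet_le measurable_const (by fun_prop)
  have hHa : Measurable (H a) := hHm.comp measurable_prodMk_left
  have hHint : ∫⁻ Z, H a Z = ENNReal.ofReal ((√(1 + a ⬝ᵥ a))⁻¹ ^ (m + 3) * simplexConst m) := by
    rw [← lintegral_simplex_of_slope ha, ← lintegral_indicator hs]
  simp only
  rw [lintegral_const_mul _ hHa, hHint, mul_right_comm, ← ENNReal.ofReal_mul (by positivity)]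
  congr 2
  have hw : √(1 + a ⬝ᵥ a) ≠ 0 := by
    have := dotProduct_self_nonneg_real a
    positivity
  rw [facetConst, ← hk, pow_succ _ (m + 2)]
  field_simp

/-! ### Half-Gaussian mass on either side of a hyperplane -/

theorem lintegral_gaussian (n : ℕ) :
    ∫⁻ x : Fin n → ℝ, ENNReal.ofReal (Real.exp (-(x ⬝ᵥ x) / 2)) =
      ENNReal.ofReal (√(2 * Real.pi) ^ n) := by
  have h0 := integrable_pow_mul_gaussian 0
  simp only [pow_zero, one_mul] at h0
  have h1 : ∫⁻ x : ℝ, ENNReal.ofReal (Real.exp (-(x * x) / 2)) =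
      ENNReal.ofReal √(2 * Real.pi) := by
    rw [← integral_gaussian_weight, ofReal_integral_eq_lintegral_ofReal h0
      (Filter.Eventually.of_forall fun _ => by positivity)]
  have h := lintegral_pi_prod (k := n) (volume : Measure ℝ)
    (f := fun _ x => ENNReal.ofReal (Real.exp (-(x * x) / 2))) (fun _ => by fun_prop)
  simp only [h1, Finset.prod_const, Finset.card_univ, Fintype.card_fin] at h
  rw [ENNReal.ofReal_pow (Real.sqrt_nonneg _), ← h, volume_pi]
  refine lintegral_congr fun x => ?_
  rw [← ENNReal.ofReal_prod_of_nonneg fun i _ => Real.exp_nonneg _, ← Real.exp_sum,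
    ← Finset.sum_div, Finset.sum_neg_distrib]
  rfl

theorem lintegral_half_gaussian :
    ∫⁻ h in Set.Ici (0 : ℝ), ENNReal.ofReal (Real.exp (-h ^ 2 / 2)) =
      ENNReal.ofReal (√(2 * Real.pi) / 2) := by
  have h := lintegral_exp_neg_sq_add_inv_sq le_rfl
  rw [setLIntegral_congr Ioi_ae_eq_Ici.symm]
  simp only [ne_eq, OfNat.ofNat_ne_zero, not_false_eq_true, zero_pow, zero_div, add_zero, neg_zero,
    Real.exp_zero, mul_one] at h
  rw [h]
  congr 1
  rw [Real.sqrt_eq_iff_mul_self_eq (by positivity) (by positivity)]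
  have := Real.mul_self_sqrt (show 0 ≤ 2 * Real.pi by positivity)
  linear_combination -this / 4

/-- The half-Gaussian probability measure. -/
noncomputable def halfGaussian (d : ℕ) : Measure (ℝ × (Fin d → ℝ)) :=
  volume.withDensity (halfGaussianDensity d)

theorem halfGaussianDensity_eq {d : ℕ} (h : ℝ) (z : Fin d → ℝ) :
    halfGaussianDensity d (h, z) = (Set.Ici (0 : ℝ)).indicator (fun h =>
      ENNReal.ofReal (2 * (√(2 * Real.pi))⁻¹ ^ (d + 1)) *
        ENNReal.ofReal (Real.exp (-h ^ 2 / 2))) h * ENNReal.ofReal (Real.exp (-(z ⬝ᵥ z) / 2)) := by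
  by_cases hh : h ∈ Set.Ici (0 : ℝ)
  · have hm : (h, z) ∈ (Set.Ici (0 : ℝ)) ×ˢ (Set.univ : Set (Fin d → ℝ)) := ⟨hh, trivial⟩
    rw [halfGaussianDensity, Set.indicator_of_mem hm, Set.indicator_of_mem hh,
      ← ENNReal.ofReal_mul (by positivity), ← ENNReal.ofReal_mul (by positivity), mul_assoc _
      (Real.exp (-h ^ 2 / 2)), ← Real.exp_add]
    congr 3
    ring
  · have hm : (h, z) ∉ (Set.Ici (0 : ℝ)) ×ˢ (Set.univ : Set (Fin d → ℝ)) := fun hm => hh hm.1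
    rw [halfGaussianDensity, Set.indicator_of_notMem hm, Set.indicator_of_notMem hh, zero_mul]

instance isProbabilityMeasure_halfGaussian (d : ℕ) : IsProbabilityMeasure (halfGaussian d) := by
  refine ⟨?_⟩
  have h1 : ∫⁻ h, (Set.Ici (0 : ℝ)).indicator (fun h =>
      ENNReal.ofReal (2 * (√(2 * Real.pi))⁻¹ ^ (d + 1)) *
        ENNReal.ofReal (Real.exp (-h ^ 2 / 2))) h =
      ENNReal.ofReal ((√(2 * Real.pi))⁻¹ ^ d) := by
    rw [lintegral_indicator measurableSet_Ici, lintegral_const_mul' _ _ ENNReal.ofReal_ne_top,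
      lintegral_half_gaussian, ← ENNReal.ofReal_mul (by positivity)]
    congr 1
    have : √(2 * Real.pi) ≠ 0 := by positivity
    rw [pow_succ]
    field_simp
  have h2 := lintegral_prod_mul (μ := (volume : Measure ℝ)) (ν := (volume : Measure (Fin d → ℝ)))
    (f := (Set.Ici (0 : ℝ)).indicator (fun h =>
      ENNReal.ofReal (2 * (√(2 * Real.pi))⁻¹ ^ (d + 1)) *
        ENNReal.ofReal (Real.exp (-h ^ 2 / 2))))
    (g := fun z => ENNReal.ofReal (Real.exp (-(z ⬝ᵥ z) / 2)))
    (Measurable.indicator (by fun_prop) measurableSet_Ici).aemeasurable (by fun_prop)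
  rw [halfGaussian, withDensity_apply _ MeasurableSet.univ, Measure.restrict_univ,
    Measure.volume_eq_prod, lintegral_congr fun p : ℝ × (Fin d → ℝ) =>
      halfGaussianDensity_eq p.1 p.2,
    h2, h1, lintegral_gaussian, ← ENNReal.ofReal_mul (by positivity), ← mul_pow, inv_mul_cancel₀
      (by positivity), one_pow, ENNReal.ofReal_one]

theorem halfGaussian_absolutelyContinuous (d : ℕ) : halfGaussian d ≪ volume :=
  withDensity_absolutelyContinuous _ _

/-- The Gaussian mass of a planar wedge. -/
theorem lintegral_wedge {n : ℝ} (hn : 0 ≤ n) :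
    ∫⁻ t : ℝ, ENNReal.ofReal (Real.exp (-t ^ 2 / 2)) *
      ∫⁻ h in Set.Ico 0 (n * t), ENNReal.ofReal (Real.exp (-h ^ 2 / 2)) =
      ENNReal.ofReal (Real.arctan n) := by
  -- With h = t s the wedge becomes t > 0, 0 ≤ s < n. Integrating t first leaves (1 + s²)⁻¹, whence
  -- the arctangent.
  have h1 : ∀ t : ℝ, ENNReal.ofReal (Real.exp (-t ^ 2 / 2)) *
      ∫⁻ h in Set.Ico 0 (n * t), ENNReal.ofReal (Real.exp (-h ^ 2 / 2)) =
      (Set.Ioi (0 : ℝ)).indicator (fun t => ∫⁻ s in Set.Ico 0 n,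
        ENNReal.ofReal (t ^ 1 * Real.exp (-((1 + s ^ 2) / 2) * t ^ 2))) t := by
    intro t
    by_cases ht : t ∈ Set.Ioi (0 : ℝ)
    · have ht0 : 0 < t := ht
      rw [Set.indicator_of_mem ht]
      have himg : (fun s : ℝ => t * s) '' Set.Ico 0 n = Set.Ico 0 (n * t) := by
        rw [Set.image_mul_left_Ico ht0, mul_zero, mul_comm t]
      have h := lintegral_image_eq_lintegral_abs_deriv_mul (f := fun s : ℝ => t * s)
        (f' := fun _ => t) (measurableSet_Ico (a := (0 : ℝ)) (b := n))
        (fun s _ => by simpa using ((hasDerivAt_id s).const_mul t).hasDerivWithinAt)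
        (fun x _ y _ hxy => mul_left_cancel₀ ht0.ne' hxy)
        (fun h => ENNReal.ofReal (Real.exp (-h ^ 2 / 2)))
      rw [← himg, h, ← lintegral_const_mul' _ _ ENNReal.ofReal_ne_top]
      refine lintegral_congr fun s => ?_
      rw [abs_of_pos ht0, ← ENNReal.ofReal_mul ht0.le, ← ENNReal.ofReal_mul (by positivity),
        mul_left_comm, ← Real.exp_add]
      congr 2
      · ring
      · congr 1; ring
    · have ht0 : t ≤ 0 := not_lt.1 ht
      rw [Set.indicator_of_notMem ht, Set.Ico_eq_empty (not_lt.2 (mul_nonpos_of_nonneg_of_nonpos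
        hn ht0))]
      simp
  have hmeas : Measurable (Function.uncurry fun t s : ℝ =>
      ENNReal.ofReal (t ^ 1 * Real.exp (-((1 + s ^ 2) / 2) * t ^ 2))) := by fun_prop
  rw [lintegral_congr h1, lintegral_indicator measurableSet_Ioi,
    lintegral_lintegral_swap hmeas.aemeasurable]
  have h2 : ∀ s : ℝ, ∫⁻ t in Set.Ioi (0 : ℝ),
      ENNReal.ofReal (t ^ 1 * Real.exp (-((1 + s ^ 2) / 2) * t ^ 2)) =
      ENNReal.ofReal ((1 + s ^ 2)⁻¹) := by
    intro s
    rw [lintegral_pow_mul_exp_neg_mul_sq 1 (by positivity)]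
    congr 1
    norm_num [Real.rpow_neg_one]
  rw [lintegral_congr h2, setLIntegral_congr Ico_ae_eq_Ioc, ← ofReal_integral_eq_lintegral_ofReal,
    ← intervalIntegral.integral_of_le hn, integral_inv_one_add_sq, Real.arctan_zero, sub_zero]
  · exact (integrable_inv_one_add_sq.integrableOn)
  · exact Filter.Eventually.of_forall fun s => by positivity

/-- The half-Gaussian mass below the hyperplane of slope `a`. -/
theorem halfGaussian_below {m : ℕ} (a : Fin (m + 1) → ℝ) :
    halfGaussian (m + 1) {p | p.1 < a ⬝ᵥ p.2} =
      ENNReal.ofReal (Real.arctan √(a ⬝ᵥ a) / Real.pi) := by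
  obtain ⟨R, hR, hRa⟩ := exists_rotation a
  obtain ⟨hdet, hRR, haR⟩ := rotation_transpose hR hRa
  have hs : MeasurableSet {p : ℝ × (Fin (m + 1) → ℝ) | p.1 < a ⬝ᵥ p.2} :=
    measurableSet_lt (by fun_prop) (by fun_prop)
  set c : ℝ := 2 * (√(2 * Real.pi))⁻¹ ^ (m + 1 + 1) with hc
  have hc0 : 0 ≤ c := by positivity
  -- The mass of the heights below u depends on z only through ⟨a, z⟩. After rotation this is √(a ⬝ᵥ
  -- a) times one coordinate, so all other coordinates integrate out and a planar wedge is left.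
  let W : ℝ → ℝ≥0∞ := fun u => ∫⁻ h in Set.Ico 0 u, ENNReal.ofReal (Real.exp (-h ^ 2 / 2))
  have hW : Measurable W := by
    have hs : MeasurableSet {q : ℝ × ℝ | 0 ≤ q.2 ∧ q.2 < q.1} :=
      (measurableSet_le measurable_const measurable_snd).inter
        (measurableSet_lt measurable_snd measurable_fst)
    have h1 : Measurable fun q : ℝ × ℝ => {q : ℝ × ℝ | 0 ≤ q.2 ∧ q.2 < q.1}.indicator
        (fun q => ENNReal.ofReal (Real.exp (-q.2 ^ 2 / 2))) q :=
      Measurable.indicator (by fun_prop) hs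
    have h2 : W = fun u => ∫⁻ h, {q : ℝ × ℝ | 0 ≤ q.2 ∧ q.2 < q.1}.indicator
        (fun q => ENNReal.ofReal (Real.exp (-q.2 ^ 2 / 2))) (u, h) := by
      funext u
      simp only [W]
      rw [← lintegral_indicator measurableSet_Ico]
      rfl
    rw [h2]
    exact h1.lintegral_prod_right'
  have hdens := measurable_halfGaussianDensity (m + 1)
  have hpt : ∀ z : Fin (m + 1) → ℝ, ∫⁻ h, {p : ℝ × (Fin (m + 1) → ℝ) | p.1 < a ⬝ᵥ p.2}.indicator
      (halfGaussianDensity (m + 1)) (h, z) = ENNReal.ofReal c *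
        (ENNReal.ofReal (Real.exp (-(z ⬝ᵥ z) / 2)) * W (a ⬝ᵥ z)) := by
    intro z
    simp only [W]
    rw [← lintegral_const_mul' _ _ ENNReal.ofReal_ne_top,
      ← lintegral_const_mul' _ _ ENNReal.ofReal_ne_top, ← lintegral_indicator measurableSet_Ico]
    refine lintegral_congr fun h => ?_
    by_cases h1 : h < a ⬝ᵥ z
    · have hm : (h, z) ∈ {p : ℝ × (Fin (m + 1) → ℝ) | p.1 < a ⬝ᵥ p.2} := h1
      rw [Set.indicator_of_mem hm, halfGaussianDensity_eq]
      by_cases h0 : 0 ≤ h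
      · rw [Set.indicator_of_mem (Set.mem_Ici.2 h0), Set.indicator_of_mem (Set.mem_Ico.2 ⟨h0, h1⟩)]
        ring
      · rw [Set.indicator_of_notMem (fun h => h0 (Set.mem_Ici.1 h)),
          Set.indicator_of_notMem (fun h => h0 (Set.mem_Ico.1 h).1), zero_mul]
    · have hm : (h, z) ∉ {p : ℝ × (Fin (m + 1) → ℝ) | p.1 < a ⬝ᵥ p.2} := h1
      rw [Set.indicator_of_notMem hm, Set.indicator_of_notMem fun h => h1 (Set.mem_Ico.1 h).2]
  have hRne : R.transpose.det ≠ 0 := fun h => by rw [h] at hdet; simp at hdet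
  rw [halfGaussian, withDensity_apply _ hs, ← lintegral_indicator hs, Measure.volume_eq_prod,
    lintegral_prod_symm _ (hdens.indicator hs).aemeasurable, lintegral_congr hpt,
    lintegral_const_mul' _ _ ENNReal.ofReal_ne_top, lintegral_comp_mulVec _ hRne (by fun_prop),
    hdet, ENNReal.ofReal_one, one_mul]
  simp only [hRR, haR]
  have hF : Measurable fun w : Fin (m + 1) → ℝ => ENNReal.ofReal (Real.exp (-(w ⬝ᵥ w) / 2)) *
      W (√(a ⬝ᵥ a) * w 0) := by fun_prop
  have hsplit : ∀ t : ℝ, ∫⁻ w : Fin m → ℝ, ENNReal.ofReal (Real.exp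
      (-((Fin.cons t w : Fin (m + 1) → ℝ) ⬝ᵥ (Fin.cons t w : Fin (m + 1) → ℝ)) / 2)) *
      W (√(a ⬝ᵥ a) * (Fin.cons t w : Fin (m + 1) → ℝ) 0) = ENNReal.ofReal (√(2 * Real.pi) ^ m) *
      (ENNReal.ofReal (Real.exp (-t ^ 2 / 2)) * W (√(a ⬝ᵥ a) * t)) := by
    intro t
    have : ∀ w : Fin m → ℝ, ENNReal.ofReal (Real.exp
        (-((Fin.cons t w : Fin (m + 1) → ℝ) ⬝ᵥ (Fin.cons t w : Fin (m + 1) → ℝ)) / 2)) *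
        W (√(a ⬝ᵥ a) * (Fin.cons t w : Fin (m + 1) → ℝ) 0) =
        ENNReal.ofReal (Real.exp (-(w ⬝ᵥ w) / 2)) *
        (ENNReal.ofReal (Real.exp (-t ^ 2 / 2)) * W (√(a ⬝ᵥ a) * t)) := by
      intro w
      rw [Fin.cons_zero, ← mul_assoc, ← ENNReal.ofReal_mul (by positivity), ← Real.exp_add]
      congr 3
      simp only [dotProduct, Fin.sum_univ_succ, Fin.cons_zero, Fin.cons_succ]
      ring
    rw [lintegral_congr this, lintegral_mul_const _ (by fun_prop), lintegral_gaussian]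
  rw [volume_pi, lintegral_pi_cons volume hF, ← volume_pi, lintegral_congr hsplit,
    lintegral_const_mul' _ _ ENNReal.ofReal_ne_top, lintegral_wedge (Real.sqrt_nonneg _),
    ← ENNReal.ofReal_mul (by positivity), ← ENNReal.ofReal_mul hc0, hc]
  congr 1
  have h2 := Real.mul_self_sqrt (show 0 ≤ 2 * Real.pi by positivity)
  have hne : √(2 * Real.pi) ≠ 0 := by positivity
  rw [pow_succ, pow_succ, inv_pow]
  field_simp
  linear_combination -Real.arctan √(a ⬝ᵥ a) * h2

/-- The complementary event up to the hyperplane itself, which is null. -/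
theorem halfGaussian_above {m : ℕ} (a : Fin (m + 1) → ℝ) :
    halfGaussian (m + 1) {p | a ⬝ᵥ p.2 < p.1} =
      ENNReal.ofReal (1 - Real.arctan √(a ⬝ᵥ a) / Real.pi) := by
  have hs : MeasurableSet {p : ℝ × (Fin (m + 1) → ℝ) | p.1 < a ⬝ᵥ p.2} :=
    measurableSet_lt (by fun_prop) (by fun_prop)
  have hnull : halfGaussian (m + 1) {p | p.1 = a ⬝ᵥ p.2} = 0 := by
    refine halfGaussian_absolutelyContinuous _ ?_
    have hms : MeasurableSet {p : ℝ × (Fin (m + 1) → ℝ) | p.1 = a ⬝ᵥ p.2} :=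
      measurableSet_eq_fun (by fun_prop) (by fun_prop)
    rw [Measure.volume_eq_prod, Measure.prod_apply_symm hms]
    simp
  have hle : {p : ℝ × (Fin (m + 1) → ℝ) | a ⬝ᵥ p.2 < p.1} =ᵐ[halfGaussian (m + 1)]
      ({p | p.1 < a ⬝ᵥ p.2}ᶜ : Set _) := by
    have : ∀ᵐ p ∂halfGaussian (m + 1), ¬ p.1 = a ⬝ᵥ p.2 := by
      rw [ae_iff]; simpa using hnull
    filter_upwards [this] with p hp
    apply propext
    change a ⬝ᵥ p.2 < p.1 ↔ ¬ (p.1 < a ⬝ᵥ p.2)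
    rw [not_lt]
    exact ⟨le_of_lt, fun h => lt_of_le_of_ne h (Ne.symm hp)⟩
  rw [measure_congr hle, prob_compl_eq_one_sub hs, halfGaussian_below,
    ENNReal.ofReal_sub _ (by
      have := Real.arctan_nonneg.2 (Real.sqrt_nonneg (a ⬝ᵥ a))
      positivity), ENNReal.ofReal_one]

/-! ### Polar coordinates and the angle of the hyperplane -/

/-- Polar coordinates for the lower Lebesgue integral. -/
theorem lintegral_polar {E : Type*} [NormedAddCommGroup E] [NormedSpace ℝ E] [MeasurableSpace E]
    [BorelSpace E] [FiniteDimensional ℝ E] [Nontrivial E] (μ : Measure E) [μ.IsAddHaarMeasure]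
    {f : E → ℝ≥0∞} (hf : Measurable f) :
    ∫⁻ x, f x ∂μ = ∫⁻ θ : Metric.sphere (0 : E) 1, ∫⁻ r in Set.Ioi (0 : ℝ),
      ENNReal.ofReal (r ^ (Module.finrank ℝ E - 1)) * f (r • (θ : E))
        ∂(volume : Measure ℝ) ∂μ.toSphere := by
  have hmp := μ.measurePreserving_homeomorphUnitSphereProd
  have h1 : ∫⁻ x, f x ∂μ = ∫⁻ x : ({0}ᶜ : Set E), f x ∂(μ.comap (↑)) := by
    rw [lintegral_subtype_comap (measurableSet_singleton _).compl, setLIntegral_congr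
      (t := Set.univ), Measure.restrict_univ]
    exact Filter.eventuallyEq_set.2 ((Measure.ae_ne μ 0).mono fun x hx => by simpa using hx)
  have h2 : ∀ x : ({0}ᶜ : Set E), f x = (fun p : Metric.sphere (0 : E) 1 × Set.Ioi (0 : ℝ) =>
      f ((p.2 : ℝ) • (p.1 : E))) (homeomorphUnitSphereProd E x) := by
    intro x
    have := congrArg Subtype.val ((homeomorphUnitSphereProd E).symm_apply_apply x)
    exact congrArg f this.symm
  have hg : Measurable fun p : Metric.sphere (0 : E) 1 × Set.Ioi (0 : ℝ) =>
      f ((p.2 : ℝ) • (p.1 : E)) := hf.comp (by fun_prop)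
  rw [h1, lintegral_congr h2, hmp.lintegral_comp hg, lintegral_prod _ hg.aemeasurable]
  refine lintegral_congr fun θ => ?_
  have hgθ : Measurable fun r : Set.Ioi (0 : ℝ) => f ((r : ℝ) • (θ : E)) :=
    hf.comp (by fun_prop)
  rw [Measure.volumeIoiPow, lintegral_withDensity_eq_lintegral_mul _ (by fun_prop) hgθ]
  exact lintegral_subtype_comap measurableSet_Ioi (fun r : ℝ =>
    ENNReal.ofReal (r ^ (Module.finrank ℝ E - 1)) * f (r • (θ : E)))

theorem toSphere_univ_eq_omega {d : ℕ} (hd : 0 < d) :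
    (volume : Measure (EuclideanSpace ℝ (Fin d))).toSphere Set.univ = ENNReal.ofReal (omega d) := by
  have : Nonempty (Fin d) := ⟨⟨0, hd⟩⟩
  have hd0 : (0 : ℝ) < d := by exact_mod_cast hd
  have hG : 0 < Real.Gamma ((d : ℝ) / 2) := Real.Gamma_pos_of_pos (by positivity)
  rw [Measure.toSphere_apply_univ, EuclideanSpace.volume_ball]
  simp only [finrank_euclideanSpace, Fintype.card_fin, ENNReal.ofReal_one, one_pow, one_mul]
  rw [← ENNReal.ofReal_natCast, ← ENNReal.ofReal_mul (by positivity), omega]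
  congr 1
  rw [Real.Gamma_add_one (by positivity), Real.sqrt_eq_rpow, ← Real.rpow_natCast,
    ← Real.rpow_mul Real.pi_pos.le]
  rw [show (1 / 2 : ℝ) * d = d / 2 by ring]
  field_simp

theorem omega_pos {d : ℕ} (hd : 0 < d) : 0 < omega d := by
  have hd0 : (0 : ℝ) < d := by exact_mod_cast hd
  have hG : 0 < Real.Gamma ((d : ℝ) / 2) := Real.Gamma_pos_of_pos (by positivity)
  rw [omega]
  have := Real.pi_pos
  positivity

/-- Integration of a function of the slope against the density of slopes. -/
theorem lintegral_slope_density {m : ℕ} {Ψ : ℝ → ℝ≥0∞} (hΨ : Measurable Ψ) :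
    ∫⁻ a : Fin (m + 1) → ℝ, ENNReal.ofReal ((√(1 + a ⬝ᵥ a))⁻¹ ^ (m + 2)) *
      Ψ (Real.arctan √(a ⬝ᵥ a)) =
    ENNReal.ofReal (omega (m + 1)) * ∫⁻ x in Set.Ioo 0 (Real.pi / 2),
      ENNReal.ofReal (Real.sin x ^ m) * Ψ x := by
  have hmp := (EuclideanSpace.volume_preserving_symm_measurableEquiv_toLp (Fin (m + 1)))
  have hF : Measurable fun a : Fin (m + 1) → ℝ => ENNReal.ofReal ((√(1 + a ⬝ᵥ a))⁻¹ ^ (m + 2)) *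
      Ψ (Real.arctan √(a ⬝ᵥ a)) := by fun_prop
  rw [← hmp.lintegral_comp hF]
  have hnorm : ∀ x : EuclideanSpace ℝ (Fin (m + 1)),
      ((MeasurableEquiv.toLp 2 (Fin (m + 1) → ℝ)).symm x) ⬝ᵥ
      ((MeasurableEquiv.toLp 2 (Fin (m + 1) → ℝ)).symm x) = ‖x‖ ^ 2 := by
    intro x
    rw [EuclideanSpace.real_norm_sq_eq]
    simp [dotProduct, sq]
  simp only [hnorm, Real.sqrt_sq (norm_nonneg _)]
  rw [lintegral_polar volume (by fun_prop)]
  have hsph : ∀ θ : Metric.sphere (0 : EuclideanSpace ℝ (Fin (m + 1))) 1,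
      ∫⁻ r in Set.Ioi (0 : ℝ), ENNReal.ofReal
        (r ^ (Module.finrank ℝ (EuclideanSpace ℝ (Fin (m + 1))) - 1)) *
        (ENNReal.ofReal ((√(1 + ‖r • (θ : EuclideanSpace ℝ (Fin (m + 1)))‖ ^ 2))⁻¹ ^ (m + 2)) *
        Ψ (Real.arctan ‖r • (θ : EuclideanSpace ℝ (Fin (m + 1)))‖)) =
      ∫⁻ r in Set.Ioi (0 : ℝ), ENNReal.ofReal (r ^ m) *
        (ENNReal.ofReal ((√(1 + r ^ 2))⁻¹ ^ (m + 2)) * Ψ (Real.arctan r)) := by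
    intro θ
    refine setLIntegral_congr_fun measurableSet_Ioi fun r hr => ?_
    have hr0 : 0 < r := hr
    have hθ : ‖(θ : EuclideanSpace ℝ (Fin (m + 1)))‖ = 1 := by simp
    simp [norm_smul, hθ, abs_of_pos hr0]
  rw [lintegral_congr hsph, lintegral_const, toSphere_univ_eq_omega m.succ_pos, mul_comm]
  congr 1
  -- In r = tan x the integrand is tan^m x · cos^(m+2) x with Jacobian cos^(-2) x, which is sin^m x.
  have himg : Real.tan '' Set.Ioo 0 (Real.pi / 2) = Set.Ioi 0 := by
    ext y
    constructor
    · rintro ⟨x, hx, rfl⟩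
      exact Real.tan_pos_of_pos_of_lt_pi_div_two hx.1 hx.2
    · intro hy
      exact ⟨Real.arctan y, ⟨Real.arctan_pos.2 hy, Real.arctan_lt_pi_div_two y⟩,
        Real.tan_arctan y⟩
  have hcos : ∀ x ∈ Set.Ioo 0 (Real.pi / 2), 0 < Real.cos x := fun x hx =>
    Real.cos_pos_of_mem_Ioo ⟨by linarith [hx.1, Real.pi_pos], hx.2⟩
  have hsub : Set.Ioo 0 (Real.pi / 2) ⊆ Set.Ioo (-(Real.pi / 2)) (Real.pi / 2) := fun x hx =>
    ⟨by linarith [hx.1, Real.pi_pos], hx.2⟩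
  rw [← himg, lintegral_image_eq_lintegral_abs_deriv_mul measurableSet_Ioo
    (fun x hx => (Real.hasDerivAt_tan (hcos x hx).ne').hasDerivWithinAt)
    (Real.injOn_tan.mono hsub)]
  refine setLIntegral_congr_fun measurableSet_Ioo fun x hx => ?_
  have hc := hcos x hx
  have hs : 0 < Real.sin x := Real.sin_pos_of_pos_of_lt_pi hx.1 (by linarith [hx.2, Real.pi_pos])
  rw [Real.arctan_tan (hsub hx).1 hx.2, Real.inv_sqrt_one_add_tan_sq hc, Real.tan_eq_sin_div_cos,
    abs_of_pos (by positivity),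
    ← mul_assoc, ← mul_assoc, ← ENNReal.ofReal_mul (by positivity),
    ← ENNReal.ofReal_mul (by positivity)]
  congr 2
  rw [div_pow, pow_add]
  field_simp

/-- The reflection x ↦ π - x fixes the sine and exchanges 1 - x/π with x/π. The two sides over a
quarter turn are thus one side over a half turn. -/
theorem integral_slope_sum (m k : ℕ) :
    ∫⁻ x in Set.Ioo 0 (Real.pi / 2), ENNReal.ofReal (Real.sin x ^ m) *
      (ENNReal.ofReal (1 - x / Real.pi) ^ k + ENNReal.ofReal (x / Real.pi) ^ k) =
    ENNReal.ofReal (∫ x in (0 : ℝ)..Real.pi, (1 - x / Real.pi) ^ k * Real.sin x ^ m) := by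
  have hpi := Real.pi_pos
  set f : ℝ → ℝ := fun x => (1 - x / Real.pi) ^ k * Real.sin x ^ m with hf
  have hfc : Continuous f := by fun_prop
  have hfc2 : Continuous fun x => f (Real.pi - x) := by fun_prop
  have hsplit : ∫ x in (0 : ℝ)..Real.pi, f x =
      ∫ x in (0 : ℝ)..(Real.pi / 2), (f x + f (Real.pi - x)) := by
    rw [intervalIntegral.integral_add (hfc.intervalIntegrable _ _)
      (hfc2.intervalIntegrable _ _),
      intervalIntegral.integral_comp_sub_left f Real.pi, sub_zero,
      show Real.pi - Real.pi / 2 = Real.pi / 2 by ring,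
      intervalIntegral.integral_add_adjacent_intervals (hfc.intervalIntegrable _ _)
      (hfc.intervalIntegrable _ _)]
  have hgc : Continuous fun x => f x + f (Real.pi - x) := by fun_prop
  rw [hsplit, intervalIntegral.integral_of_le (by positivity),
    ofReal_integral_eq_lintegral_ofReal (hgc.integrableOn_Ioc)
      ((ae_restrict_iff' measurableSet_Ioc).2 (Filter.Eventually.of_forall fun x hx => ?_)),
    setLIntegral_congr Ioo_ae_eq_Ioc]
  · refine setLIntegral_congr_fun measurableSet_Ioc fun x hx => ?_
    have hs : 0 ≤ Real.sin x :=
      Real.sin_nonneg_of_nonneg_of_le_pi hx.1.le (by linarith [hx.2])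
    have h1 : 0 ≤ x / Real.pi := div_nonneg hx.1.le hpi.le
    have h2 : 0 ≤ 1 - x / Real.pi := by
      rw [sub_nonneg, div_le_one hpi]
      linarith [hx.2]
    rw [← ENNReal.ofReal_pow h2, ← ENNReal.ofReal_pow h1, ← ENNReal.ofReal_add (by positivity)
      (by positivity), ← ENNReal.ofReal_mul (by positivity)]
    congr 1
    simp only [hf, Real.sin_pi_sub]
    rw [show 1 - (Real.pi - x) / Real.pi = x / Real.pi by field_simp; ring]
    ring
  · have hs : 0 ≤ Real.sin x :=
      Real.sin_nonneg_of_nonneg_of_le_pi hx.1.le (by linarith [hx.2])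
    have h2 : 0 ≤ 1 - x / Real.pi := by
      rw [sub_nonneg, div_le_one hpi]
      linarith [hx.2]
    have h3 : 0 ≤ 1 - (Real.pi - x) / Real.pi := by
      rw [sub_nonneg, div_le_one hpi]
      linarith [hx.1]
    simp only [hf, Real.sin_pi_sub, Pi.zero_apply]
    positivity

/-! ### The mean contribution of an index set -/

/-- The points outside `I` lie strictly on one side of the hyperplane through the points of `I`. -/
def OneSided {d n : ℕ} (I : Finset (Fin n)) (hI : I.card = d)
    (p : Fin n → ℝ × (Fin d → ℝ)) : Prop :=
  (∀ j ∉ I, slope (p ∘ I.orderEmbOfFin hI) ⬝ᵥ (p j).2 < (p j).1) ∨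
    ∀ j ∉ I, (p j).1 < slope (p ∘ I.orderEmbOfFin hI) ⬝ᵥ (p j).2

/-- The contribution of the index set `I` to the Gaussian surface content of the cone spanned by
`n` points. -/
noncomputable def facetTerm {d n : ℕ} (I : Finset (Fin n)) (hI : I.card = d)
    (p : Fin n → ℝ × (Fin d → ℝ)) : ℝ≥0∞ :=
  {p | OneSided I hI p}.indicator (fun p => coneGaussian (p ∘ I.orderEmbOfFin hI)) p

theorem measurableSet_oneSided {d n : ℕ} (I : Finset (Fin n)) (hI : I.card = d) :
    MeasurableSet {p : Fin n → ℝ × (Fin d → ℝ) | OneSided I hI p} := by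
  have hsl : Measurable fun p : Fin n → ℝ × (Fin d → ℝ) => slope (p ∘ I.orderEmbOfFin hI) :=
    measurable_slope.comp (measurable_pi_iff.2 fun _ => measurable_pi_apply _)
  have h1 : {p : Fin n → ℝ × (Fin d → ℝ) | OneSided I hI p} =
      (⋂ j, ⋂ (_ : j ∉ I), {p | slope (p ∘ I.orderEmbOfFin hI) ⬝ᵥ (p j).2 < (p j).1}) ∪
      ⋂ j, ⋂ (_ : j ∉ I), {p | (p j).1 < slope (p ∘ I.orderEmbOfFin hI) ⬝ᵥ (p j).2} := by
    ext p
    simp [OneSided]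
  rw [h1]
  refine MeasurableSet.union ?_ ?_ <;>
  · refine MeasurableSet.iInter fun j => MeasurableSet.iInter fun _ => ?_
    exact measurableSet_lt (by fun_prop) (by fun_prop)

theorem measurable_facetTerm {d n : ℕ} (I : Finset (Fin n)) (hI : I.card = d) :
    Measurable (facetTerm I hI) :=
  (measurable_coneGaussian.comp
    (measurable_pi_iff.2 fun _ => measurable_pi_apply _)).indicator (measurableSet_oneSided I hI)

theorem lintegral_pi_halfGaussian {m : ℕ} {Φ : (Fin (m + 1) → ℝ) → ℝ≥0∞} (hΦ : Measurable Φ) :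
    ∫⁻ p : Fin (m + 1) → ℝ × (Fin (m + 1) → ℝ), coneGaussian p * Φ (slope p)
      ∂(Measure.pi fun _ => halfGaussian (m + 1)) =
    ∫⁻ a, ENNReal.ofReal (facetConst m * (√(1 + a ⬝ᵥ a))⁻¹ ^ (m + 2)) * Φ a := by
  have hdens := measurable_halfGaussianDensity (m + 1)
  have hslope := measurable_slope (d := m + 1)
  have hcone := measurable_coneGaussian (d := m + 1)
  have : SigmaFinite (volume.withDensity (halfGaussianDensity (m + 1))) :=
    inferInstanceAs (SigmaFinite (halfGaussian (m + 1)))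
  have h := pi_withDensity (k := m + 1) (volume : Measure (ℝ × (Fin (m + 1) → ℝ))) hdens
  rw [← lintegral_halfGaussian_coneGaussian hΦ]
  unfold halfGaussian
  rw [h, lintegral_withDensity_eq_lintegral_mul _ (by fun_prop) (by fun_prop)]
  rfl

/-- Each alternative is a product event. They exclude each other because there is at least one
point; for an empty family both would hold. -/
theorem halfGaussian_pi_sides {m : ℕ} {ι : Type*} [Fintype ι] [Nonempty ι] (a : Fin (m + 1) → ℝ) :
    (Measure.pi fun _ : ι => halfGaussian (m + 1))
      {w | (∀ j, a ⬝ᵥ (w j).2 < (w j).1) ∨ ∀ j, (w j).1 < a ⬝ᵥ (w j).2} =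
    ENNReal.ofReal (1 - Real.arctan √(a ⬝ᵥ a) / Real.pi) ^ Fintype.card ι +
      ENNReal.ofReal (Real.arctan √(a ⬝ᵥ a) / Real.pi) ^ Fintype.card ι := by
  have hms : MeasurableSet {p : ℝ × (Fin (m + 1) → ℝ) | p.1 < a ⬝ᵥ p.2} :=
    measurableSet_lt (by fun_prop) (by fun_prop)
  have hset : {w : ι → ℝ × (Fin (m + 1) → ℝ) | (∀ j, a ⬝ᵥ (w j).2 < (w j).1) ∨
      ∀ j, (w j).1 < a ⬝ᵥ (w j).2} = (Set.univ.pi fun _ => {p | a ⬝ᵥ p.2 < p.1}) ∪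
      Set.univ.pi fun _ => {p | p.1 < a ⬝ᵥ p.2} := by
    ext w
    simp
  have hdisj : Disjoint (Set.univ.pi fun _ : ι => {p : ℝ × (Fin (m + 1) → ℝ) | a ⬝ᵥ p.2 < p.1})
      (Set.univ.pi fun _ : ι => {p | p.1 < a ⬝ᵥ p.2}) := by
    rw [Set.disjoint_left]
    intro w h1 h2
    obtain ⟨j⟩ := ‹Nonempty ι›
    have h1' : a ⬝ᵥ (w j).2 < (w j).1 := h1 j trivial
    have h2' : (w j).1 < a ⬝ᵥ (w j).2 := h2 j trivial
    exact lt_asymm h1' h2'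
  rw [hset, measure_union hdisj (MeasurableSet.univ_pi fun _ => hms), Measure.pi_pi,
    Measure.pi_pi]
  simp only [halfGaussian_above, halfGaussian_below, Finset.prod_const, Finset.card_univ]

theorem facetConst_nonneg (m : ℕ) : 0 ≤ facetConst m := by
  have : 0 < Real.Gamma (((m + 1 : ℕ) + 1 : ℝ) / 2) := Real.Gamma_pos_of_pos (by positivity)
  rw [facetConst, simplexConst]
  positivity

/-- The mean contribution of an index set to the surface content. -/
theorem lintegral_facetTerm {m n : ℕ} (hn : m + 1 < n) (I : Finset (Fin n))
    (hI : I.card = m + 1) :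
    ∫⁻ p, facetTerm I hI p ∂(Measure.pi fun _ : Fin n => halfGaussian (m + 1)) =
      ENNReal.ofReal (facetConst m * omega (m + 1) *
        ∫ x in (0 : ℝ)..Real.pi, (1 - x / Real.pi) ^ (n - (m + 1)) * Real.sin x ^ m) := by
  set ν := halfGaussian (m + 1) with hν
  set k := n - (m + 1) with hk
  let Θ : ℝ → ℝ≥0∞ := fun x =>
    ENNReal.ofReal (1 - x / Real.pi) ^ k + ENNReal.ofReal (x / Real.pi) ^ k
  have hΘ : Measurable Θ := by fun_prop
  let Φ : (Fin (m + 1) → ℝ) → ℝ≥0∞ := fun a => Θ (Real.arctan √(a ⬝ᵥ a))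
  have hΦ : Measurable Φ := by fun_prop
  have hcardc : Fintype.card {i // i ∉ I} = k := by
    rw [Fintype.card_subtype_compl, Fintype.card_fin, Fintype.card_coe, hI]
  have hne : Nonempty {i // i ∉ I} := by
    rw [← Fintype.card_pos_iff, hcardc]
    omega
  -- The points of I fix the hyperplane and the cone. The remaining points are independent of them,
  -- so Fubini evaluates the side probability at a fixed slope.
  have hmp := measurePreserving_piEquivPiSubtypeProd (fun _ : Fin n => ν) (fun i => i ∈ I)
  have hT := measurable_facetTerm I hI
  let f : Fin (m + 1) ≃ {i // i ∈ I} := (I.orderIsoOfFin hI).toEquiv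
  have hcone := measurable_coneGaussian (d := m + 1)
  have hslope := measurable_slope (d := m + 1)
  have hcomp : Measurable fun u : {i // i ∈ I} → ℝ × (Fin (m + 1) → ℝ) => u ∘ f :=
    measurable_pi_iff.2 fun _ => measurable_pi_apply _
  have hinner : ∀ u : {i // i ∈ I} → ℝ × (Fin (m + 1) → ℝ),
      ∫⁻ w : {i // i ∉ I} → ℝ × (Fin (m + 1) → ℝ), facetTerm I hI
        ((MeasurableEquiv.piEquivPiSubtypeProd (fun _ => ℝ × (Fin (m + 1) → ℝ))
          fun i => i ∈ I).symm (u, w)) ∂(Measure.pi fun _ => ν) =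
      coneGaussian (u ∘ f) * Φ (slope (u ∘ f)) := by
    intro u
    have hres : ∀ w, ((MeasurableEquiv.piEquivPiSubtypeProd (fun _ => ℝ × (Fin (m + 1) → ℝ))
          fun i => i ∈ I).symm (u, w)) ∘ I.orderEmbOfFin hI = u ∘ f := by
      intro w
      funext i
      have hmem : I.orderEmbOfFin hI i ∈ I := Finset.orderEmbOfFin_mem _ _ _
      change (if h : I.orderEmbOfFin hI i ∈ I then u ⟨_, h⟩ else w ⟨_, h⟩) = _
      rw [dif_pos hmem]
      rfl
    have hout : ∀ w, ∀ j : {i // i ∉ I}, ((MeasurableEquiv.piEquivPiSubtypeProd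
        (fun _ => ℝ × (Fin (m + 1) → ℝ)) fun i => i ∈ I).symm (u, w)) j = w j := by
      intro w j
      change (if h : (j : Fin n) ∈ I then u ⟨_, h⟩ else w ⟨_, h⟩) = _
      rw [dif_neg j.2]
    have hpt : ∀ w, facetTerm I hI ((MeasurableEquiv.piEquivPiSubtypeProd
        (fun _ => ℝ × (Fin (m + 1) → ℝ)) fun i => i ∈ I).symm (u, w)) =
        {w : {i // i ∉ I} → ℝ × (Fin (m + 1) → ℝ) |
          (∀ j, slope (u ∘ f) ⬝ᵥ (w j).2 < (w j).1) ∨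
          ∀ j, (w j).1 < slope (u ∘ f) ⬝ᵥ (w j).2}.indicator
          (fun _ => coneGaussian (u ∘ f)) w := by
      intro w
      have hiff : OneSided I hI ((MeasurableEquiv.piEquivPiSubtypeProd
          (fun _ => ℝ × (Fin (m + 1) → ℝ)) fun i => i ∈ I).symm (u, w)) ↔
          (∀ j, slope (u ∘ f) ⬝ᵥ (w j).2 < (w j).1) ∨
          ∀ j, (w j).1 < slope (u ∘ f) ⬝ᵥ (w j).2 := by
        rw [OneSided, hres]
        refine or_congr ?_ ?_
        · constructor
          · intro h j; have := h j j.2; rwa [hout] at this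
          · intro h j hj; have := h ⟨j, hj⟩; rw [← hout w ⟨j, hj⟩] at this; exact this
        · constructor
          · intro h j; have := h j j.2; rwa [hout] at this
          · intro h j hj; have := h ⟨j, hj⟩; rw [← hout w ⟨j, hj⟩] at this; exact this
      rw [facetTerm]
      simp only [Set.indicator, Set.mem_ofPred_eq, hiff, hres]
    have hms : MeasurableSet {w : {i // i ∉ I} → ℝ × (Fin (m + 1) → ℝ) |
          (∀ j, slope (u ∘ f) ⬝ᵥ (w j).2 < (w j).1) ∨
          ∀ j, (w j).1 < slope (u ∘ f) ⬝ᵥ (w j).2} := by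
      have h1 : {w : {i // i ∉ I} → ℝ × (Fin (m + 1) → ℝ) |
          (∀ j, slope (u ∘ f) ⬝ᵥ (w j).2 < (w j).1) ∨
          ∀ j, (w j).1 < slope (u ∘ f) ⬝ᵥ (w j).2} =
          (⋂ j, {w | slope (u ∘ f) ⬝ᵥ (w j).2 < (w j).1}) ∪
          ⋂ j, {w | (w j).1 < slope (u ∘ f) ⬝ᵥ (w j).2} := by ext; simp
      rw [h1]
      refine MeasurableSet.union ?_ ?_ <;>
      exact MeasurableSet.iInter fun j => measurableSet_lt (by fun_prop) (by fun_prop)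
    rw [lintegral_congr hpt, lintegral_indicator_const hms, hν, halfGaussian_pi_sides, hcardc]
  have hG : Measurable fun u : {i // i ∈ I} → ℝ × (Fin (m + 1) → ℝ) =>
      coneGaussian (u ∘ f) * Φ (slope (u ∘ f)) := by fun_prop
  have hmp2 := measurePreserving_piCongrLeft (fun _ : {i // i ∈ I} => ν) f
  have hcancel : ∀ x : Fin (m + 1) → ℝ × (Fin (m + 1) → ℝ),
      (MeasurableEquiv.piCongrLeft (fun _ : {i // i ∈ I} => ℝ × (Fin (m + 1) → ℝ)) f x) ∘ f =
        x := by
    intro x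
    funext i
    exact Equiv.piCongrLeft_apply_apply (fun _ => ℝ × (Fin (m + 1) → ℝ)) f x i
  have h0 := lintegral_prod (μ := Measure.pi fun _ : {i // i ∈ I} => ν)
    (ν := Measure.pi fun _ : {i // i ∉ I} => ν) _ (hT.comp hmp.symm.measurable).aemeasurable
  rw [← hmp.symm.lintegral_comp hT]
  refine Eq.trans ?_ (h0.trans ?_)
  · have : Subtype.fintype (fun i => i ∈ I) = Finset.Subtype.fintype I := Subsingleton.elim _ _
    rw [this]
    rfl
  refine (lintegral_congr hinner).trans ?_
  rw [← hmp2.lintegral_comp hG]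
  simp only [hcancel]
  rw [hν, lintegral_pi_halfGaussian hΦ]
  have hfc := facetConst_nonneg m
  simp only [ENNReal.ofReal_mul hfc, mul_assoc]
  rw [lintegral_const_mul' _ _ ENNReal.ofReal_ne_top, lintegral_slope_density hΘ,
    integral_slope_sum, ← ENNReal.ofReal_mul (omega_pos m.succ_pos).le]

/-! ### Facets of cones generated by vectors in general position -/

theorem mem_hull_range {E ι : Type*} [AddCommGroup E] [Module ℝ E] [Fintype ι] {v : ι → E}
    {x : E} : x ∈ PointedCone.hull ℝ (Set.range v) ↔
      ∃ c : ι → ℝ, (∀ i, 0 ≤ c i) ∧ ∑ i, c i • v i = x := by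
  rw [PointedCone.hull, Submodule.mem_span_range_iff_exists_fun]
  constructor
  · rintro ⟨c, rfl⟩
    exact ⟨fun i => c i, fun i => (c i).2, rfl⟩
  · rintro ⟨c, hc, rfl⟩
    exact ⟨fun i => ⟨c i, hc i⟩, rfl⟩

theorem smul_mem_hull {E : Type*} [AddCommGroup E] [Module ℝ E] {s : Set E} {r : ℝ} (hr : 0 ≤ r)
    {x : E} (hx : x ∈ PointedCone.hull ℝ s) : r • x ∈ PointedCone.hull ℝ s :=
  Submodule.smul_mem _ (⟨r, hr⟩ : {c : ℝ // 0 ≤ c}) hx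

theorem hull_range_smul {E ι : Type*} [AddCommGroup E] [Module ℝ E] {v : ι → E}
    {r : ι → ℝ} (hr : ∀ i, 0 < r i) :
    PointedCone.hull ℝ (Set.range fun i => r i • v i) = PointedCone.hull ℝ (Set.range v) := by
  apply le_antisymm
  · refine Submodule.span_le.2 ?_
    rintro _ ⟨i, rfl⟩
    exact smul_mem_hull (hr i).le (Submodule.subset_span ⟨i, rfl⟩)
  · refine Submodule.span_le.2 ?_
    rintro _ ⟨i, rfl⟩
    have := smul_mem_hull (inv_pos.2 (hr i)).le (Submodule.subset_span ⟨i, rfl⟩ :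
      r i • v i ∈ PointedCone.hull ℝ (Set.range fun i => r i • v i))
    rwa [inv_smul_smul₀ (hr i).ne'] at this

section Facets

variable {d n : ℕ} {v : Fin n → Ambient d}

/-- The hyperplane through the vectors with index in `I` strictly supports all the others. -/
def Supports (v : Fin n → Ambient d) (I : Finset (Fin n)) : Prop :=
  ∃ u : Ambient d, (∀ i ∈ I, inner ℝ u (v i) = 0) ∧ ∀ j ∉ I, inner ℝ u (v j) < 0

/-- Any `d + 1` of the vectors are linearly independent. -/
def GeneralPosition (v : Fin n → Ambient d) : Prop :=
  ∀ J : Finset (Fin n), J.card ≤ d + 1 → LinearIndepOn ℝ v (J : Set (Fin n))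

theorem inner_nonpos_of_mem_hull {u : Ambient d} {s : Set (Ambient d)}
    (h : ∀ y ∈ s, inner ℝ u y ≤ 0) {x : Ambient d} (hx : x ∈ PointedCone.hull ℝ s) :
    inner ℝ u x ≤ 0 := by
  induction hx using Submodule.span_induction with
  | mem y hy => exact h y hy
  | zero => simp
  | add y z _ _ hy hz => rw [inner_add_right]; linarith
  | smul c y _ hy =>
    change inner ℝ u ((c : ℝ) • y) ≤ 0
    rw [real_inner_smul_right]
    exact mul_nonpos_of_nonneg_of_nonpos c.2 hy

/-- The face of a cone cut out by a supporting hyperplane is spanned by the generators it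
contains. -/
theorem mem_hull_image_iff {u : Ambient d} {I : Finset (Fin n)}
    (hI : ∀ i ∈ I, inner ℝ u (v i) = 0) (hJ : ∀ j ∉ I, inner ℝ u (v j) < 0) {x : Ambient d} :
    x ∈ PointedCone.hull ℝ (v '' I) ↔
      x ∈ PointedCone.hull ℝ (Set.range v) ∧ inner ℝ u x = 0 := by
  constructor
  · intro hx
    refine ⟨Submodule.span_mono (Set.image_subset_range _ _) hx, le_antisymm ?_ ?_⟩
    · refine inner_nonpos_of_mem_hull ?_ hx
      rintro _ ⟨i, hi, rfl⟩
      exact (hI i hi).le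
    · have : inner ℝ (-u) x ≤ 0 := by
        refine inner_nonpos_of_mem_hull ?_ hx
        rintro _ ⟨i, hi, rfl⟩
        rw [inner_neg_left, hI i hi, neg_zero]
      rw [inner_neg_left] at this
      linarith
  · rintro ⟨hx, h0⟩
    obtain ⟨c, hc, rfl⟩ := mem_hull_range.1 hx
    rw [inner_sum] at h0
    have hle : ∀ i ∈ Finset.univ, inner ℝ u (c i • v i) ≤ 0 := by
      intro i _
      rw [real_inner_smul_right]
      refine mul_nonpos_of_nonneg_of_nonpos (hc i) ?_
      by_cases hi : i ∈ I
      · exact (hI i hi).le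
      · exact (hJ i hi).le
    have h1 := (Finset.sum_eq_zero_iff_of_nonpos hle).1 h0
    refine Submodule.sum_mem _ fun i _ => ?_
    by_cases hi : i ∈ I
    · exact smul_mem_hull (hc i) (Submodule.subset_span ⟨i, hi, rfl⟩)
    · have h2 := h1 i (Finset.mem_univ i)
      rw [real_inner_smul_right] at h2
      rcases mul_eq_zero.1 h2 with h3 | h3
      · rw [h3, zero_smul]; exact Submodule.zero_mem _
      · exact absurd h3 (hJ i hi).ne

theorem inv_norm_smul_mem_sphericalHull {s : Set (Ambient d)} {x : Ambient d} (hx : x ∈ s)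
    (h0 : x ≠ 0) : ‖x‖⁻¹ • x ∈ sphericalHull s := by
  refine ⟨?_, smul_mem_hull (by positivity) (Submodule.subset_span hx)⟩
  rw [mem_sphere_zero_iff_norm, norm_smul, norm_inv, norm_norm,
    inv_mul_cancel₀ (norm_ne_zero_iff.2 h0)]

theorem span_sphericalHull {s : Set (Ambient d)} (hs : (0 : Ambient d) ∉ s) :
    Submodule.span ℝ (sphericalHull s) = Submodule.span ℝ s := by
  apply le_antisymm
  · exact Submodule.span_le.2 fun x hx => PointedCone.hull_le_span (R := ℝ) s hx.2
  · refine Submodule.span_le.2 fun x hx => ?_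
    have h0 : x ≠ 0 := fun h => hs (h ▸ hx)
    have h1 : ‖x‖⁻¹ • x ∈ Submodule.span ℝ (sphericalHull s) :=
      Submodule.subset_span (inv_norm_smul_mem_sphericalHull hx h0)
    have := Submodule.smul_mem _ ‖x‖ h1
    rwa [smul_inv_smul₀ (norm_ne_zero_iff.2 h0)] at this

theorem GeneralPosition.ne_zero (hv : GeneralPosition v) (i : Fin n) : v i ≠ 0 :=
  (hv {i} (by simp)).ne_zero (by simp)

theorem GeneralPosition.finrank_span (hv : GeneralPosition v) {J : Finset (Fin n)}
    (hJ : J.card ≤ d + 1) : Module.finrank ℝ (Submodule.span ℝ (v '' J)) = J.card := by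
  have h := hv J hJ
  rw [Set.image_eq_range]
  have := finrank_span_eq_card h
  simpa using this

theorem GeneralPosition.zero_notMem (hv : GeneralPosition v) (s : Set (Fin n)) :
    (0 : Ambient d) ∉ v '' s := by
  rintro ⟨i, -, hi⟩
  exact hv.ne_zero i hi

theorem setOf_inner_eq_zero {u : Ambient d} {I : Finset (Fin n)}
    (hI : ∀ i ∈ I, inner ℝ u (v i) = 0) (hJ : ∀ j ∉ I, inner ℝ u (v j) < 0) :
    {x ∈ sphericalHull (Set.range v) | inner ℝ u x = 0} = sphericalHull (v '' I) := by
  ext x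
  have := mem_hull_image_iff hI hJ (x := x)
  constructor
  · rintro ⟨⟨h1, h2⟩, h3⟩
    exact ⟨h1, this.2 ⟨h2, h3⟩⟩
  · rintro ⟨h1, h2⟩
    exact ⟨⟨h1, (this.1 h2).1⟩, (this.1 h2).2⟩

theorem GeneralPosition.isFacet (hv : GeneralPosition v) {I : Finset (Fin n)} (hI : I.card = d)
    (hs : Supports v I) : IsFacet (sphericalHull (Set.range v)) (sphericalHull (v '' I)) := by
  obtain ⟨u, h1, h2⟩ := hs
  refine ⟨⟨u, fun x hx => inner_nonpos_of_mem_hull ?_ hx.2, (setOf_inner_eq_zero h1 h2).symm⟩, ?_⟩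
  · rintro _ ⟨i, rfl⟩
    by_cases hi : i ∈ I
    · exact (h1 i hi).le
    · exact (h2 i hi).le
  · rw [span_sphericalHull (hv.zero_notMem _), hv.finrank_span (by omega), hI]

/-- I collects the generators on the supporting hyperplane, and they span the face. Up to d + 1
generators are independent, so the dimension of the face equals |I|; a larger I would already force
dimension d + 1. -/
theorem GeneralPosition.exists_of_isFacet (hv : GeneralPosition v)
    {F : Set (Ambient d)} (hF : IsFacet (sphericalHull (Set.range v)) F) :
    ∃ I : Finset (Fin n), I.card = d ∧ Supports v I ∧ sphericalHull (v '' I) = F := by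
  obtain ⟨⟨u, hu, rfl⟩, hdim⟩ := hF
  have hle : ∀ i, inner ℝ u (v i) ≤ 0 := by
    intro i
    have := hu _ (inv_norm_smul_mem_sphericalHull ⟨i, rfl⟩ (hv.ne_zero i))
    rw [real_inner_smul_right] at this
    have hpos : 0 < ‖v i‖⁻¹ := inv_pos.2 (norm_pos_iff.2 (hv.ne_zero i))
    exact nonpos_of_mul_nonpos_right this hpos
  let I : Finset (Fin n) := Finset.univ.filter fun i => inner ℝ u (v i) = 0
  have h1 : ∀ i ∈ I, inner ℝ u (v i) = 0 := fun i hi => (Finset.mem_filter.1 hi).2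
  have h2 : ∀ j ∉ I, inner ℝ u (v j) < 0 := fun j hj =>
    lt_of_le_of_ne (hle j) fun h => hj (Finset.mem_filter.2 ⟨Finset.mem_univ j, h⟩)
  have hset := setOf_inner_eq_zero h1 h2
  rw [hset, span_sphericalHull (hv.zero_notMem _)] at hdim
  refine ⟨I, ?_, ⟨u, h1, h2⟩, hset.symm⟩
  by_cases hc : I.card ≤ d + 1
  · rw [← hdim, hv.finrank_span hc]
  · obtain ⟨J, hJI, hJ⟩ := Finset.exists_subset_card_eq (show d + 1 ≤ I.card by omega)
    have := hv.finrank_span hJ.le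
    have hmono : Module.finrank ℝ (Submodule.span ℝ (v '' J)) ≤
        Module.finrank ℝ (Submodule.span ℝ (v '' I)) :=
      Submodule.finrank_mono (Submodule.span_mono (Set.image_mono (by exact_mod_cast hJI)))
    omega

/-- The normal supporting I is strictly negative on every generator outside I, so the direction of
such a generator cannot lie in the face. This makes I ↦ face injective. -/
theorem GeneralPosition.subset_of_sphericalHull_eq (hv : GeneralPosition v) {I J : Finset (Fin n)}
    (hI : Supports v I) (h : sphericalHull (v '' I) = sphericalHull (v '' J)) : J ⊆ I := by
  obtain ⟨u, h1, h2⟩ := hI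
  intro i hi
  by_contra hc
  have hm := inv_norm_smul_mem_sphericalHull (s := v '' J) ⟨i, hi, rfl⟩ (hv.ne_zero i)
  rw [← h, ← setOf_inner_eq_zero h1 h2] at hm
  have := hm.2
  rw [real_inner_smul_right] at this
  rcases mul_eq_zero.1 this with h3 | h3
  · exact hv.ne_zero i (norm_eq_zero.1 (inv_eq_zero.1 h3))
  · exact (h2 i hc).ne h3

open Classical in
/-- The surface area of the spherical hull of vectors in general position. -/
theorem GeneralPosition.surfaceArea_eq (hv : GeneralPosition v) :
    surfaceArea (sphericalHull (Set.range v)) =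
      ∑ I ∈ Finset.powersetCard d Finset.univ, if Supports v I then
        greatSubsphereMeasure (Submodule.span ℝ (v '' I)) (sphericalHull (v '' I)) else 0 := by
  let φ : {I : Finset (Fin n) // I.card = d ∧ Supports v I} →
      {F : Set (Ambient d) // IsFacet (sphericalHull (Set.range v)) F} :=
    fun I => ⟨sphericalHull (v '' I.1), hv.isFacet I.2.1 I.2.2⟩
  have hφ : Function.Bijective φ := by
    constructor
    · intro I J h
      have h' : sphericalHull (v '' I.1) = sphericalHull (v '' J.1) := congrArg Subtype.val h
      exact Subtype.ext (Finset.Subset.antisymm (hv.subset_of_sphericalHull_eq J.2.2 h'.symm)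
        (hv.subset_of_sphericalHull_eq I.2.2 h'))
    · rintro ⟨F, hF⟩
      obtain ⟨I, h1, h2, h3⟩ := hv.exists_of_isFacet hF
      exact ⟨⟨I, h1, h2⟩, Subtype.ext h3⟩
  rw [surfaceArea, ← (Equiv.ofBijective φ hφ).tsum_eq, tsum_fintype, ← Finset.sum_filter]
  rw [Finset.sum_subtype (p := fun I => I.card = d ∧ Supports v I) _ (by
    intro I
    simp [Finset.mem_powersetCard])]
  refine Finset.sum_congr rfl fun I _ => ?_
  change greatSubsphereMeasure (Submodule.span ℝ (sphericalHull (v '' I.1))) _ = _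
  rw [span_sphericalHull (hv.zero_notMem _)]
  rfl

end Facets

/-! ### Coordinates adapted to the centre of the halfsphere -/

/-- The vector of `ℝ^{d+1}` with height `p.1` along `b 0` and the other coordinates `p.2`. -/
noncomputable def vec {d : ℕ} (b : OrthonormalBasis (Fin (d + 1)) ℝ (Ambient d)) :
    ℝ × (Fin d → ℝ) →ₗ[ℝ] Ambient d :=
  (LinearMap.toSpanSingleton ℝ _ (b 0)).coprod (Fintype.linearCombination ℝ fun j => b j.succ)

section Coordinates

variable {d : ℕ} (b : OrthonormalBasis (Fin (d + 1)) ℝ (Ambient d))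

theorem vec_apply (p : ℝ × (Fin d → ℝ)) : vec b p = p.1 • b 0 + ∑ j, p.2 j • b j.succ := by
  simp [vec, Fintype.linearCombination_apply]

theorem inner_vec_right (u : Ambient d) (p : ℝ × (Fin d → ℝ)) :
    inner ℝ u (vec b p) = inner ℝ u (b 0) * p.1 + (fun j => inner ℝ u (b j.succ)) ⬝ᵥ p.2 := by
  simp only [vec_apply, inner_add_right, inner_sum, real_inner_smul_right, dotProduct, mul_comm]

theorem inner_vec_zero (p : ℝ × (Fin d → ℝ)) : inner ℝ (vec b p) (b 0) = p.1 := by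
  rw [real_inner_comm, inner_vec_right]
  simp [b.inner_eq_ite, dotProduct, (Fin.succ_ne_zero _).symm]

theorem inner_vec_succ (p : ℝ × (Fin d → ℝ)) (j : Fin d) :
    inner ℝ (vec b p) (b j.succ) = p.2 j := by
  rw [real_inner_comm, inner_vec_right]
  simp [b.inner_eq_ite, dotProduct, Fin.succ_ne_zero]

theorem inner_vec_vec (p q : ℝ × (Fin d → ℝ)) :
    inner ℝ (vec b p) (vec b q) = p.1 * q.1 + p.2 ⬝ᵥ q.2 := by
  simp only [inner_vec_right, inner_vec_zero, inner_vec_succ]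

theorem mulVec_slope {q : Fin d → ℝ × (Fin d → ℝ)} (hq : (Matrix.of fun i => (q i).2).det ≠ 0)
    (i : Fin d) : (q i).2 ⬝ᵥ slope q = (q i).1 := by
  have h : (Matrix.of fun i => (q i).2).mulVec (slope q) = fun i => (q i).1 := by
    rw [slope, Matrix.mulVec_mulVec, Matrix.mul_nonsing_inv _ hq.isUnit, Matrix.one_mulVec]
  exact congrFun h i

theorem linearIndependent_vec {q : Fin d → ℝ × (Fin d → ℝ)}
    (hq : (Matrix.of fun i => (q i).2).det ≠ 0) : LinearIndependent ℝ fun i => vec b (q i) := by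
  have h1 : LinearIndependent ℝ fun i => (q i).2 :=
    Matrix.linearIndependent_rows_of_det_ne_zero hq
  have h2 : LinearIndependent ℝ q := h1.of_comp (LinearMap.snd ℝ ℝ (Fin d → ℝ))
  refine h2.map' (vec b) (LinearMap.ker_eq_bot'.2 fun p hp => ?_)
  refine Prod.ext ?_ (funext fun j => ?_)
  · rw [← inner_vec_zero b, hp, inner_zero_left]; rfl
  · rw [← inner_vec_succ b, hp, inner_zero_left]; rfl

/-- A normal that annihilates the points of I is a multiple u0 · (1, -slope), so its value at (h, z)
is u0 (h - ⟨slope, z⟩). The sign of u0 decides the side, and u0 = 0 is excluded by the existence of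
a point outside I. -/
theorem supports_iff_oneSided {n : ℕ} {p : Fin n → ℝ × (Fin d → ℝ)} {I : Finset (Fin n)}
    (hI : I.card = d) (hn : d < n)
    (hdet : (Matrix.of fun i => ((p ∘ I.orderEmbOfFin hI) i).2).det ≠ 0) :
    Supports (fun i => vec b (p i)) I ↔ OneSided I hI p := by
  set q := p ∘ I.orderEmbOfFin hI with hq
  have hsl := mulVec_slope hdet
  have hmem : ∀ i ∈ I, ∃ k, I.orderEmbOfFin hI k = i := by
    intro i hi
    have : i ∈ Set.range (I.orderEmbOfFin hI) := by
      rw [Finset.range_orderEmbOfFin]; exact hi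
    exact this
  constructor
  · rintro ⟨u, h1, h2⟩
    set u0 := inner ℝ u (b 0) with hu0
    set u' : Fin d → ℝ := fun j => inner ℝ u (b j.succ) with hu'
    have hu : u' = -(u0 • slope q) := by
      have hinj := Matrix.mulVec_injective_iff_isUnit.2
        ((Matrix.isUnit_iff_isUnit_det _).2 hdet.isUnit)
      refine hinj (funext fun k => ?_)
      have := h1 _ (Finset.orderEmbOfFin_mem I hI k)
      rw [inner_vec_right] at this
      change (q k).2 ⬝ᵥ u' = (q k).2 ⬝ᵥ (-(u0 • slope q))
      rw [dotProduct_neg, dotProduct_smul, hsl k, dotProduct_comm, smul_eq_mul]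
      change u0 * (q k).1 + u' ⬝ᵥ (q k).2 = 0 at this
      linarith
    have hval : ∀ j, inner ℝ u (vec b (p j)) = u0 * ((p j).1 - slope q ⬝ᵥ (p j).2) := by
      intro j
      rw [inner_vec_right]
      change u0 * (p j).1 + u' ⬝ᵥ (p j).2 = _
      rw [hu, neg_dotProduct, smul_dotProduct, smul_eq_mul]
      ring
    have hneg : ∀ j ∉ I, u0 * ((p j).1 - slope q ⬝ᵥ (p j).2) < 0 := fun j hj =>
      hval j ▸ h2 j hj
    rcases lt_trichotomy u0 0 with h0 | h0 | h0
    · left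
      intro j hj
      have := pos_of_mul_neg_right (hneg j hj) h0.le
      linarith
    · exfalso
      obtain ⟨j, hj⟩ : ∃ j, j ∉ I := by
        by_contra hc
        push Not at hc
        rw [Finset.eq_univ_iff_forall.2 hc, Finset.card_univ, Fintype.card_fin] at hI
        omega
      have := hneg j hj
      rw [h0, zero_mul] at this
      exact this.false
    · right
      intro j hj
      have := neg_of_mul_neg_right (hneg j hj) h0.le
      linarith
  · have hval : ∀ s j, inner ℝ (vec b (s, -(s • slope q))) (vec b (p j)) =
        s * ((p j).1 - slope q ⬝ᵥ (p j).2) := by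
      intro s j
      rw [inner_vec_vec, neg_dotProduct, smul_dotProduct, smul_eq_mul]
      ring
    have hz : ∀ s, ∀ i ∈ I, inner ℝ (vec b (s, -(s • slope q))) (vec b (p i)) = 0 := by
      intro s i hi
      obtain ⟨k, rfl⟩ := hmem i hi
      have := hsl k
      rw [hval, dotProduct_comm]
      change s * ((q k).1 - (q k).2 ⬝ᵥ slope q) = 0
      rw [this, sub_self, mul_zero]
    rintro (h | h)
    · refine ⟨_, hz (-1), fun j hj => ?_⟩
      have := h j hj
      rw [hval]
      linarith
    · refine ⟨_, hz 1, fun j hj => ?_⟩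
      have := h j hj
      rw [hval]
      linarith

end Coordinates

/-! ### Facet content as a Gaussian integral over a cone -/

/-- The radial Gaussian integral `∫ r^m exp(-r²/2) dr` over the positive reals. -/
noncomputable def radialConst (m : ℕ) : ℝ :=
  (1 / 2 : ℝ) ^ (-((m : ℝ) + 1) / 2) * (1 / 2) * Real.Gamma (((m : ℝ) + 1) / 2)

theorem radialConst_pos (m : ℕ) : 0 < radialConst m := by
  have : 0 < Real.Gamma (((m : ℝ) + 1) / 2) := Real.Gamma_pos_of_pos (by positivity)
  rw [radialConst]
  positivity

theorem lintegral_radial (m : ℕ) :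
    ∫⁻ r in Set.Ioi (0 : ℝ), ENNReal.ofReal (r ^ m) * ENNReal.ofReal (Real.exp (-r ^ 2 / 2)) =
      ENNReal.ofReal (radialConst m) := by
  rw [radialConst, ← lintegral_pow_mul_exp_neg_mul_sq m (by norm_num : (0 : ℝ) < 1 / 2)]
  refine setLIntegral_congr_fun measurableSet_Ioi fun r hr => ?_
  have hr0 : 0 < r := hr
  rw [← ENNReal.ofReal_mul (by positivity)]
  congr 3
  ring

theorem smul_mem_hull_iff {E : Type*} [AddCommGroup E] [Module ℝ E] {s : Set E} {r : ℝ}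
    (hr : 0 < r) {x : E} : r • x ∈ PointedCone.hull ℝ s ↔ x ∈ PointedCone.hull ℝ s := by
  refine ⟨fun h => ?_, smul_mem_hull hr.le⟩
  have := smul_mem_hull (inv_pos.2 hr).le h
  rwa [inv_smul_smul₀ hr.ne'] at this

theorem sum_smul_mem_hull_iff {E ι : Type*} [AddCommGroup E] [Module ℝ E] [Fintype ι] {w : ι → E}
    (hw : LinearIndependent ℝ w) (c : ι → ℝ) :
    ∑ i, c i • w i ∈ PointedCone.hull ℝ (Set.range w) ↔ 0 ≤ c := by
  rw [mem_hull_range]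
  constructor
  · rintro ⟨c', hc', h⟩ i
    have h0 : ∑ i, (c' i - c i) • w i = 0 := by
      simp only [sub_smul, Finset.sum_sub_distrib, h, sub_self]
    have := Fintype.linearIndependent_iff.1 hw _ h0 i
    have h2 := hc' i
    change 0 ≤ c i
    linarith
  · exact fun h => ⟨c, h, rfl⟩

/-- Polar coordinates for the Gaussian integral over a cone in a subspace. -/
theorem lintegral_gaussian_cone {E : Type*} [NormedAddCommGroup E] [NormedSpace ℝ E]
    [MeasurableSpace E] [BorelSpace E] [FiniteDimensional ℝ E] (μ : Measure E)
    [μ.IsAddHaarMeasure] {m : ℕ} (hm : Module.finrank ℝ E = m + 1) {K : Set E}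
    (hK : MeasurableSet K) (hcone : ∀ r : ℝ, 0 < r → ∀ x, r • x ∈ K ↔ x ∈ K) :
    ∫⁻ x in K, ENNReal.ofReal (Real.exp (-‖x‖ ^ 2 / 2)) ∂μ =
      ENNReal.ofReal (radialConst m) * μ.toSphere ((↑) ⁻¹' K) := by
  have : Nontrivial E := Module.nontrivial_of_finrank_pos (R := ℝ) (by omega)
  have hms : MeasurableSet ((↑) ⁻¹' K : Set (Metric.sphere (0 : E) 1)) :=
    measurable_subtype_coe hK
  rw [← lintegral_indicator hK, lintegral_polar μ
    (Measurable.indicator (by fun_prop) hK), hm]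
  have hpt : ∀ θ : Metric.sphere (0 : E) 1, ∫⁻ r in Set.Ioi (0 : ℝ),
      ENNReal.ofReal (r ^ (m + 1 - 1)) * K.indicator
        (fun x => ENNReal.ofReal (Real.exp (-‖x‖ ^ 2 / 2))) (r • (θ : E)) =
      ((↑) ⁻¹' K : Set (Metric.sphere (0 : E) 1)).indicator
        (fun _ => ENNReal.ofReal (radialConst m)) θ := by
    intro θ
    have hθ : ‖(θ : E)‖ = 1 := by simp
    by_cases h : (θ : E) ∈ K
    · rw [Set.indicator_of_mem (by exact h), ← lintegral_radial]
      refine setLIntegral_congr_fun measurableSet_Ioi fun r hr => ?_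
      have hr0 : 0 < r := hr
      rw [Set.indicator_of_mem ((hcone r hr0 θ).2 h), norm_smul, hθ, Real.norm_of_nonneg hr0.le,
        mul_one, Nat.add_sub_cancel]
    · rw [Set.indicator_of_notMem (by exact h), setLIntegral_congr_fun (g := 0)
        measurableSet_Ioi fun r hr => ?_]
      · simp
      · have hr0 : 0 < r := hr
        simp only [Pi.zero_apply]
        rw [Set.indicator_of_notMem (fun h' => h ((hcone r hr0 θ).1 h')), mul_zero]
  rw [lintegral_congr hpt, lintegral_indicator_const hms]

theorem greatSubsphereMeasure_sphericalHull {d : ℕ} (L : Submodule ℝ (Ambient d))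
    (s : Set (Ambient d)) : greatSubsphereMeasure L (sphericalHull s) =
      (volume : Measure L).toSphere ((↑) ⁻¹' {x : L | (x : Ambient d) ∈ PointedCone.hull ℝ s}) := by
  have hL : MeasurableEmbedding ((↑) : L → Ambient d) :=
    MeasurableEmbedding.subtype_coe L.closed_of_finiteDimensional.measurableSet
  have hS : MeasurableEmbedding ((↑) : Metric.sphere (0 : L) 1 → L) :=
    MeasurableEmbedding.subtype_coe Metric.isClosed_sphere.measurableSet
  have h := (hL.comp hS).map_apply (volume : Measure L).toSphere (sphericalHull s)
  refine h.trans (congrArg _ ?_)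
  ext x
  have hx : ((x : L) : Ambient d) ∈ Sph d := by
    have : ‖((x : L) : Ambient d)‖ = 1 := norm_eq_of_mem_sphere x
    exact mem_sphere_zero_iff_norm.2 this
  exact ⟨fun h => h.2, fun h => ⟨hx, h⟩⟩

section FacetContent

variable {m : ℕ} (b : OrthonormalBasis (Fin (m + 1 + 1)) ℝ (Ambient (m + 1)))
  {q : Fin (m + 1) → ℝ × (Fin (m + 1) → ℝ)}

/-- Integration over the hyperplane spanned by `d` points in the coordinates they provide. -/
theorem lintegral_span_vec (hq : (Matrix.of fun i => (q i).2).det ≠ 0)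
    {F : Ambient (m + 1) → ℝ≥0∞}
    (hF : Measurable fun x : Submodule.span ℝ (Set.range fun i => vec b (q i)) => F x) :
    ∫⁻ x : Submodule.span ℝ (Set.range fun i => vec b (q i)), F x =
      ENNReal.ofReal (√(1 + slope q ⬝ᵥ slope q) * |(Matrix.of fun i => (q i).2).det|) *
        ∫⁻ c : Fin (m + 1) → ℝ, F (∑ i, c i • vec b (q i)) := by
  set w := fun i => vec b (q i) with hw
  set H := Submodule.span ℝ (Set.range w) with hH
  set Z : Matrix (Fin (m + 1)) (Fin (m + 1)) ℝ := Matrix.of fun i => (q i).2 with hZ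
  set a := slope q with ha
  have hwi : LinearIndependent ℝ w := linearIndependent_vec b hq
  have hfr : Module.finrank ℝ H = m + 1 := by
    rw [hH, finrank_span_eq_card hwi, Fintype.card_fin]
  obtain ⟨M, l, -, -, -, hdet, hrow, -⟩ := exists_whitening a
  have hMdet := abs_det_eq_inv_sqrt hdet
  have hM0 : M.det ≠ 0 := by
    intro h
    rw [h] at hdet
    norm_num at hdet
  -- The hyperplane is the graph of z ↦ ⟨a, z⟩, and the inner product it induces on the horizontal
  -- space is the form 1 + a aᵀ.
  let g : (Fin (m + 1) → ℝ) →ₗ[ℝ] Ambient (m + 1) :=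
    vec b ∘ₗ (dotProductBilin ℝ ℝ a).prod LinearMap.id
  have hg : ∀ z, g z = vec b (a ⬝ᵥ z, z) := fun z => rfl
  have hgq : ∀ i, g (Z i) = w i := by
    intro i
    rw [hg, dotProduct_comm]
    change vec b ((q i).2 ⬝ᵥ slope q, (q i).2) = _
    rw [mulVec_slope hq]
  have hgZ : ∀ c : Fin (m + 1) → ℝ, g (Z.transpose.mulVec c) = ∑ i, c i • w i := by
    intro c
    rw [Matrix.mulVec_transpose, Matrix.vecMul_eq_sum, map_sum]
    refine Finset.sum_congr rfl fun i _ => ?_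
    rw [map_smul, ← hgq i]
  have hgH : ∀ z, g z ∈ H := by
    intro z
    have : z = Z.transpose.mulVec (Z.transpose⁻¹.mulVec z) := by
      rw [Matrix.mulVec_mulVec, Matrix.mul_nonsing_inv _ (by
        rw [Matrix.det_transpose]; exact hq.isUnit), Matrix.one_mulVec]
    rw [this, hgZ]
    exact Submodule.sum_mem _ fun i _ => Submodule.smul_mem _ _ (Submodule.subset_span ⟨i, rfl⟩)
  -- The rows of the whitening matrix are orthonormal for that form, so they give an orthonormal
  -- basis in which to compute Lebesgue measure of the hyperplane.
  let f0 : Fin (m + 1) → H := fun k => ⟨g (M k), hgH _⟩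
  have hon : Orthonormal ℝ f0 := by
    rw [orthonormal_iff_ite]
    intro i j
    change inner ℝ (g (M i)) (g (M j)) = _
    rw [hg, hg, inner_vec_vec, ← hrow i j]
    ring
  let f : OrthonormalBasis (Fin (m + 1)) ℝ H := OrthonormalBasis.mk hon
    (hon.linearIndependent.span_eq_top_of_card_eq_finrank' (by simp [hfr])).ge
  have hf : ∀ k, f k = f0 k := fun k => by simp [f]
  have hmp := f.measurePreserving_repr_symm.comp
    (EuclideanSpace.volume_preserving_symm_measurableEquiv_toLp (Fin (m + 1))).symm
  have hcoe : ∀ y : Fin (m + 1) → ℝ, ((f.repr.symm ((MeasurableEquiv.toLp 2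
      (Fin (m + 1) → ℝ)) y) : H) : Ambient (m + 1)) = g (M.transpose.mulVec y) := by
    intro y
    have : f.repr.symm ((MeasurableEquiv.toLp 2 (Fin (m + 1) → ℝ)) y) = ∑ k, y k • f k := by
      rw [← OrthonormalBasis.sum_repr_symm]
      rfl
    rw [this, Matrix.mulVec_transpose, Matrix.vecMul_eq_sum, map_sum]
    simp only [hf, Submodule.coe_sum, Submodule.coe_smul, f0, map_smul]
  have hF1 : Measurable fun y : Fin (m + 1) → ℝ => F (g (M.transpose.mulVec y)) := by
    have := hF.comp hmp.measurable
    convert this using 2 with y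
    exact (congrArg F (hcoe y)).symm
  have h1 : ∫⁻ x : H, F x = ∫⁻ y : Fin (m + 1) → ℝ, F (g (M.transpose.mulVec y)) := by
    rw [← hmp.lintegral_comp hF]
    exact lintegral_congr fun y => congrArg F (hcoe y)
  have hMt : IsUnit M.transpose.det := by
    rw [Matrix.det_transpose]; exact hM0.isUnit
  have hAdet : |(M.transpose⁻¹ * Z.transpose).det| = √(1 + a ⬝ᵥ a) * |Z.det| := by
    rw [Matrix.det_mul, Matrix.det_nonsing_inv, Matrix.det_transpose, Matrix.det_transpose,
      abs_mul, Ring.inverse_eq_inv', abs_inv, hMdet, inv_inv]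
  have hA0 : (M.transpose⁻¹ * Z.transpose).det ≠ 0 := by
    rw [Matrix.det_mul, Matrix.det_transpose]
    exact mul_ne_zero ((Matrix.isUnit_nonsing_inv_det _ hMt).ne_zero) hq
  rw [h1, lintegral_comp_mulVec _ hA0 hF1, hAdet]
  congr 1
  refine lintegral_congr fun c => ?_
  rw [Matrix.mulVec_mulVec, ← mul_assoc, Matrix.mul_nonsing_inv _ hMt, one_mul, hgZ]

/-- The Gaussian integral over the cone is computed twice: polar coordinates give the radial
constant times the spherical content, and the coordinates of the generators, which run through the
positive orthant, give `coneGaussian`. -/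
theorem greatSubsphereMeasure_hull_vec (hq : (Matrix.of fun i => (q i).2).det ≠ 0) :
    greatSubsphereMeasure (Submodule.span ℝ (Set.range fun i => vec b (q i)))
      (sphericalHull (Set.range fun i => vec b (q i))) =
      (ENNReal.ofReal (radialConst m))⁻¹ * coneGaussian q := by
  have hwi := linearIndependent_vec b hq
  have hfr : Module.finrank ℝ (Submodule.span ℝ (Set.range fun i => vec b (q i))) = m + 1 := by
    rw [finrank_span_eq_card hwi, Fintype.card_fin]
  let K : Set (Ambient (m + 1)) := ↑(PointedCone.hull ℝ (Set.range fun i => vec b (q i)))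
  have hmemK : ∀ c : Fin (m + 1) → ℝ, ∑ i, c i • vec b (q i) ∈ K ↔ 0 ≤ c :=
    sum_smul_mem_hull_iff hwi
  have hKm : MeasurableSet ((↑) ⁻¹' K :
      Set (Submodule.span ℝ (Set.range fun i => vec b (q i)))) := by
    let B := Module.Basis.span hwi
    have h : ((↑) ⁻¹' K : Set (Submodule.span ℝ (Set.range fun i => vec b (q i)))) =
        ⋂ i, {x | 0 ≤ B.coord i x} := by
      ext x
      have hx : (x : Ambient (m + 1)) = ∑ i, B.repr x i • vec b (q i) := by
        conv_lhs => rw [← B.sum_repr x]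
        rw [Submodule.coe_sum]
        refine Finset.sum_congr rfl fun i _ => ?_
        rw [Submodule.coe_smul, Module.Basis.span_apply]
      rw [Set.mem_preimage, hx, hmemK, Set.mem_iInter]
      rfl
    rw [h]
    refine MeasurableSet.iInter fun i => measurableSet_le measurable_const ?_
    exact (LinearMap.continuous_of_finiteDimensional (B.coord i)).measurable
  have hpos := radialConst_pos m
  rw [greatSubsphereMeasure_sphericalHull]
  have h1 := lintegral_gaussian_cone volume hfr hKm fun r hr x => smul_mem_hull_iff hr
  have h2 : ∫⁻ x in ((↑) ⁻¹' K : Set (Submodule.span ℝ (Set.range fun i => vec b (q i)))),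
      ENNReal.ofReal (Real.exp (-‖x‖ ^ 2 / 2)) = coneGaussian q := by
    rw [← lintegral_indicator hKm, coneGaussian]
    refine (lintegral_span_vec b hq
      (F := K.indicator fun x => ENNReal.ofReal (Real.exp (-‖x‖ ^ 2 / 2))) ?_).trans ?_
    · exact Measurable.indicator (by fun_prop) hKm
    · rw [← lintegral_indicator measurableSet_Ici]
      congr 1
      refine lintegral_congr fun c => ?_
      have hsum : ∑ i, c i • vec b (q i) = vec b (∑ i, c i * (q i).1, ∑ i, c i • (q i).2) := by
        simp only [← map_smul, ← map_sum]
        congr 1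
        exact Prod.ext (by simp [Prod.fst_sum]) (by simp [Prod.snd_sum])
      have hnorm : ‖∑ i, c i • vec b (q i)‖ ^ 2 = (∑ i, c i • (q i).2) ⬝ᵥ (∑ i, c i • (q i).2) +
          (∑ i, c i * (q i).1) ^ 2 := by
        rw [← real_inner_self_eq_norm_sq, hsum, inner_vec_vec]
        ring
      by_cases hc : 0 ≤ c
      · rw [Set.indicator_of_mem ((hmemK c).2 hc), Set.indicator_of_mem (Set.mem_Ici.2 hc), hnorm]
      · rw [Set.indicator_of_notMem fun h => hc ((hmemK c).1 h),
          Set.indicator_of_notMem fun h => hc (Set.mem_Ici.1 h)]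
  rw [← h2, h1, ← mul_assoc, ENNReal.inv_mul_cancel, one_mul]
  · rfl
  · simpa using hpos
  · exact ENNReal.ofReal_ne_top

end FacetContent

/-! ### Almost sure general position -/

/-- A function with null zero sets on all parallels to a line has a null zero set. -/
theorem ae_ne_zero_of_line {E : Type*} [AddCommGroup E] [Module ℝ E] [MeasurableSpace E]
    [MeasurableAdd₂ E] (μ : Measure E) [SFinite μ] [μ.IsAddLeftInvariant] {D : E → ℝ}
    (hD : Measurable D) (w : E) (hw : Measurable fun t : ℝ => t • w)
    (h : ∀ p, {t : ℝ | D (t • w + p) = 0}.Countable) :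
    ∀ᵐ p ∂μ, D p ≠ 0 := by
  have hms : MeasurableSet {p : E | D p = 0} := hD (measurableSet_singleton 0)
  have hms2 : MeasurableSet {z : E × ℝ | D (z.2 • w + z.1) = 0} := by
    have : Measurable fun z : E × ℝ => D (z.2 • w + z.1) := by fun_prop
    exact this (measurableSet_singleton 0)
  -- Fubini in both orders: the sections along lines are countable, so for some t the zero set
  -- translated by t w is null. Translation invariance then removes t.
  have h1 : (μ.prod volume) {z : E × ℝ | D (z.2 • w + z.1) = 0} = 0 := by
    refine Measure.measure_prod_null_of_ae_null hms2 (Filter.Eventually.of_forall fun p => ?_)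
    exact (h p).measure_zero volume
  rw [Measure.prod_apply_symm hms2, lintegral_eq_zero_iff (measurable_measure_prodMk_right hms2)]
    at h1
  obtain ⟨t, ht⟩ := h1.exists
  rw [ae_iff]
  simp only [ne_eq, not_not]
  have ht' : μ ((fun p => t • w + p) ⁻¹' {p | D p = 0}) = 0 := ht
  rwa [measure_preimage_add] at ht'

/-- As a function of t this is the characteristic polynomial of -A, which is monic and has finitely
many roots. -/
theorem countable_det_add_smul_one {k : ℕ} (A : Matrix (Fin k) (Fin k) ℝ) :
    {t : ℝ | (A + t • (1 : Matrix (Fin k) (Fin k) ℝ)).det = 0}.Countable := by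
  have h : {t : ℝ | (A + t • (1 : Matrix (Fin k) (Fin k) ℝ)).det = 0} ⊆
      {t | (-A).charpoly.IsRoot t} := by
    intro t ht
    have ht' : (A + t • (1 : Matrix (Fin k) (Fin k) ℝ)).det = 0 := ht
    change (-A).charpoly.eval t = 0
    rw [Matrix.eval_charpoly, ← ht', sub_neg_eq_add, add_comm, Matrix.smul_one_eq_diagonal]
    rfl
  exact (Polynomial.finite_setOfPred_isRoot (-A).charpoly_monic.ne_zero).countable.mono h

/-- The determinants formed from the coordinates of almost all families of points do not vanish. -/
theorem ae_det_ne_zero {n k : ℕ} {E : Type*} [AddCommGroup E] [Module ℝ E] [MeasurableSpace E]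
    [MeasurableAdd₂ E] [MeasurableSMul₂ ℝ E] (μ : Measure E) [SigmaFinite μ]
    [μ.IsAddLeftInvariant]
    (σ : Fin k ↪ Fin n) (L : E →ₗ[ℝ] (Fin k → ℝ)) (hLm : Measurable L)
    (hL : Function.Surjective L) :
    ∀ᵐ p ∂(Measure.pi fun _ : Fin n => μ), (Matrix.of fun i => L (p (σ i))).det ≠ 0 := by
  choose s hs using fun i : Fin k => hL (Pi.single i 1)
  have hD : Measurable fun p : Fin n → E => (Matrix.of fun i => L (p (σ i))).det := by
    have h1 : Measurable fun M : Fin k → Fin k → ℝ => (Matrix.of M).det := measurable_det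
    exact h1.comp (measurable_pi_iff.2 fun i => hLm.comp (measurable_pi_apply _))
  -- The selected points move along preimages of the unit vectors and all others stay fixed, so the
  -- matrix changes by t times the identity.
  refine ae_ne_zero_of_line _ hD (Function.extend σ s 0)
    (measurable_pi_iff.2 fun i => measurable_id.smul_const _) fun p => ?_
  refine (countable_det_add_smul_one (Matrix.of fun i => L (p (σ i)))).mono fun t ht => ?_
  have ht' : (Matrix.of fun i => L ((t • Function.extend σ s 0 + p) (σ i))).det = 0 := ht
  change Matrix.det _ = 0
  rw [← ht', add_comm]
  congr 1
  ext i j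
  simp only [Matrix.add_apply, Matrix.of_apply, Matrix.smul_apply, Pi.add_apply, Pi.smul_apply,
    σ.injective.extend_apply, map_add, map_smul, hs, Matrix.one_apply, Pi.single_apply,
    eq_comm (a := i)]

/-- All determinants formed from the coordinates, or from the coordinates other than the height,
of sufficiently many points are nonzero. -/
def Generic {d n : ℕ} (p : Fin n → ℝ × (Fin d → ℝ)) : Prop :=
  (∀ σ : Fin d ↪o Fin n, (Matrix.of fun i => (p (σ i)).2).det ≠ 0) ∧
    ∀ σ : Fin (d + 1) ↪o Fin n, (Matrix.of fun i =>
      Fin.consLinearEquiv ℝ (fun _ => ℝ) (p (σ i))).det ≠ 0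

theorem measurableSet_generic {d n : ℕ} :
    MeasurableSet {p : Fin n → ℝ × (Fin d → ℝ) | Generic p} := by
  have h : ∀ {k : ℕ} (L : ℝ × (Fin d → ℝ) → Fin k → ℝ) (_ : Measurable L) (σ : Fin k ↪o Fin n),
      MeasurableSet {p : Fin n → ℝ × (Fin d → ℝ) | (Matrix.of fun i => L (p (σ i))).det ≠ 0} := by
    intro k L hL σ
    have h1 : Measurable fun M : Fin k → Fin k → ℝ => (Matrix.of M).det := measurable_det
    exact (h1.comp (measurable_pi_iff.2 fun i => hL.comp (measurable_pi_apply (σ i))))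
      (measurableSet_singleton 0).compl
  have h2 := MeasurableSet.iInter fun σ => h Prod.snd measurable_snd σ
  have h3 := MeasurableSet.iInter fun σ => h (Fin.consLinearEquiv ℝ (fun _ => ℝ))
    (LinearMap.continuous_of_finiteDimensional
      (Fin.consLinearEquiv ℝ fun _ : Fin (d + 1) => ℝ).toLinearMap).measurable σ
  convert h2.inter h3 using 1
  ext p
  simp only [Set.mem_inter_iff, Set.mem_iInter]
  rfl

theorem ae_generic (d n : ℕ) :
    ∀ᵐ p ∂(Measure.pi fun _ : Fin n => halfGaussian d), Generic p := by
  have hac : (Measure.pi fun _ : Fin n => halfGaussian d) ≪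
      Measure.pi fun _ => (volume : Measure (ℝ × (Fin d → ℝ))) := by
    have : SigmaFinite ((volume : Measure (ℝ × (Fin d → ℝ))).withDensity
      (halfGaussianDensity d)) := inferInstanceAs (SigmaFinite (halfGaussian d))
    unfold halfGaussian
    rw [pi_withDensity _ (measurable_halfGaussianDensity d)]
    exact withDensity_absolutelyContinuous _ _
  refine hac.ae_le ?_
  have : (volume : Measure (ℝ × (Fin d → ℝ))).IsAddLeftInvariant :=
    inferInstanceAs (Measure.prod volume volume).IsAddLeftInvariant
  have h1 : ∀ᵐ p ∂(Measure.pi fun _ : Fin n => (volume : Measure (ℝ × (Fin d → ℝ)))),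
      ∀ σ : Fin d ↪o Fin n, (Matrix.of fun i => (p (σ i)).2).det ≠ 0 := by
    refine ae_all_iff.2 fun σ => ?_
    exact ae_det_ne_zero volume σ.toEmbedding (LinearMap.snd ℝ ℝ (Fin d → ℝ)) measurable_snd
      fun y => ⟨(0, y), rfl⟩
  have h2 : ∀ᵐ p ∂(Measure.pi fun _ : Fin n => (volume : Measure (ℝ × (Fin d → ℝ)))),
      ∀ σ : Fin (d + 1) ↪o Fin n, (Matrix.of fun i =>
        Fin.consLinearEquiv ℝ (fun _ => ℝ) (p (σ i))).det ≠ 0 := by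
    refine ae_all_iff.2 fun σ => ?_
    exact ae_det_ne_zero volume σ.toEmbedding
      (Fin.consLinearEquiv ℝ fun _ : Fin (d + 1) => ℝ).toLinearMap
      (LinearMap.continuous_of_finiteDimensional _).measurable
      (Fin.consLinearEquiv ℝ fun _ : Fin (d + 1) => ℝ).surjective
  filter_upwards [h1, h2] with p hp1 hp2 using ⟨hp1, hp2⟩

/-- Row scaling multiplies determinants by positive numbers. This carries genericity from the
Gaussian vectors to their directions. -/
theorem Generic.smul {d n : ℕ} {p : Fin n → ℝ × (Fin d → ℝ)} (hp : Generic p) {r : Fin n → ℝ}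
    (hr : ∀ i, 0 < r i) : Generic fun i => r i • p i := by
  have h : ∀ {k : ℕ} (M : Fin k → Fin k → ℝ) (s : Fin k → ℝ), (∀ i, 0 < s i) →
      (Matrix.of M).det ≠ 0 → (Matrix.of fun i => s i • M i).det ≠ 0 := by
    intro k M s hs hM
    have := Matrix.det_mul_column s (Matrix.of M)
    change (Matrix.of fun i => s i • M i).det = _ at this
    rw [this]
    exact mul_ne_zero (Finset.prod_ne_zero_iff.2 fun i _ => (hs i).ne') hM
  refine ⟨fun σ => h _ (fun i => r (σ i)) (fun i => hr _) (hp.1 σ), fun σ => ?_⟩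
  simp only [map_smul]
  exact h _ (fun i => r (σ i)) (fun i => hr _) (hp.2 σ)

theorem Generic.generalPosition {d n : ℕ} {p : Fin n → ℝ × (Fin d → ℝ)} (hp : Generic p)
    (hn : d + 1 ≤ n) (b : OrthonormalBasis (Fin (d + 1)) ℝ (Ambient d)) :
    GeneralPosition fun i => vec b (p i) := by
  intro J hJ
  -- A smaller index set is enlarged to exactly d + 1 indices, the size for which genericity
  -- provides a full determinant.
  obtain ⟨K, hJK, -, hK⟩ := Finset.exists_subsuperset_card_eq (Finset.subset_univ J) hJ
    (by simpa using hn)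
  have h1 : LinearIndependent ℝ fun i =>
      Fin.consLinearEquiv ℝ (fun _ : Fin (d + 1) => ℝ) (p (K.orderEmbOfFin hK i)) :=
    Matrix.linearIndependent_rows_of_det_ne_zero (hp.2 (K.orderEmbOfFin hK))
  have h2 : LinearIndependent ℝ fun i => p (K.orderEmbOfFin hK i) :=
    h1.of_comp (Fin.consLinearEquiv ℝ fun _ : Fin (d + 1) => ℝ).toLinearMap
  have h3 : LinearIndependent ℝ ((fun i => vec b (p i)) ∘ K.orderEmbOfFin hK) := by
    refine h2.map' (vec b) (LinearMap.ker_eq_bot'.2 fun p hp => ?_)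
    refine Prod.ext ?_ (funext fun j => ?_)
    · rw [← inner_vec_zero b, hp, inner_zero_left]; rfl
    · rw [← inner_vec_succ b, hp, inner_zero_left]; rfl
  have h4 := (linearIndepOn_range_iff (K.orderEmbOfFin hK).injective _).2 h3
  rw [Finset.range_orderEmbOfFin] at h4
  exact h4.mono (by exact_mod_cast hJK)

/-- The surface area of the spherical hull of generic points in terms of their coordinates. -/
theorem surfaceArea_hull_vec {m n : ℕ} {p : Fin n → ℝ × (Fin (m + 1) → ℝ)} (hp : Generic p)
    (hn : m + 1 < n) (b : OrthonormalBasis (Fin (m + 1 + 1)) ℝ (Ambient (m + 1))) :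
    surfaceArea (sphericalHull (Set.range fun i => vec b (p i))) =
      ∑ I : {I : Finset (Fin n) // I.card = m + 1},
        (ENNReal.ofReal (radialConst m))⁻¹ * facetTerm I.1 I.2 p := by
  classical
  rw [(hp.generalPosition hn b).surfaceArea_eq,
    Finset.sum_subtype (p := fun I => I.card = m + 1) _ (by
    intro I
    simp [Finset.mem_powersetCard])]
  refine Finset.sum_congr rfl fun I _ => ?_
  obtain ⟨I, hI⟩ := I
  have hdet := hp.1 (I.orderEmbOfFin hI)
  have hiff := supports_iff_oneSided b hI hn hdet
  rw [facetTerm]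
  by_cases h : OneSided I hI p
  · have hm : p ∈ {p | OneSided I hI p} := h
    have himg : (fun i => vec b (p i)) '' (I : Set (Fin n)) =
        Set.range fun k => vec b ((p ∘ I.orderEmbOfFin hI) k) := by
      rw [← Finset.range_orderEmbOfFin I hI, ← Set.range_comp]
      rfl
    rw [if_pos (hiff.2 h), Set.indicator_of_mem hm, himg,
      greatSubsphereMeasure_hull_vec b (q := p ∘ I.orderEmbOfFin hI) hdet]
  · have hm : p ∉ {p | OneSided I hI p} := h
    rw [if_neg (fun h' => h (hiff.1 h')), Set.indicator_of_notMem hm, mul_zero]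

/-! ### Uniform points as directions of half-Gaussian points -/

theorem measurePreserving_vec {d : ℕ} (b : OrthonormalBasis (Fin (d + 1)) ℝ (Ambient d)) :
    MeasurePreserving (vec b) volume volume := by
  have h := b.measurePreserving_repr_symm.comp
    ((EuclideanSpace.volume_preserving_symm_measurableEquiv_toLp (Fin (d + 1))).symm.comp
    (volume_preserving_piFinSuccAbove (fun _ : Fin (d + 1) => ℝ) 0).symm)
  refine (congrArg (fun f => MeasurePreserving f volume volume) ?_).mpr h
  funext p
  change _ = b.repr.symm (WithLp.toLp 2 (Fin.insertNth 0 p.1 p.2))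
  rw [← OrthonormalBasis.sum_repr_symm, Fin.sum_univ_succ, vec_apply]
  simp

/-- The direction of a vector; `e` serves for the zero vector. -/
noncomputable def direction {d : ℕ} (e : Sph d) (x : Ambient d) : Sph d :=
  ⟨open Classical in if x = 0 then e else ‖x‖⁻¹ • x, by
    split_ifs with h
    · exact e.2
    · rw [mem_sphere_zero_iff_norm, norm_smul, norm_inv, norm_norm,
        inv_mul_cancel₀ (norm_ne_zero_iff.2 h)]⟩

theorem coe_direction {d : ℕ} (e : Sph d) {x : Ambient d} (hx : x ≠ 0) :
    (direction e x : Ambient d) = ‖x‖⁻¹ • x := by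
  rw [direction]
  exact if_neg hx

theorem direction_smul {d : ℕ} (e θ : Sph d) {r : ℝ} (hr : 0 < r) :
    direction e (r • (θ : Ambient d)) = θ := by
  have hθ : ‖(θ : Ambient d)‖ = 1 := norm_eq_of_mem_sphere θ
  have h0 : (θ : Ambient d) ≠ 0 := by
    rw [← norm_ne_zero_iff, hθ]
    exact one_ne_zero
  refine Subtype.ext ?_
  rw [coe_direction e (smul_ne_zero hr.ne' h0), norm_smul, hθ, mul_one,
    Real.norm_of_nonneg hr.le, inv_smul_smul₀ hr.ne']

theorem measurable_direction {d : ℕ} (e : Sph d) : Measurable (direction e) := by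
  classical
  refine Measurable.subtype_mk ?_
  exact Measurable.ite (p := fun x : Ambient d => x = 0) (measurableSet_singleton 0)
    measurable_const (measurable_norm.inv.smul measurable_id)

theorem measurableSet_halfsphere {d : ℕ} (e : Sph d) : MeasurableSet (halfsphere e) :=
  measurableSet_le measurable_const (by fun_prop)

/-- The direction of a half-Gaussian vector is uniformly distributed in the halfsphere. -/
theorem map_direction_halfGaussian {d : ℕ} (e : Sph d)
    {b : OrthonormalBasis (Fin (d + 1)) ℝ (Ambient d)} (hb : b 0 = e) :
    (halfGaussian d).map (fun p => direction e (vec b p)) = uniformHalfsphere e := by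
  have hvec := measurePreserving_vec b
  have hT : Measurable fun p => direction e (vec b p) :=
    (measurable_direction e).comp hvec.measurable
  have hhalf := measurableSet_halfsphere e
  set c : ℝ := 2 * (√(2 * Real.pi))⁻¹ ^ (d + 1) with hc
  have hc0 : 0 ≤ c := by positivity
  let K : ℝ≥0∞ := ENNReal.ofReal c * ENNReal.ofReal (radialConst d)
  have hmain : ∀ s, MeasurableSet s →
      (halfGaussian d).map (fun p => direction e (vec b p)) s = K * sigma d (halfsphere e ∩ s) := by
    intro s hs
    let A : Set (Ambient d) := {x | 0 ≤ inner ℝ x (e : Ambient d)} ∩ direction e ⁻¹' s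
    have hA : MeasurableSet A :=
      (measurableSet_le measurable_const (by fun_prop)).inter (measurable_direction e hs)
    let F : Ambient d → ℝ≥0∞ := A.indicator fun x =>
      ENNReal.ofReal c * ENNReal.ofReal (Real.exp (-‖x‖ ^ 2 / 2))
    have hF : Measurable F := Measurable.indicator (by fun_prop) hA
    have h1 : ∀ p, ((fun p => direction e (vec b p)) ⁻¹' s).indicator
        (halfGaussianDensity d) p = F (vec b p) := by
      intro p
      have hin : inner ℝ (vec b p) (e : Ambient d) = p.1 := by rw [← hb, inner_vec_zero]
      have hnorm : ‖vec b p‖ ^ 2 = p.1 ^ 2 + p.2 ⬝ᵥ p.2 := by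
        rw [← real_inner_self_eq_norm_sq, inner_vec_vec, sq]
      by_cases h : direction e (vec b p) ∈ s
      · rw [Set.indicator_of_mem (by exact h), halfGaussianDensity]
        by_cases h0 : 0 ≤ p.1
        · have hm1 : p ∈ Set.Ici (0 : ℝ) ×ˢ (Set.univ : Set (Fin d → ℝ)) := ⟨h0, trivial⟩
          have hm2 : vec b p ∈ A := ⟨by rw [← hin] at h0; exact h0, h⟩
          simp only [F]
          rw [Set.indicator_of_mem hm1, Set.indicator_of_mem hm2, hnorm, ← hc,
            ENNReal.ofReal_mul hc0]
        · have hm1 : p ∉ Set.Ici (0 : ℝ) ×ˢ (Set.univ : Set (Fin d → ℝ)) := fun h => h0 h.1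
          have hm2 : vec b p ∉ A := fun h => h0 (by rw [← hin]; exact h.1)
          simp only [F]
          rw [Set.indicator_of_notMem hm1, Set.indicator_of_notMem hm2]
      · have hm2 : vec b p ∉ A := fun h' => h h'.2
        simp only [F]
        rw [Set.indicator_of_notMem (by exact h), Set.indicator_of_notMem hm2]
    have h2 : ∀ θ : Sph d, ∫⁻ r in Set.Ioi (0 : ℝ), ENNReal.ofReal
        (r ^ (Module.finrank ℝ (Ambient d) - 1)) * F (r • (θ : Ambient d)) =
        (halfsphere e ∩ s).indicator (fun _ => K) θ := by
      intro θ
      have hθ : ‖(θ : Ambient d)‖ = 1 := norm_eq_of_mem_sphere θ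
      have hiff : ∀ r : ℝ, 0 < r → (r • (θ : Ambient d) ∈ A ↔ θ ∈ halfsphere e ∩ s) := by
        intro r hr
        have h3 : 0 ≤ inner ℝ (r • (θ : Ambient d)) (e : Ambient d) ↔
            0 ≤ inner ℝ (θ : Ambient d) (e : Ambient d) := by
          rw [real_inner_smul_left]
          exact mul_nonneg_iff_of_pos_left hr
        have h4 : direction e (r • (θ : Ambient d)) ∈ s ↔ θ ∈ s := by rw [direction_smul e θ hr]
        exact and_congr h3 h4
      by_cases h : θ ∈ halfsphere e ∩ s
      · rw [Set.indicator_of_mem h]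
        simp only [K]
        rw [← lintegral_radial, ← lintegral_const_mul' _ _ ENNReal.ofReal_ne_top]
        refine setLIntegral_congr_fun measurableSet_Ioi fun r hr => ?_
        have hr0 : 0 < r := hr
        simp only [F]
        rw [Set.indicator_of_mem ((hiff r hr0).2 h), norm_smul, hθ, Real.norm_of_nonneg hr0.le,
          finrank_euclideanSpace_fin, Nat.add_sub_cancel, mul_one]
        ring
      · rw [Set.indicator_of_notMem h, setLIntegral_congr_fun (g := 0)
          measurableSet_Ioi fun r hr => ?_]
        · simp
        · have hr0 : 0 < r := hr
          simp only [Pi.zero_apply, F]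
          rw [Set.indicator_of_notMem (fun h' => h ((hiff r hr0).1 h')), mul_zero]
    rw [Measure.map_apply hT hs, halfGaussian, withDensity_apply _ (hT hs),
      ← lintegral_indicator (hT hs), lintegral_congr h1, hvec.lintegral_comp hF,
      lintegral_polar volume hF, lintegral_congr h2, lintegral_indicator_const (hhalf.inter hs)]
    rfl
  have hprob : IsProbabilityMeasure ((halfGaussian d).map fun p => direction e (vec b p)) :=
    Measure.isProbabilityMeasure_map hT.aemeasurable
  -- The radial constant need not be evaluated: the image is a probability measure proportional to σ
  -- on the halfsphere.
  have hK : K = (sigma d (halfsphere e))⁻¹ := by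
    have := hmain Set.univ MeasurableSet.univ
    rw [measure_univ, Set.inter_univ] at this
    exact ENNReal.eq_inv_of_mul_eq_one_left this.symm
  refine Measure.ext fun s hs => ?_
  rw [hmain s hs, uniformHalfsphere, cond_apply hhalf, hK]

/-- The coordinates of a vector in an orthonormal basis, the first of them separately. -/
noncomputable def coord {d : ℕ} (b : OrthonormalBasis (Fin (d + 1)) ℝ (Ambient d))
    (u : Ambient d) : ℝ × (Fin d → ℝ) :=
  (inner ℝ u (b 0), fun j => inner ℝ u (b j.succ))

theorem vec_coord {d : ℕ} (b : OrthonormalBasis (Fin (d + 1)) ℝ (Ambient d)) (u : Ambient d) :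
    vec b (coord b u) = u := by
  conv_rhs => rw [← b.sum_repr' u, Fin.sum_univ_succ]
  rw [vec_apply]
  simp only [coord, real_inner_comm]

theorem coord_vec {d : ℕ} (b : OrthonormalBasis (Fin (d + 1)) ℝ (Ambient d))
    (p : ℝ × (Fin d → ℝ)) : coord b (vec b p) = p :=
  Prod.ext (inner_vec_zero b p) (funext (inner_vec_succ b p))

theorem measurable_coord {d : ℕ} (b : OrthonormalBasis (Fin (d + 1)) ℝ (Ambient d)) :
    Measurable (coord b) := by
  unfold coord
  fun_prop

theorem Generic.ne_zero {d n : ℕ} {p : Fin n → ℝ × (Fin d → ℝ)} (hp : Generic p)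
    (hn : d + 1 ≤ n) (b : OrthonormalBasis (Fin (d + 1)) ℝ (Ambient d)) (i : Fin n) :
    vec b (p i) ≠ 0 :=
  (hp.generalPosition hn b).ne_zero i

/-- The expected surface area of the spherical hull of independent uniform points of a
halfsphere. -/
theorem lintegral_surfaceArea_polytope {m n : ℕ} (hn : m + 1 < n) (e : Sph (m + 1)) :
    AEMeasurable (fun x : Fin n → Sph (m + 1) => surfaceArea (polytope x))
      (Measure.pi fun _ => uniformHalfsphere e) ∧
    ∫⁻ x : Fin n → Sph (m + 1), surfaceArea (polytope x)
      ∂(Measure.pi fun _ => uniformHalfsphere e) =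
      n.choose (m + 1) * ((ENNReal.ofReal (radialConst m))⁻¹ *
        ENNReal.ofReal (facetConst m * omega (m + 1) *
        ∫ x in (0 : ℝ)..Real.pi, (1 - x / Real.pi) ^ (n - (m + 1)) * Real.sin x ^ m)) := by
  obtain ⟨b, hb⟩ := exists_orthonormalBasis_zero_eq (e : Ambient (m + 1)) (norm_eq_of_mem_sphere e)
  have hdir : Measurable fun p => direction e (vec b p) :=
    (measurable_direction e).comp (measurePreserving_vec b).measurable
  let T : (Fin n → ℝ × (Fin (m + 1) → ℝ)) → Fin n → Sph (m + 1) := fun p i =>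
    direction e (vec b (p i))
  have hT : Measurable T := measurable_pi_iff.2 fun i => hdir.comp (measurable_pi_apply i)
  have hmap : (Measure.pi fun _ : Fin n => uniformHalfsphere e) =
      (Measure.pi fun _ => halfGaussian (m + 1)).map T := by
    have hs : ∀ i : Fin n, SigmaFinite ((halfGaussian (m + 1)).map fun p =>
        direction e (vec b p)) := fun _ =>
      have := Measure.isProbabilityMeasure_map (μ := halfGaussian (m + 1)) hdir.aemeasurable
      inferInstance
    rw [← map_direction_halfGaussian e hb, ← Measure.pi_map_pi fun _ => hdir.aemeasurable]
  have hscale : ∀ p, Generic p → ∃ r : Fin n → ℝ, (∀ i, 0 < r i) ∧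
      ∀ i, (T p i : Ambient (m + 1)) = vec b (r i • p i) := by
    intro p hp
    have h0 := hp.ne_zero hn b
    refine ⟨fun i => ‖vec b (p i)‖⁻¹, fun i => inv_pos.2 (norm_pos_iff.2 (h0 i)), fun i => ?_⟩
    rw [map_smul]
    exact coe_direction e (h0 i)
  let G : (Fin n → ℝ × (Fin (m + 1) → ℝ)) → ℝ≥0∞ := fun p =>
    ∑ I : {I : Finset (Fin n) // I.card = m + 1},
      (ENNReal.ofReal (radialConst m))⁻¹ * facetTerm I.1 I.2 p
  have hGm : Measurable G := Finset.measurable_fun_sum _ fun I _ =>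
    (measurable_facetTerm I.1 I.2).const_mul _
  have hC : Measurable fun (x : Fin n → Sph (m + 1)) i => coord b (x i) :=
    measurable_pi_iff.2 fun i =>
      (measurable_coord b).comp (measurable_subtype_coe.comp (measurable_pi_apply i))
  have hae : ∀ᵐ x ∂(Measure.pi fun _ : Fin n => uniformHalfsphere e),
      Generic fun i => coord b (x i : Ambient (m + 1)) := by
    rw [hmap]
    refine (ae_map_iff hT.aemeasurable (hC measurableSet_generic)).2 ?_
    filter_upwards [ae_generic (m + 1) n] with p hp
    obtain ⟨r, hr, hTp⟩ := hscale p hp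
    simp only [hTp, coord_vec]
    exact hp.smul hr
  have hmeas : AEMeasurable (fun x : Fin n → Sph (m + 1) => surfaceArea (polytope x))
      (Measure.pi fun _ => uniformHalfsphere e) := by
    -- At generic points the surface area coincides with a finite sum of measurable terms in the
    -- coordinates, which serves as its measurable representative.
    refine ⟨_, hGm.comp hC, ?_⟩
    filter_upwards [hae] with x hx
    have := surfaceArea_hull_vec hx hn b
    simp only [vec_coord] at this
    exact this
  refine ⟨hmeas, ?_⟩
  rw [hmap] at hmeas ⊢
  rw [lintegral_map' hmeas hT.aemeasurable]
  have hcongr : ∫⁻ p, surfaceArea (polytope (T p)) ∂(Measure.pi fun _ => halfGaussian (m + 1)) =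
      ∫⁻ p, G p ∂(Measure.pi fun _ => halfGaussian (m + 1)) := by
    refine lintegral_congr_ae ?_
    filter_upwards [ae_generic (m + 1) n] with p hp
    obtain ⟨r, hr, hTp⟩ := hscale p hp
    simp only [G]
    rw [← surfaceArea_hull_vec hp hn b, polytope, sphericalHull, sphericalHull]
    simp only [hTp, map_smul]
    rw [hull_range_smul hr]
  have hconst : (ENNReal.ofReal (radialConst m))⁻¹ ≠ ∞ := by
    simpa using radialConst_pos m
  rw [hcongr, lintegral_finsetSum _ fun I _ => (measurable_facetTerm I.1 I.2).const_mul _]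
  simp only [lintegral_const_mul' _ _ hconst, lintegral_facetTerm hn]
  rw [Finset.sum_const, Finset.card_univ, Fintype.card_finset_len, Fintype.card_fin, nsmul_eq_mul]

/-! ### The value of the constant -/

/-- The powers of √(2π) collapse to π^(-(m+1)). What remains beside the factor m + 1 is a Gamma
quotient, which Legendre duplication at (m+1)/2 identifies with the radial constant, so that the
latter cancels in the expected area. -/
theorem facetConst_eq (m : ℕ) :
    facetConst m = radialConst m * ((m + 1 : ℕ) / Real.pi ^ (m + 1)) := by
  have hpi := Real.pi_pos
  set s := √(2 * Real.pi) with hs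
  have hs0 : 0 < s := Real.sqrt_pos.2 (by positivity)
  have hss : s ^ 2 = 2 * Real.pi := Real.sq_sqrt (by positivity)
  have hG1 : 0 < Real.Gamma (((m : ℝ) + 1) / 2) := Real.Gamma_pos_of_pos (by positivity)
  have hG2 : 0 < Real.Gamma (((m + 1 : ℕ) + 1 : ℝ) / 2) := Real.Gamma_pos_of_pos (by positivity)
  have hdup := Real.Gamma_mul_Gamma_add_half (((m : ℝ) + 1) / 2)
  rw [show ((m : ℝ) + 1) / 2 + 1 / 2 = ((m + 1 : ℕ) + 1 : ℝ) / 2 by push_cast; ring,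
    show 2 * (((m : ℝ) + 1) / 2) = m + 1 by ring, Real.Gamma_nat_eq_factorial,
    show (1 : ℝ) - (m + 1) = -(m : ℝ) by ring] at hdup
  have hsqrt : √(Real.pi / 2) * √2 = √Real.pi := by
    rw [← Real.sqrt_mul (by positivity)]
    congr 1
    ring
  have h2 : √2 = (2 : ℝ) ^ (1 / 2 : ℝ) := Real.sqrt_eq_rpow 2
  have hrad : m.factorial * (√(Real.pi / 2) /
      ((1 / 2 : ℝ) ^ (-((m + 1 : ℕ) + 1 : ℝ) / 2) * (1 / 2) *
        Real.Gamma (((m + 1 : ℕ) + 1 : ℝ) / 2))) = radialConst m := by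
    have hp1 : (1 / 2 : ℝ) ^ (-((m + 1 : ℕ) + 1 : ℝ) / 2) * (1 / 2) = (2 : ℝ) ^ ((m : ℝ) / 2) := by
      rw [one_div, Real.inv_rpow (by norm_num), ← Real.rpow_neg (by norm_num), ← Real.rpow_neg_one,
        ← Real.rpow_add (by norm_num)]
      congr 1
      push_cast
      ring
    have hp2 : (1 / 2 : ℝ) ^ (-((m : ℝ) + 1) / 2) * (1 / 2) * √2 = (2 : ℝ) ^ ((m : ℝ) / 2) := by
      rw [one_div, Real.inv_rpow (by norm_num), ← Real.rpow_neg (by norm_num), ← Real.rpow_neg_one,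
        h2, ← Real.rpow_add (by norm_num), ← Real.rpow_add (by norm_num)]
      congr 1
      ring
    have hp3 : (2 : ℝ) ^ (-(m : ℝ)) * ((2 : ℝ) ^ ((m : ℝ) / 2) * (2 : ℝ) ^ ((m : ℝ) / 2)) = 1 := by
      rw [← Real.rpow_add (by norm_num), ← Real.rpow_add (by norm_num)]
      norm_num
    have hp0 : 0 < (2 : ℝ) ^ ((m : ℝ) / 2) := by positivity
    rw [hp1, radialConst, ← mul_div_assoc, div_eq_iff (by positivity)]
    have h2pos : 0 < √2 := by positivity
    have hpipos : 0 < √Real.pi := by positivity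
    apply mul_right_cancel₀ h2pos.ne'
    rw [mul_assoc, hsqrt]
    calc (m.factorial : ℝ) * √Real.pi = m.factorial * √Real.pi * 1 := by ring
      _ = (m.factorial * (2 : ℝ) ^ (-(m : ℝ)) * √Real.pi) *
          ((2 : ℝ) ^ ((m : ℝ) / 2) * (2 : ℝ) ^ ((m : ℝ) / 2)) := by rw [← hp3]; ring
      _ = _ := by rw [← hdup]; nth_rewrite 1 [← hp2]; ring
  have hpow : (2 * s⁻¹ ^ (m + 2)) ^ (m + 1) * s ^ (m * (m + 1)) = 1 / Real.pi ^ (m + 1) := by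
    have : s ^ (m + 2) = s ^ m * (2 * Real.pi) := by rw [pow_add, hss]
    rw [pow_mul, ← mul_pow, inv_pow, this]
    rw [show 2 * (s ^ m * (2 * Real.pi))⁻¹ * s ^ m = 1 / Real.pi by field_simp, div_pow, one_pow]
  rw [facetConst, simplexConst, ← hrad]
  calc _ = ((2 * s⁻¹ ^ (m + 2)) ^ (m + 1) * s ^ (m * (m + 1))) * ((m + 1 : ℝ) *
        (m.factorial * (√(Real.pi / 2) / ((1 / 2 : ℝ) ^ (-((m + 1 : ℕ) + 1 : ℝ) / 2) * (1 / 2) *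
        Real.Gamma (((m + 1 : ℕ) + 1 : ℝ) / 2))))) := by ring
    _ = _ := by rw [hpow]; push_cast; ring

/-! ### Asymptotic expansion -/

theorem abs_sin_sub_add_le {x : ℝ} (hx : 0 ≤ x) : |Real.sin x - x + x ^ 3 / 6| ≤ x ^ 4 := by
  rcases le_total x 1 with h | h
  · have h1 := Real.sin_bound (abs_le.2 ⟨by linarith, h⟩)
    rw [abs_of_nonneg hx] at h1
    have h2 : x ^ 5 ≤ x ^ 4 := pow_le_pow_of_le_one hx h (by norm_num)
    have h3 : 0 ≤ x ^ 5 := by positivity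
    rw [show Real.sin x - x + x ^ 3 / 6 = Real.sin x - (x - x ^ 3 / 6) by ring]
    linarith
  · have h1 := Real.sin_le hx
    have h2 := Real.sin_ge_sub_cube hx
    have h3 : x ^ 3 ≤ x ^ 4 := pow_le_pow_right₀ h (by norm_num)
    have h4 : 0 ≤ x ^ 3 := by positivity
    rw [abs_le]
    constructor <;> linarith

/-- The expansion of a power of the sine to second order. -/
theorem exists_abs_sin_pow_sub_le (m : ℕ) : ∃ K : ℝ, 0 ≤ K ∧ ∀ x ∈ Set.Icc 0 Real.pi,
    |Real.sin x ^ m - x ^ m + m / 6 * x ^ (m + 2)| ≤ K * x ^ (m + 3) := by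
  induction m with
  | zero => exact ⟨0, le_rfl, fun x _ => by simp⟩
  | succ m ih =>
    obtain ⟨K, hK, h⟩ := ih
    refine ⟨K + 1 + m, by positivity, fun x hx => ?_⟩
    have hx0 := hx.1
    have hx4 : x ≤ 4 := hx.2.trans Real.pi_le_four
    have hs : |Real.sin x| ≤ x := by
      rw [abs_of_nonneg (Real.sin_nonneg_of_nonneg_of_le_pi hx.1 hx.2)]
      exact Real.sin_le hx0
    have hs2 : |x - Real.sin x| ≤ x ^ 3 / 6 := by
      have := Real.abs_sub_sin_le x
      rwa [abs_of_nonneg hx0] at this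
    have e1 : |Real.sin x * (Real.sin x ^ m - x ^ m + m / 6 * x ^ (m + 2))| ≤
        x * (K * x ^ (m + 3)) := by
      rw [abs_mul]
      exact mul_le_mul hs (h x hx) (abs_nonneg _) hx0
    have e2 : |x ^ m * (Real.sin x - x + x ^ 3 / 6)| ≤ x ^ m * x ^ 4 := by
      rw [abs_mul, abs_of_nonneg (pow_nonneg hx0 m)]
      exact mul_le_mul_of_nonneg_left (abs_sin_sub_add_le hx0) (pow_nonneg hx0 m)
    have e3 : |m / 6 * x ^ (m + 2) * (x - Real.sin x)| ≤ m * x ^ (m + 4) := by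
      have h0 : 0 ≤ m / 6 * x ^ (m + 2) := by positivity
      rw [abs_mul, abs_of_nonneg h0]
      refine (mul_le_mul_of_nonneg_left hs2 h0).trans ?_
      have : (m : ℝ) / 6 * x ^ (m + 2) * (x ^ 3 / 6) = m * x ^ (m + 4) * (x / 36) := by ring
      rw [this]
      exact mul_le_of_le_one_right (by positivity) (by linarith)
    -- The error splits into sin x times the previous error, x^m times the cubic Taylor error of the
    -- sine, and the error from replacing sin x by x in the second-order term.
    have hsum : Real.sin x ^ (m + 1) - x ^ (m + 1) + ((m + 1 : ℕ) : ℝ) / 6 * x ^ (m + 1 + 2) =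
        Real.sin x * (Real.sin x ^ m - x ^ m + m / 6 * x ^ (m + 2)) +
        x ^ m * (Real.sin x - x + x ^ 3 / 6) + m / 6 * x ^ (m + 2) * (x - Real.sin x) := by
      push_cast
      ring
    rw [hsum]
    refine (abs_add_three _ _ _).trans ?_
    calc _ ≤ x * (K * x ^ (m + 3)) + x ^ m * x ^ 4 + m * x ^ (m + 4) := by linarith
      _ = _ := by ring

/-- The moments of a power of `1 - x / π`. -/
theorem integral_one_sub_div_pow_mul_pow (k : ℕ) : ∀ N : ℕ,
    (∫ x in (0 : ℝ)..Real.pi, (1 - x / Real.pi) ^ N * x ^ k) =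
      Real.pi ^ (k + 1) * N.factorial * k.factorial / (N + k + 1).factorial := by
  have hpi := Real.pi_pos
  have hlin : ∀ x : ℝ, HasDerivAt (fun x => 1 - x / Real.pi) (-(1 / Real.pi)) x := fun x =>
    ((hasDerivAt_id x).div_const Real.pi).const_sub 1
  induction k with
  | zero =>
    intro N
    have hd : ∀ x ∈ Set.uIcc 0 Real.pi, HasDerivAt
        (fun x => -(Real.pi / (N + 1)) * (1 - x / Real.pi) ^ (N + 1))
        ((1 - x / Real.pi) ^ N * x ^ 0) x := by
      intro x _
      refine (((hlin x).pow (N + 1)).const_mul (-(Real.pi / (N + 1)))).congr_deriv ?_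
      rw [Nat.add_sub_cancel]
      push_cast
      field_simp
    rw [intervalIntegral.integral_eq_sub_of_hasDerivAt hd
      (Continuous.intervalIntegrable (by fun_prop) _ _)]
    rw [div_self hpi.ne', sub_self, zero_pow N.succ_ne_zero, add_zero, Nat.factorial_succ,
      Nat.factorial_zero]
    have := N.factorial_ne_zero
    push_cast
    field_simp
    simp
  | succ k ih =>
    intro N
    -- Integration by parts lowers the power of x and raises the power of 1 - x/π; the boundary
    -- terms vanish.
    have hd : ∀ x ∈ Set.uIcc 0 Real.pi, HasDerivAt
        (fun x => -(Real.pi / (N + 1)) * ((1 - x / Real.pi) ^ (N + 1) * x ^ (k + 1)))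
        ((1 - x / Real.pi) ^ N * x ^ (k + 1) -
          Real.pi / (N + 1) * (k + 1) * ((1 - x / Real.pi) ^ (N + 1) * x ^ k)) x := by
      intro x _
      refine ((((hlin x).pow (N + 1)).mul (hasDerivAt_pow (k + 1) x)).const_mul
        (-(Real.pi / (N + 1)))).congr_deriv ?_
      simp only [Nat.add_sub_cancel, Pi.pow_apply]
      generalize 1 - x / Real.pi = y
      push_cast
      field_simp
      ring
    have h1 := intervalIntegral.integral_eq_sub_of_hasDerivAt hd
      (Continuous.intervalIntegrable (by fun_prop) _ _)
    rw [intervalIntegral.integral_sub (Continuous.intervalIntegrable (by fun_prop) _ _)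
      (Continuous.intervalIntegrable (by fun_prop) _ _), intervalIntegral.integral_const_mul,
      ih (N + 1), div_self hpi.ne', sub_self, zero_pow N.succ_ne_zero,
      zero_pow k.succ_ne_zero] at h1
    rw [eq_add_of_sub_eq h1, show N + 1 + k + 1 = N + (k + 1) + 1 by ring, Nat.factorial_succ N,
      Nat.factorial_succ k]
    have := (N + (k + 1) + 1).factorial_ne_zero
    push_cast
    field_simp
    ring

theorem cast_choose_three (m : ℕ) : (((m + 2).choose 3 : ℕ) : ℝ) = (m + 2) * (m + 1) * m / 6 := by
  have h := Nat.descFactorial_eq_factorial_mul_choose (m + 2) 3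
  have h2 : (m + 2).descFactorial 3 = (m + 2) * (m + 1) * m := by
    simp only [Nat.descFactorial_succ, Nat.descFactorial_zero]
    rw [show m + 2 - 2 = m by omega, show m + 2 - 1 = m + 1 by omega, Nat.sub_zero]
    ring
  rw [h2, show Nat.factorial 3 = 6 by rfl] at h
  have h3 : (((m + 2) * (m + 1) * m : ℕ) : ℝ) = ((6 * (m + 2).choose 3 : ℕ) : ℝ) := by rw [h]
  push_cast at h3
  linarith

/-- The difference is -(3n + 2)/(n²(n+1)(n+2)), and 3n + 2 ≤ 5n once n ≥ 1. -/
theorem abs_inv_mul_sub_inv_sq_le {n : ℝ} (hn : 1 ≤ n) :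
    |1 / ((n + 1) * (n + 2)) - (n ^ 2)⁻¹| ≤ 5 * (n ^ 3)⁻¹ := by
  have h0 : 0 < n := by linarith
  have h : 1 / ((n + 1) * (n + 2)) - (n ^ 2)⁻¹ =
      -((3 * n + 2) / (n ^ 2 * ((n + 1) * (n + 2)))) := by
    field_simp
    ring
  rw [h, abs_neg, abs_of_nonneg (by positivity), ← div_eq_mul_inv,
    div_le_div_iff₀ (by positivity) (by positivity)]
  have h1 : 3 * n + 2 ≤ 5 * n := by linarith
  calc (3 * n + 2) * n ^ 3 ≤ (5 * n) * n ^ 3 := by gcongr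
    _ = 5 * (n ^ 2 * (n * n)) := by ring
    _ ≤ 5 * (n ^ 2 * ((n + 1) * (n + 2))) := by
      gcongr <;> linarith

/-- The asymptotic expansion of the expected surface area. -/
theorem exists_abs_integral_sub_le (m : ℕ) : ∃ C : ℝ, ∀ n : ℕ, m + 2 ≤ n →
    |((m + 1 : ℕ) / Real.pi ^ (m + 1) * (n.choose (m + 1) : ℝ)) *
        (∫ x in (0 : ℝ)..Real.pi, (1 - x / Real.pi) ^ (n - (m + 1)) * Real.sin x ^ m) -
        (1 - ((m + 2).choose 3 : ℝ) * Real.pi ^ 2 * ((n : ℝ) ^ 2)⁻¹)| ≤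
      C * ((n : ℝ) ^ 3)⁻¹ := by
  obtain ⟨K, hK, hsin⟩ := exists_abs_sin_pow_sub_le m
  have hpi := Real.pi_pos
  -- The first summand bounds the remainder of the sine expansion through the moment of x^(m+3); the
  -- second pays for replacing 1/((n+1)(n+2)) by n⁻².
  refine ⟨K * ((m + 1) * (m + 2) * (m + 3) * Real.pi ^ 3) +
    ((m + 2).choose 3 : ℝ) * Real.pi ^ 2 * 5, fun n hn => ?_⟩
  obtain ⟨N, rfl⟩ : ∃ N, n = N + (m + 1) := ⟨n - (m + 1), by omega⟩
  rw [Nat.add_sub_cancel]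
  set ν : ℝ := ((N + (m + 1) : ℕ) : ℝ) with hν
  have hν1 : 1 ≤ ν := by
    rw [hν]
    exact_mod_cast (by omega : 1 ≤ N + (m + 1))
  have hνN : ν = N + m + 1 := by rw [hν]; push_cast; ring
  set Q : ℝ := (m + 1 : ℕ) / Real.pi ^ (m + 1) * ((N + (m + 1)).choose (m + 1) : ℝ) with hQ
  have hQ0 : 0 ≤ Q := by positivity
  have hfN : (N.factorial : ℝ) ≠ 0 := by exact_mod_cast N.factorial_ne_zero
  have hfm : (m.factorial : ℝ) ≠ 0 := by exact_mod_cast m.factorial_ne_zero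
  have hfn : ((N + m + 1).factorial : ℝ) ≠ 0 := by exact_mod_cast (N + m + 1).factorial_ne_zero
  have hm1 : ((m : ℝ) + 1) ≠ 0 := by positivity
  have hQ' : Q = (N + m + 1).factorial / (Real.pi ^ (m + 1) * N.factorial * m.factorial) := by
    have h := Nat.choose_mul_factorial_mul_factorial (show m + 1 ≤ N + (m + 1) by omega)
    rw [Nat.add_sub_cancel, Nat.factorial_succ m, ← Nat.add_assoc] at h
    rw [hQ, ← h]
    push_cast
    rw [← Nat.add_assoc]
    field_simp
  -- The prefactor is exactly the normalisation of this Beta integral, so the leading term is 1 with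
  -- no error.
  have hI0 : Q * (∫ x in (0 : ℝ)..Real.pi, (1 - x / Real.pi) ^ N * x ^ m) = 1 := by
    rw [integral_one_sub_div_pow_mul_pow, hQ']
    field_simp
  have hI2 : Q * (∫ x in (0 : ℝ)..Real.pi, (1 - x / Real.pi) ^ N * x ^ (m + 2)) =
      (m + 1) * (m + 2) * Real.pi ^ 2 * (1 / ((ν + 1) * (ν + 2))) := by
    rw [integral_one_sub_div_pow_mul_pow, hQ', hνN,
      show N + (m + 2) + 1 = N + m + 1 + 1 + 1 by ring,
      Nat.factorial_succ (N + m + 1 + 1), Nat.factorial_succ (N + m + 1),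
      show m + 2 = m + 1 + 1 by ring, Nat.factorial_succ (m + 1), Nat.factorial_succ m]
    push_cast
    field_simp
    ring
  have hI3 : Q * (∫ x in (0 : ℝ)..Real.pi, (1 - x / Real.pi) ^ N * x ^ (m + 3)) =
      (m + 1) * (m + 2) * (m + 3) * Real.pi ^ 3 * (1 / ((ν + 1) * (ν + 2) * (ν + 3))) := by
    rw [integral_one_sub_div_pow_mul_pow, hQ', hνN,
      show N + (m + 3) + 1 = N + m + 1 + 1 + 1 + 1 by ring,
      Nat.factorial_succ (N + m + 1 + 1 + 1), Nat.factorial_succ (N + m + 1 + 1),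
      Nat.factorial_succ (N + m + 1),
      show m + 3 = m + 1 + 1 + 1 by ring, Nat.factorial_succ (m + 1 + 1),
      Nat.factorial_succ (m + 1), Nat.factorial_succ m]
    push_cast
    field_simp
    ring
  have hint : ∀ {f : ℝ → ℝ}, Continuous f → IntervalIntegrable f volume 0 Real.pi :=
    fun hf => hf.intervalIntegrable _ _
  have hR : |(∫ x in (0 : ℝ)..Real.pi, (1 - x / Real.pi) ^ N * Real.sin x ^ m) -
      (∫ x in (0 : ℝ)..Real.pi, (1 - x / Real.pi) ^ N * x ^ m) +
      m / 6 * ∫ x in (0 : ℝ)..Real.pi, (1 - x / Real.pi) ^ N * x ^ (m + 2)| ≤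
      K * ∫ x in (0 : ℝ)..Real.pi, (1 - x / Real.pi) ^ N * x ^ (m + 3) := by
    rw [← intervalIntegral.integral_const_mul, ← intervalIntegral.integral_const_mul,
      ← intervalIntegral.integral_sub (hint (by fun_prop)) (hint (by fun_prop)),
      ← intervalIntegral.integral_add (hint (by fun_prop)) (hint (by fun_prop))]
    rw [← Real.norm_eq_abs]
    refine intervalIntegral.norm_integral_le_of_norm_le hpi.le
      (Filter.Eventually.of_forall fun x hx => ?_) (hint (by fun_prop))
    have h1 : 0 ≤ 1 - x / Real.pi := by
      rw [sub_nonneg, div_le_one hpi]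
      exact hx.2
    have h2 : (1 - x / Real.pi) ^ N * Real.sin x ^ m - (1 - x / Real.pi) ^ N * x ^ m +
        m / 6 * ((1 - x / Real.pi) ^ N * x ^ (m + 2)) =
        (1 - x / Real.pi) ^ N * (Real.sin x ^ m - x ^ m + m / 6 * x ^ (m + 2)) := by ring
    rw [h2, norm_mul, Real.norm_of_nonneg (pow_nonneg h1 N), Real.norm_eq_abs]
    calc _ ≤ (1 - x / Real.pi) ^ N * (K * x ^ (m + 3)) :=
          mul_le_mul_of_nonneg_left (hsin x ⟨hx.1.le, hx.2⟩) (pow_nonneg h1 N)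
      _ = _ := by ring
  have hR' := mul_le_mul_of_nonneg_left hR hQ0
  rw [← abs_of_nonneg hQ0, ← abs_mul, abs_of_nonneg hQ0, mul_add, mul_sub, hI0,
    mul_left_comm Q, hI2, mul_left_comm Q, hI3] at hR'
  have hinv3 : 1 / ((ν + 1) * (ν + 2) * (ν + 3)) ≤ (ν ^ 3)⁻¹ := by
    rw [one_div]
    refine inv_anti₀ (by positivity) ?_
    calc ν ^ 3 = ν * ν * ν := by ring
      _ ≤ (ν + 1) * (ν + 2) * (ν + 3) := by gcongr <;> linarith
  have hinv2 := abs_inv_mul_sub_inv_sq_le hν1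
  have hch := cast_choose_three m
  set c3 : ℝ := ((m + 2).choose 3 : ℝ)
  have hc3 : 0 ≤ c3 := Nat.cast_nonneg _
  have e1 : K * ((m + 1) * (m + 2) * (m + 3) * Real.pi ^ 3 * (1 / ((ν + 1) * (ν + 2) * (ν + 3)))) ≤
      K * ((m + 1) * (m + 2) * (m + 3) * Real.pi ^ 3) * (ν ^ 3)⁻¹ := by
    rw [← mul_assoc K]
    exact mul_le_mul_of_nonneg_left hinv3 (by positivity)
  have e2 : |c3 * Real.pi ^ 2 * (1 / ((ν + 1) * (ν + 2)) - (ν ^ 2)⁻¹)| ≤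
      c3 * Real.pi ^ 2 * 5 * (ν ^ 3)⁻¹ := by
    rw [abs_mul, abs_of_nonneg (by positivity : 0 ≤ c3 * Real.pi ^ 2), mul_assoc (c3 * Real.pi ^ 2)]
    exact mul_le_mul_of_nonneg_left hinv2 (by positivity)
  -- The second-order moment enters with coefficient m(m+1)(m+2)π²/6, which is C(m+2, 3) π².
  have hdecomp : Q * (∫ x in (0 : ℝ)..Real.pi, (1 - x / Real.pi) ^ N * Real.sin x ^ m) -
      (1 - c3 * Real.pi ^ 2 * (ν ^ 2)⁻¹) =
      (Q * (∫ x in (0 : ℝ)..Real.pi, (1 - x / Real.pi) ^ N * Real.sin x ^ m) - 1 +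
        m / 6 * ((m + 1) * (m + 2) * Real.pi ^ 2 * (1 / ((ν + 1) * (ν + 2))))) -
      c3 * Real.pi ^ 2 * (1 / ((ν + 1) * (ν + 2)) - (ν ^ 2)⁻¹) := by
    rw [hch]
    ring
  rw [hdecomp]
  refine (abs_sub _ _).trans ?_
  linarith

end RandomSphericalPolytope

open RandomSphericalPolytope in
/-- For the spherical convex hull `P_n` of `n ≥ d + 1` independent uniform random points of a
closed halfsphere of `S^d`: the explicit formula for the expected surface area, and its asymptotic
expansion, in which the constant of the `O(n⁻³)` term depends only on `d`. The expectation of the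
`[0, ∞]`-valued random variable `S(P_n)` is its integral `∫⁻`, which the formula shows to be
finite. -/
theorem theoremT2 (d : ℕ) (hd : 2 ≤ d) :
    ∃ C : ℝ, ∀ (e : Sph d) (n : ℕ), d + 1 ≤ n →
      ∀ (Ω : Type*) [MeasurableSpace Ω] (Pr : Measure Ω) [IsProbabilityMeasure Pr]
        (X : Fin n → Ω → Sph d),
        iIndepFun X Pr → (∀ i, HasLaw (X i) (uniformHalfsphere e) Pr) →
          AEMeasurable (fun ω => surfaceArea (polytope fun i => X i ω)) Pr ∧
          ∫⁻ ω, surfaceArea (polytope fun i => X i ω) ∂Pr =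
            ENNReal.ofReal (d * omega d / Real.pi ^ d * (n.choose d : ℝ) *
              ∫ x in (0 : ℝ)..Real.pi, (1 - x / Real.pi) ^ (n - d) * Real.sin x ^ (d - 1)) ∧
          |(∫⁻ ω, surfaceArea (polytope fun i => X i ω) ∂Pr).toReal -
              omega d * (1 - ((d + 1).choose 3 : ℝ) * Real.pi ^ 2 * ((n : ℝ) ^ 2)⁻¹)| ≤
            C * ((n : ℝ) ^ 3)⁻¹ := by
  obtain ⟨m, rfl⟩ : ∃ m, d = m + 1 := ⟨d - 1, by omega⟩
  obtain ⟨C, hC⟩ := exists_abs_integral_sub_le m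
  have hω := omega_pos m.succ_pos
  refine ⟨omega (m + 1) * C, fun e n hn Ω _ Pr _ X hind hlaw => ?_⟩
  -- Independence makes the product measure the joint law, so the whole statement is transported
  -- from the canonical model.
  have hjoint := hind.hasLaw_pi hlaw
  obtain ⟨hmeas, hval⟩ := lintegral_surfaceArea_polytope (m := m) (n := n) (by omega) e
  rw [← hjoint.map_eq] at hmeas hval
  set J := ∫ x in (0 : ℝ)..Real.pi, (1 - x / Real.pi) ^ (n - (m + 1)) * Real.sin x ^ m with hJ
  have hκ := radialConst_pos m
  have hE : ∫⁻ ω, surfaceArea (polytope fun i => X i ω) ∂Pr =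
      ENNReal.ofReal ((m + 1 : ℕ) * omega (m + 1) / Real.pi ^ (m + 1) *
        (n.choose (m + 1) : ℝ) * J) := by
    rw [← lintegral_map' hmeas hjoint.aemeasurable, hval, facetConst_eq,
      ← ENNReal.ofReal_inv_of_pos hκ, ← ENNReal.ofReal_mul (by positivity),
      ← ENNReal.ofReal_natCast, ← ENNReal.ofReal_mul (by positivity)]
    congr 1
    field_simp
  have hJ0 : 0 ≤ J := by
    refine intervalIntegral.integral_nonneg Real.pi_pos.le fun x hx => mul_nonneg
      (pow_nonneg ?_ _) (pow_nonneg (Real.sin_nonneg_of_nonneg_of_le_pi hx.1 hx.2) _)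
    rw [sub_nonneg, div_le_one Real.pi_pos]
    exact hx.2
  refine ⟨hmeas.comp_aemeasurable hjoint.aemeasurable, hE, ?_⟩
  have hpi := Real.pi_pos
  rw [hE, ENNReal.toReal_ofReal (by positivity)]
  have h := mul_le_mul_of_nonneg_left (hC n (by omega)) hω.le
  rw [← abs_of_pos hω, ← abs_mul, abs_of_pos hω, ← hJ] at h
  calc _ = |omega (m + 1) * ((m + 1 : ℕ) / Real.pi ^ (m + 1) * (n.choose (m + 1) : ℝ) * J -
        (1 - ((m + 2).choose 3 : ℝ) * Real.pi ^ 2 * ((n : ℝ) ^ 2)⁻¹))| := by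
        congr 1
        ring
    _ ≤ _ := h
    _ = _ := by ring
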